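/- **Large volume limit of Yang's $S^1$-symmetric Einstein–Bogomol'nyi metrics.** *Setting.* Let $N'\ge 1$ be an integer, $L=\mathcal O_{\mathbf P^1}(2N')$, $\phi=z_0^{N'}z_1^{N'}$ (a strictly polystable Higgs field: two zeros $0,\infty$ of equal multiplicity $N'$), $\tau=1$, and $\alpha=\frac1{2N'}$ (so that $\alpha\tau\deg L=1$). On a Riemann surface with a line bundle $L$ and holomorphic section $\phi$, a Kähler metric $\omega$ and a Hermitian metric $h$ on $L$ form an Einstein–Bogomol'nyi (EB) metric if $$iF_h+\tfrac12(|\phi|_h^2-\tau)\omega=0,\qquad S_\omega+\alpha(\Delta_\omega+\tau)(|\phi|_h^2-\tau)=0,$$ where $F_h=-\partial\bar\partial\log h$, $\Delta_\omega f=\operatorname{tr}_\omega(-2i\partial\bar\partial f)$, $S_\omega=\operatorname{tr}_\omega\operatorname{Ric}\omega$. Write $z=z_1/z_0=e^{t+i\theta}$ on $\mathbf C^*\subset\mathbf P^1$. For $\mathfrak b>0$ Yang's solution $(g_{\mathfrak b},h_{\mathfrak b})$ is the pair consisting of a smooth Kähler metric on $\mathbf P^1$ and a smooth Hermitian metric on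 $L$ given on $\mathbf C^*$ by $$g_{\mathfrak b}=\tfrac1{\lambda}e^{2\alpha(u-e^{u})}(dt^2+d\theta^2),\qquad |\phi|^2_{h_{\mathfrak b}}=|z^{N'}|^2h_{\mathfrak b}=e^{u},$$ where $u=u^{\mathfrak b}(t)$, $\lambda=\lambda_{\mathfrak b}>0$ satisfy $$u''=\tfrac1\lambda e^{2\alpha(u-e^u)}(e^u-1)\ \text{ on }\mathbf R,\quad u(0)=-\mathfrak b,\ u'(0)=0,\quad \lim_{t\to\pm\infty}u'(t)=\mp 2N'.\tag{1}$$ For $\mathfrak c>0$ consider also the limit problem $$u''=\tfrac1\lambda e^{2\alpha(u-e^u)}(e^u-1)\ \text{ on }\mathbf R,\quad u(0)=-\mathfrak c,\quad \lim_{t\to-\infty}u'=2N',\ \lim_{t\to+\infty}u'=0,\quad \lambda>0.\tag{2}$$ *Statement.* 0. For every $\mathfrak b>0$ there are exactly one $\lambda$ and one $u$ as in (1), and one corresponding smooth pair $(g_{\mathfrak b},h_{\mathfrak b})$ on $\mathbf P^1$; moreover $\lambda_{\mathfrak b}=\frac{1}{2N'e^{2\alpha(\mathfrak b+e^{-\mathfrak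 b})}}$ and $(g_{\mathfrak b},h_{\mathfrak b})$ is an EB metric with Higgs field $\phi$. 1. $\operatorname{diam}(\mathbf P^1,g_{\mathfrak b})\to+\infty$ as $\mathfrak b\to0+$. 2. (Base point on the equator.) Let $p$ be a point with $|z(p)|=1$. As $\mathfrak b\to 0+$, $(\mathbf P^1,g_{\mathfrak b},p)$ converges in the pointed Cheeger–Gromov sense, via the inclusion $\mathbf C^*\subset\mathbf P^1$, to the flat cylinder $g_C=2N'(dt^2+d\theta^2)$ on $\mathbf R\times S^1=\mathbf C^*$; the Hermitian metrics converge to $e^{-2N't}$, whose curvature vanishes, the section is $z^{N'}$, and $|\phi|^2_{h_{\mathfrak b}}\to1$. All convergences are smooth on compact subsets of $\mathbf C^*$. 3. (The limit at a zero.) For every $\mathfrak c>0$ problem (2) has exactly one solution $(\lambda,u)$, and $\lambda=\lambda_0=\frac1{2N'e^{2\alpha}}$. The metrics $g_{(\infty)}=\frac1{\lambda_0}e^{2\alpha(u-e^u)}(dt^2+d\theta^2)$ and $h_{(\infty)}=e^{u}/|z|^{2N'}$ extend uniquely to $\mathbf C$, where they form a smooth $S^1$-invariant EB metric with Higgs field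 $z^{N'}$, and $g_{(\infty)}$ is complete. For $t\ge0$, $$\mathfrak c\,e^{-2N'\sqrt\alpha\,t}\le -u(t)\le \mathfrak c\,\exp\!\Big(-2N'\sqrt\alpha\,e^{-\alpha(e^{-\mathfrak c}-(1-\mathfrak c))-\mathfrak c/2}\,t\Big),$$ and for every $\ell\ge0$, on $t\ge0$, $|\nabla^\ell_{g_C}(g_{(\infty)}-g_C)|=O(u^2)$ and $|\nabla^\ell_{g_C}F_{h_{(\infty)}}|=O(|u|)$; so $g_{(\infty)}$ is asymptotic to $g_C=2N'(dt^2+d\theta^2)$ at an exponential rate and $F_{h_{(\infty)}}$ decays exponentially, with all derivatives. The total string number $\frac1{2\pi}\int_{\mathbf C}iF_{h_{(\infty)}}$ equals $N'$. Uniqueness: every $S^1$-invariant EB metric on $\mathbf C$ with Higgs field $z^{N'}$ (same $\alpha$, $\tau$) that is complete and asymptotic to $g_C$ at an exponential rate with all derivatives as $t\to+\infty$ is the pull-back of $(g_{(\infty)},h_{(\infty)})$ by a dilation: its conformal factor and its weight are $m^2\rho_{(\infty)}(mw)$ and $m^{2N'}h_{(\infty)}(mw)$ for some $m>0$, where $g_{(\infty)}=\rho_{(\infty)}|dw|^2$.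 In particular different $\mathfrak c$ give the same metric up to dilation. 4. (Base point at a zero.) Fix $\mathfrak c>0$. For $0<\mathfrak b<\mathfrak c$ there is exactly one $t_{\mathfrak b}<0$ with $u^{\mathfrak b}(t_{\mathfrak b})=-\mathfrak c$. In the affine coordinate centred at either zero of $\phi$, put $F_{\mathfrak b}(w)=e^{t_{\mathfrak b}}w$, lifted to the bundles by multiplication by $e^{N't_{\mathfrak b}}$ in the standard frames. As $\mathfrak b\to0+$, the pull-backs by $F_{\mathfrak b}$ of $g_{\mathfrak b}$, $h_{\mathfrak b}$ and $\phi$ converge, smoothly on compact subsets of $\mathbf C$, to $g_{(\infty)}$, $h_{(\infty)}$ and $w^{N'}$, where $(g_{(\infty)},h_{(\infty)})$ comes from the solution of (2) for this $\mathfrak c$. In particular the metrics based at a zero of $\phi$ converge in the pointed Cheeger–Gromov sense to $(\mathbf C,g_{(\infty)},0)$. -/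

import Mathlib

open Set Filter Topology MeasureTheory
open scoped ContDiff ENNReal

noncomputable section

namespace EinsteinBogomolnyi

/-! Conventions. A Kähler metric on a Riemann surface is written in a holomorphic coordinate
`z = x + i y` through its conformal factor `ρ > 0`: the Riemannian metric is `ρ (dx² + dy²)` and the
Kähler form is `ω = ρ dx ∧ dy`. A Hermitian metric on a holomorphic line bundle is written in a
holomorphic frame through its positive weight `h`. -/

/-- Coefficient of `i F_h = -i ∂ ∂bar log h` with respect to `dx ∧ dy`. -/
def curv (h : ℂ → ℝ) (z : ℂ) : ℝ :=
  -(1 / 2) * Laplacian.laplacian (fun w => Real.log (h w)) z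

/-- `S_ω = tr_ω Ric ω` for `ω = ρ dx ∧ dy`; this is the Gaussian curvature. -/
def scal (ρ : ℂ → ℝ) (z : ℂ) : ℝ :=
  -(1 / (2 * ρ z)) * Laplacian.laplacian (fun w => Real.log (ρ w)) z

/-- `Δ_ω f = tr_ω (-2 i ∂ ∂bar f)` for `ω = ρ dx ∧ dy` (the nonnegative Laplacian). -/
def lapl (ρ f : ℂ → ℝ) (z : ℂ) : ℝ :=
  -(1 / ρ z) * Laplacian.laplacian f z

/-- The state function `|φ|_h²`. -/
def stateFn (h : ℂ → ℝ) (φ : ℂ → ℂ) (z : ℂ) : ℝ := h z * ‖φ z‖ ^ 2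

/-- The Einstein-Bogomol'nyi equations
`i F_h + (1/2) (|φ|_h² - τ) ω = 0` and `S_ω + α (Δ_ω + τ) (|φ|_h² - τ) = 0`
in a coordinate chart that is the whole of `ℂ`. -/
def SolvesEB (α τ : ℝ) (ρ h : ℂ → ℝ) (φ : ℂ → ℂ) : Prop :=
  ∀ z, curv h z + 1 / 2 * (stateFn h φ z - τ) * ρ z = 0 ∧
    scal ρ z + α * (lapl ρ (fun w => stateFn h φ w - τ) z + τ * (stateFn h φ z - τ)) = 0

/-! ### The projective line -/

/-- The complex projective line. -/
abbrev P1 : Type := Projectivization ℂ (Fin 2 → ℂ)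

/-- Homogeneous coordinates of the point with affine coordinate `z` in the `i`-th affine chart:
`[1 : z]` for `i = 0` and `[z : 1]` for `i = 1`. -/
def homog (i : Fin 2) (z : ℂ) : Fin 2 → ℂ := Function.update (fun _ => z) i 1

theorem homog_ne_zero (i : Fin 2) (z : ℂ) : homog i z ≠ 0 := by
  intro H
  have := congrFun H i
  simp [homog] at this

/-- The two affine charts of the projective line. -/
def chart (i : Fin 2) (z : ℂ) : P1 := Projectivization.mk ℂ (homog i z) (homog_ne_zero i z)

/-- The section `z₀ ^ n * z₁ ^ n` of `O(2n)` in the `i`-th chart, in the frame `z_i ^ (2n)`. -/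
def higgs (n : ℕ) (i : Fin 2) (z : ℂ) : ℂ := homog i z 0 ^ n * homog i z 1 ^ n

/-- A smooth Kähler metric on `P¹`, given by its conformal factors in the two affine charts. -/
structure KahlerP1 where
  ρ : Fin 2 → ℂ → ℝ
  smooth : ∀ i, ContDiff ℝ ∞ (ρ i)
  pos : ∀ i z, 0 < ρ i z
  compat : ∀ w, w ≠ 0 → ρ 1 w * ‖w‖ ^ 4 = ρ 0 w⁻¹

/-- A smooth Hermitian metric on `O(d)` over `P¹`, given by its weights in the frames `z_i ^ d`. -/
structure HermitianP1 (d : ℕ) where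
  h : Fin 2 → ℂ → ℝ
  smooth : ∀ i, ContDiff ℝ ∞ (h i)
  pos : ∀ i z, 0 < h i z
  compat : ∀ w, w ≠ 0 → h 1 w * ‖w‖ ^ (2 * d) = h 0 w⁻¹

/-- Length of the curve `γ : [0,1] → ℂ` for the metric `ρ (dx² + dy²)`. -/
def arcLength (ρ : ℂ → ℝ) (γ : ℝ → ℂ) : ℝ≥0∞ :=
  ∫⁻ s in Icc (0 : ℝ) 1, ENNReal.ofReal (√(ρ (γ s)) * ‖deriv γ s‖)

/-- `JoinedBy g p q ℓ`: there is a piecewise `C¹` curve of length `ℓ` from `p` to `q` in `P¹`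
(a concatenation of finitely many `C¹` arcs, each of them inside one of the affine charts). -/
inductive JoinedBy (g : KahlerP1) : P1 → P1 → ℝ≥0∞ → Prop
  | refl (p : P1) : JoinedBy g p p 0
  | arc (p : P1) (ℓ : ℝ≥0∞) (i : Fin 2) (γ : ℝ → ℂ) (hγ : ContDiff ℝ 1 γ)
      (hp : JoinedBy g p (chart i (γ 0)) ℓ) :
      JoinedBy g p (chart i (γ 1)) (ℓ + arcLength (g.ρ i) γ)

/-- The Riemannian distance on `P¹`. -/
def distP1 (g : KahlerP1) (p q : P1) : ℝ≥0∞ := ⨅ (ℓ : ℝ≥0∞) (_ : JoinedBy g p q ℓ), ℓ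

/-- The diameter of `(P¹, g)`. -/
def diamP1 (g : KahlerP1) : ℝ≥0∞ := ⨆ (p : P1) (q : P1), distP1 g p q

/-- `(g, h)` is an Einstein-Bogomol'nyi metric on `P¹` with Higgs field `z₀ ^ n * z₁ ^ n`, for
`τ = 1` and the coupling constant `α`. -/
def IsEBP1 (α : ℝ) (n : ℕ) (g : KahlerP1) (h : HermitianP1 (2 * n)) : Prop :=
  ∀ i, SolvesEB α 1 (g.ρ i) (h.h i) (higgs n i)

/-! ### Yang's symmetric solutions -/

/-- The coupling constant, determined by `α τ N = 1` with `τ = 1`, `N = 2 n`. -/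
def coupling (n : ℕ) : ℝ := 1 / (2 * n)

/-- `u'' = (1/λ) e^{2α(u - e^u)} (e^u - 1)` on the real line. -/
def SolvesODE (α lam : ℝ) (u : ℝ → ℝ) : Prop :=
  Differentiable ℝ u ∧ ∀ t, HasDerivAt (deriv u)
    (1 / lam * Real.exp (2 * α * (u t - Real.exp (u t))) * (Real.exp (u t) - 1)) t

/-- The parameter `λ_b = 1 / (2 n e^{2 α (b + e^{-b})})`. -/
def lamB (n : ℕ) (b : ℝ) : ℝ :=
  1 / (2 * n * Real.exp (2 * coupling n * (b + Real.exp (-b))))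

/-- In the coordinates `z = e^{t + iθ}`, the metric is `(1/λ) e^{2α(u - e^u)} (dt² + dθ²)` and
the state function `|z ^ n|² h` is `e^u`, with `u = u(t)`. -/
def GivenBy (n : ℕ) (lam : ℝ) (u : ℝ → ℝ) (ρ h : ℂ → ℝ) : Prop :=
  ∀ z : ℂ, z ≠ 0 →
    ρ z = 1 / lam * Real.exp (2 * coupling n *
      (u (Real.log ‖z‖) - Real.exp (u (Real.log ‖z‖)))) / ‖z‖ ^ 2 ∧
    h z * ‖z‖ ^ (2 * n) = Real.exp (u (Real.log ‖z‖))

/-- Yang's `S¹`-symmetric solution `(g_b, h_b)` on `P¹` with parameter `b`. -/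
structure IsYang (n : ℕ) (b lam : ℝ) (u : ℝ → ℝ) (g : KahlerP1) (h : HermitianP1 (2 * n)) :
    Prop where
  lam_pos : 0 < lam
  ode : SolvesODE (coupling n) lam u
  init : u 0 = -b
  init_deriv : deriv u 0 = 0
  at_top : Tendsto (deriv u) atTop (𝓝 (-(2 * n)))
  at_bot : Tendsto (deriv u) atBot (𝓝 (2 * n))
  given : GivenBy n lam u (g.ρ 0) (h.h 0)

/-! ### Metrics on `ℂ` -/

/-- `(ρ, h)` is a smooth Einstein-Bogomol'nyi metric on `ℂ` with Higgs field `z ^ n`, for `τ = 1`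
and the coupling constant `α`. -/
structure IsEBPlane (α : ℝ) (n : ℕ) (ρ h : ℂ → ℝ) : Prop where
  smooth_metric : ContDiff ℝ ∞ ρ
  pos_metric : ∀ z, 0 < ρ z
  smooth_herm : ContDiff ℝ ∞ h
  pos_herm : ∀ z, 0 < h z
  eb : SolvesEB α 1 ρ h (fun z => z ^ n)

/-- The Riemannian distance of `ρ (dx² + dy²)` on `ℂ`. -/
def distPlane (ρ : ℂ → ℝ) (x y : ℂ) : ℝ≥0∞ :=
  ⨅ (γ : ℝ → ℂ) (_ : ContDiff ℝ 1 γ ∧ γ 0 = x ∧ γ 1 = y), arcLength ρ γ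

/-- Completeness of the metric `ρ (dx² + dy²)` on `ℂ`: Cauchy sequences converge. -/
def IsCompleteMetric (ρ : ℂ → ℝ) : Prop :=
  ∀ x : ℕ → ℂ,
    (∀ ε : ℝ≥0∞, 0 < ε → ∃ k, ∀ i j, k ≤ i → k ≤ j → distPlane ρ (x i) (x j) < ε) →
    ∃ a, Tendsto (fun i => distPlane ρ (x i) a) atTop (𝓝 0)

/-- If `f (dx² + dy²)` is a metric (or `f dx ∧ dy` a form) in the coordinate `z ≠ 0`, this is its
coefficient with respect to `dt² + dθ²` (or `dt ∧ dθ`) in the cylindrical coordinate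
`ζ = t + iθ`, `z = e^ζ`. -/
def cyl (f : ℂ → ℝ) (ζ : ℂ) : ℝ := f (Complex.exp ζ) * ‖Complex.exp ζ‖ ^ 2

/-- All derivatives of the function `f` of `ζ = t + iθ` decay exponentially (at one common rate) as
`t → +∞`. -/
def ExpDecay (f : ℂ → ℝ) : Prop :=
  ∃ κ : ℝ, 0 < κ ∧ ∀ l : ℕ, ∃ C : ℝ, ∀ ζ : ℂ, 0 ≤ ζ.re →
    ‖iteratedFDeriv ℝ l f ζ‖ ≤ C * Real.exp (-(κ * ζ.re))

/-- The metric `ρ (dx² + dy²)` is asymptotic, with all derivatives and at an exponential rate, to the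
flat cylinder `a (dt² + dθ²)` as `t = log |z| → +∞`. -/
def AsymptoticToCylinder (a : ℝ) (ρ : ℂ → ℝ) : Prop := ExpDecay (fun ζ => cyl ρ ζ - a)

/-- Invariance under the rotations of `ℂ`. -/
def IsRotInvariant (f : ℂ → ℝ) : Prop := ∀ a z : ℂ, ‖a‖ = 1 → f (a * z) = f z

/-- The limit problem: `u` solves the ODE with `u(0) = -c`, `u'(-∞) = 2n`, `u'(+∞) = 0`, and
`(ρ, h)` are the continuous functions on `ℂ` that it determines. -/
structure IsLinet (n : ℕ) (c lam : ℝ) (u : ℝ → ℝ) (ρ h : ℂ → ℝ) : Prop where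
  lam_pos : 0 < lam
  ode : SolvesODE (coupling n) lam u
  init : u 0 = -c
  at_bot : Tendsto (deriv u) atBot (𝓝 (2 * n))
  at_top : Tendsto (deriv u) atTop (𝓝 0)
  cont_metric : Continuous ρ
  cont_herm : Continuous h
  given : GivenBy n lam u ρ h

/-! ### Pointed convergence -/

/-- `f b → f₀` as `b → 0+`, uniformly with all derivatives on compact subsets of `Ω`. -/
def SmoothConv {E : Type} [NormedAddCommGroup E] [NormedSpace ℝ E]
    (Ω : Set ℂ) (f : ℝ → ℂ → E) (f₀ : ℂ → E) : Prop :=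
  ∀ (k : ℕ) (K : Set ℂ), K ⊆ Ω → IsCompact K →
    TendstoUniformlyOn (fun b => iteratedFDeriv ℝ k (f b)) (iteratedFDeriv ℝ k f₀) (𝓝[>] 0) K

/-- Pointed Cheeger-Gromov convergence as `b → 0+` of surfaces with metric `ρ b`, Hermitian line
bundle `h b`, section `φ b` and base point `p b`, written in a coordinate chart, to the surface `Ω`
with data `ρ₀`, `h₀`, `φ₀` and base point `q`. The convergence is realized by holomorphic embeddings
`F b : Ω → ℂ` that match the base points, lifted to the line bundles by the nowhere vanishing
holomorphic functions `s b` (which send the frame over `w ∈ Ω` to `s b w` times the frame over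
`F b w`): the pulled back metrics, Hermitian metrics and sections converge smoothly on compact
sets. -/
structure PointedConv (ρ h : ℝ → ℂ → ℝ) (φ : ℝ → ℂ → ℂ) (p : ℝ → ℂ)
    (Ω : Set ℂ) (ρ₀ h₀ : ℂ → ℝ) (φ₀ : ℂ → ℂ) (q : ℂ) (F s : ℝ → ℂ → ℂ) : Prop where
  isOpen : IsOpen Ω
  base_mem : q ∈ Ω
  holo : ∀ᶠ b in 𝓝[>] (0 : ℝ), DifferentiableOn ℂ (F b) Ω
  inj : ∀ᶠ b in 𝓝[>] (0 : ℝ), InjOn (F b) Ω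
  base : ∀ᶠ b in 𝓝[>] (0 : ℝ), F b q = p b
  lift_holo : ∀ᶠ b in 𝓝[>] (0 : ℝ), DifferentiableOn ℂ (s b) Ω
  lift_ne : ∀ᶠ b in 𝓝[>] (0 : ℝ), ∀ w ∈ Ω, s b w ≠ 0
  metric : SmoothConv Ω (fun b w => ρ b (F b w) * ‖deriv (F b) w‖ ^ 2) ρ₀
  herm : SmoothConv Ω (fun b w => h b (F b w) * ‖s b w‖ ^ 2) h₀
  section_conv : SmoothConv Ω (fun b w => φ b (F b w) / s b w) φ₀

/-- The flat metric `2n (dt² + dθ²)` on the cylinder `ℂ \ {0}`, `w = e^{t + iθ}`. -/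
def cylMetric (n : ℕ) (w : ℂ) : ℝ := 2 * n / ‖w‖ ^ 2

/-- The Hermitian metric `e^{-2nt}` over the cylinder `ℂ \ {0}`, `w = e^{t + iθ}`. -/
def cylHerm (n : ℕ) (w : ℂ) : ℝ := 1 / ‖w‖ ^ (2 * n)

end EinsteinBogomolnyi

end

open EinsteinBogomolnyi

namespace EinsteinBogomolnyi

/-! Put a = 2α = 1/n, m = 1/λ and V(u) = e^{(u - e^u)/n} (`pot`). Since V' = -(1/n) V (e^u - 1), the
equation is Newton's law for the potential energy n m V, and u'² + 2 n m V(u) is conserved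
(`Solves.energy`). On (-∞, 0] the function V increases from 0 to its maximum V(0). Slope 2n at -∞
fixes the conserved value (2n)². Hence rest at height -b forces m = 2n / V(-b), which is λ_b, and
slope 0 at +∞ forces m = 2n / V(0): the limit problem describes the separatrix climbing from -∞ to
the equilibrium u = 0 (`exists_yangProfile`, `limitProfile_of_tendsto`). On the separatrix u' is a
function of u comparable to -u, which gives the exponential rates.

As b → 0 the data of Yang's profile at t = 0 tend to the equilibrium, so by Grönwall's inequality
(`profileConv_of_init`) u^b → 0 on compact sets of t, and the metric tends to the cylinder. If time
is translated so that u = -c at time 0, the energy determines the slope there; it tends to the slope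
of the separatrix, and the same inequality gives convergence to the separatrix.

The zero of the Higgs field lies at t = -∞, outside such compact sets. In the variable s = |z|² =
e^{2t} the factorisation (2n - u')(2n + u') = 2 n m V shows that log h has a derivative in s without
pole at s = 0 (`Profile.mul_factor_mul_invSlope`). So s, h, u', 1/(u' + 2n) and the conformal factor
generate an algebra of functions on s ≥ 0 that is closed under derivation (`diffAlg_planeAlg`). For
such an algebra, smoothness in z and convergence of all derivatives reduce to differentiability and
convergence of the generators (`DiffAlg.contDiffOn`, `DiffAlg.smoothConv`). The same device in the
variable t serves on the cylinder and for the decay of all derivatives.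

The first Einstein-Bogomol'nyi equation is the differential equation itself; the second holds
because log ρ - (log h - |φ|²)/n is constant (`Profile.solvesEB`). Conversely, for an invariant
solution on the plane this combination is forced to be constant by smoothness at the origin, which
leads back to the equation (`exists_solves_of_isEBPlane`); two separatrices differ by a translation
of t, that is, a dilation of z. Completeness and the diameter bound both come from explicit
functions that are Lipschitz for the metric, and the string number is the total drop of u' from 2n
to 0. -/

/-! ### Global solutions of ordinary differential equations -/

/-- A globally Lipschitz `C¹` vector field has complete integral curves. -/
theorem exists_global_solution {E : Type*} [NormedAddCommGroup E] [NormedSpace ℝ E]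
    [CompleteSpace E] {v : E → E} {K : NNReal} (hv : LipschitzWith K v) (hv1 : ContDiff ℝ 1 v)
    (x : E) : ∃ γ : ℝ → E, γ 0 = x ∧ ∀ t, HasDerivAt γ (v (γ t)) t := by
  -- The existence time must not depend on the initial point y. On the ball of radius ‖v y‖ + 1
  -- about y the field is at most (K + 1)(‖v y‖ + 1), so no solution leaves that ball before time 1
  -- / (K + 1).
  set ε : ℝ := 1 / (2 * (K + 1)) with hε
  have hε0 : 0 < ε := by positivity
  have key := exists_isMIntegralCurve_of_isMIntegralCurveOn (I := modelWithCornersSelf ℝ E) (M := E)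
    (v := fun x => v x) (contMDiff_vectorSpace_iff_contDiff.2 hv1) hε0 (fun y => ?_) x
  · obtain ⟨γ, h0, hγ⟩ := key
    refine ⟨γ, h0, fun t => ?_⟩
    have h1 : HasFDerivAt γ ((1 : ℝ →L[ℝ] ℝ).smulRight (v (γ t))) t :=
      hasMFDerivAt_iff_hasFDerivAt.1 (hγ t)
    exact h1.hasDerivAt.congr_deriv (by simp)
  · have h0 : (0 : ℝ) ∈ Icc (-ε) ε := ⟨by linarith, hε0.le⟩
    have hPL : IsPicardLindelof (fun _ : ℝ => v) (⟨0, h0⟩ : Icc (-ε) ε) y (‖v y‖₊ + 1) 0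
        (‖v y‖₊ + K * (‖v y‖₊ + 1)) K := by
      refine IsPicardLindelof.of_time_independent (fun z hz => ?_) hv.lipschitzOnWith ?_
      · have h1 : ‖v z‖ ≤ ‖v y‖ + ‖v z - v y‖ := by
          have := norm_add_le (v y) (v z - v y)
          simpa using this
        have h2 : ‖v z - v y‖ ≤ K * ‖z - y‖ := by
          simpa [dist_eq_norm] using hv.dist_le_mul z y
        have h3 : ‖z - y‖ ≤ ‖v y‖ + 1 := by
          simpa [dist_eq_norm] using hz
        push_cast
        calc ‖v z‖ ≤ ‖v y‖ + K * ‖z - y‖ := by linarith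
          _ ≤ ‖v y‖ + K * (‖v y‖ + 1) := by gcongr
      · simp only [sub_zero, zero_sub, neg_neg, max_self]
        push_cast
        have hK : (0 : ℝ) ≤ K := K.2
        have hn := norm_nonneg (v y)
        rw [hε, mul_one_div, div_le_iff₀ (by positivity)]
        nlinarith [mul_nonneg hK hn]
    obtain ⟨γ, hγ0, hγ⟩ := hPL.exists_eq_forall_mem_Icc_hasDerivWithinAt₀
    refine ⟨γ, hγ0, fun t ht => ?_⟩
    have := (hγ t (Ioo_subset_Icc_self ht)).hasDerivAt (Icc_mem_nhds ht.1 ht.2)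
    have h2 : HasFDerivAt γ ((1 : ℝ →L[ℝ] ℝ).smulRight (v (γ t))) t :=
      this.hasFDerivAt.congr_fderiv (by ext; simp)
    exact h2.hasMFDerivAt.hasMFDerivWithinAt

/-! ### The force of the equation -/

/-- The potential `e^{a (u - e^u)}`. -/
noncomputable def pot (a u : ℝ) : ℝ := Real.exp (a * (u - Real.exp u))

/-- The force `e^{a (u - e^u)} (e^u - 1)`. -/
noncomputable def force (a u : ℝ) : ℝ := pot a u * (Real.exp u - 1)

theorem pot_pos (a u : ℝ) : 0 < pot a u := Real.exp_pos _

theorem hasDerivAt_pot (a u : ℝ) : HasDerivAt (pot a) (-(a * force a u)) u := by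
  have := (((hasDerivAt_id u).sub (Real.hasDerivAt_exp u)).const_mul a).exp
  refine this.congr_deriv ?_
  simp only [force, pot, Pi.sub_apply, id]
  ring

theorem hasDerivAt_force (a u : ℝ) :
    HasDerivAt (force a) (pot a u * (Real.exp u - a * (Real.exp u - 1) ^ 2)) u := by
  have := (hasDerivAt_pot a u).mul ((Real.hasDerivAt_exp u).sub_const 1)
  refine this.congr_deriv ?_
  simp only [force]
  ring

theorem contDiff_pot (a : ℝ) {k : WithTop ℕ∞} : ContDiff ℝ k (pot a) := by
  unfold pot
  fun_prop

theorem contDiff_force (a : ℝ) {k : WithTop ℕ∞} : ContDiff ℝ k (force a) := by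
  unfold force
  have := contDiff_pot a (k := k)
  fun_prop

/-- Half of e^u absorbs the linear term, as 2u ≤ e^u. The resulting doubly exponential decay beats
every power of e^u. -/
theorem pot_le {a : ℝ} (ha : 0 < a) (u : ℝ) : pot a u ≤ Real.exp (-(a / 2 * Real.exp u)) := by
  apply Real.exp_le_exp.2
  have : 2 * u ≤ Real.exp u := by
    rcases le_or_gt 0 u with h | h
    · nlinarith [Real.quadratic_le_exp_of_nonneg h]
    · linarith [Real.exp_pos u]
  nlinarith

theorem pot_mul_exp_pow_le {a : ℝ} (ha : 0 < a) (k : ℕ) (u : ℝ) :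
    pot a u * Real.exp u ^ k ≤ (k.factorial : ℝ) * (2 / a) ^ k := by
  have h1 := pot_le ha u
  have h2 := Real.pow_div_factorial_le_exp (x := a / 2 * Real.exp u) (by positivity) k
  have h3 : Real.exp u ^ k ≤ (k.factorial : ℝ) * (2 / a) ^ k * Real.exp (a / 2 * Real.exp u) := by
    rw [div_le_iff₀ (by positivity), mul_pow] at h2
    calc Real.exp u ^ k = (2 / a) ^ k * ((a / 2) ^ k * Real.exp u ^ k) := by
          rw [← mul_assoc, ← mul_pow, div_mul_div_comm, mul_comm a 2, div_self (by positivity),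
            one_pow, one_mul]
      _ ≤ (2 / a) ^ k * (Real.exp (a / 2 * Real.exp u) * (k.factorial : ℝ)) := by gcongr
      _ = _ := by ring
  calc pot a u * Real.exp u ^ k
      ≤ Real.exp (-(a / 2 * Real.exp u)) *
        ((k.factorial : ℝ) * (2 / a) ^ k * Real.exp (a / 2 * Real.exp u)) := by gcongr
    _ = (k.factorial : ℝ) * (2 / a) ^ k *
        (Real.exp (-(a / 2 * Real.exp u)) * Real.exp (a / 2 * Real.exp u)) := by ring
    _ = _ := by rw [← Real.exp_add]; simp

/-- The force and its derivative are polynomials in e^u times `pot`, and each `pot` · e^{ku} is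
bounded. The first bound controls a change of the parameter m, the second makes the vector field
globally Lipschitz. -/
theorem exists_force_bound {a : ℝ} (ha : 0 < a) :
    ∃ C : ℝ, 0 < C ∧ ∀ u, |force a u| ≤ C ∧
      |pot a u * (Real.exp u - a * (Real.exp u - 1) ^ 2)| ≤ C := by
  have h0 := fun u => pot_mul_exp_pow_le ha 0 u
  have h1 := fun u => pot_mul_exp_pow_le ha 1 u
  have h2 := fun u => pot_mul_exp_pow_le ha 2 u
  simp only [pow_zero, pow_one, Nat.factorial] at h0 h1 h2
  push_cast at h0 h1 h2
  set A := 1 * (2 / a) with hA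
  set B := (2 : ℝ) * 1 * (2 / a) ^ 2 with hB
  have hA0 : 0 < A := by positivity
  have hB0 : 0 < B := by positivity
  refine ⟨A + 1 + a * (B + 1), by positivity, fun u => ⟨?_, ?_⟩⟩
  · have e1 : force a u = pot a u * Real.exp u - pot a u := by unfold force; ring
    have := h0 u
    have := h1 u
    have := pot_pos a u
    have := mul_pos (pot_pos a u) (Real.exp_pos u)
    have : 0 < a * (B + 1) := by positivity
    rw [e1, abs_le]
    constructor <;> linarith
  · have hx := Real.exp_pos u
    have hp := pot_pos a u
    have e1 : pot a u * (Real.exp u - a * (Real.exp u - 1) ^ 2) =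
      pot a u * Real.exp u - a * (pot a u * (Real.exp u - 1) ^ 2) := by ring
    have e2 : 0 ≤ pot a u * (Real.exp u - 1) ^ 2 := by positivity
    have e3 : pot a u * (Real.exp u - 1) ^ 2 ≤ B + 1 := by
      have : pot a u * (Real.exp u - 1) ^ 2 ≤ pot a u * Real.exp u ^ 2 + pot a u * 1 := by
        nlinarith
      have := h0 u
      have := h2 u
      linarith
    have e4 := mul_le_mul_of_nonneg_left e3 ha.le
    have e5 := mul_nonneg ha.le e2
    have := h1 u
    have := mul_pos hp hx
    rw [e1, abs_le]
    constructor <;> linarith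

theorem exists_force_lipschitz {a : ℝ} (ha : 0 < a) :
    ∃ K : NNReal, LipschitzWith K (force a) := by
  obtain ⟨C, hC, h⟩ := exists_force_bound ha
  refine ⟨C.toNNReal, lipschitzWith_of_nnnorm_deriv_le
    (fun u => (hasDerivAt_force a u).differentiableAt) fun u => ?_⟩
  rw [(hasDerivAt_force a u).deriv, ← NNReal.coe_le_coe, Real.coe_toNNReal _ hC.le]
  exact (h u).2

/-! ### The equation as a first order system -/

/-- The vector field of the system equivalent to `u'' = m * force a u`. -/
noncomputable def field (a m : ℝ) (x : ℝ × ℝ) : ℝ × ℝ := (x.2, m * force a x.1)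

theorem contDiff_field (a m : ℝ) : ContDiff ℝ 1 (field a m) := by
  unfold field
  have := contDiff_force a (k := 1)
  fun_prop

theorem exists_field_lipschitz {a : ℝ} (ha : 0 < a) (m : ℝ) :
    ∃ K : NNReal, LipschitzWith K (field a m) := by
  obtain ⟨K, hK⟩ := exists_force_lipschitz ha
  have h : LipschitzWith (‖m‖₊ * (K * 1)) (fun x : ℝ × ℝ => m * force a x.1) :=
    (lipschitzWith_smul m).comp (hK.comp LipschitzWith.prod_fst)
  exact ⟨_, LipschitzWith.prod_snd.prodMk h⟩

/-- The equation `u'' = m * force a u`. -/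
def Solves (a m : ℝ) (u : ℝ → ℝ) : Prop :=
  Differentiable ℝ u ∧ ∀ t, HasDerivAt (deriv u) (m * force a (u t)) t

theorem solvesODE_iff {α lam : ℝ} {u : ℝ → ℝ} :
    SolvesODE α lam u ↔ Solves (2 * α) (1 / lam) u := by
  simp only [SolvesODE, Solves, force, pot, mul_assoc]

theorem Solves.hasDerivAt {a m : ℝ} {u : ℝ → ℝ} (h : Solves a m u) (t : ℝ) :
    HasDerivAt u (deriv u t) t := (h.1 t).hasDerivAt

theorem Solves.hasDerivAt_prod {a m : ℝ} {u : ℝ → ℝ} (h : Solves a m u) (t : ℝ) :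
    HasDerivAt (fun t => (u t, deriv u t)) (field a m (u t, deriv u t)) t :=
  (h.hasDerivAt t).prodMk (h.2 t)

theorem exists_solves {a : ℝ} (ha : 0 < a) (m x y : ℝ) :
    ∃ u, Solves a m u ∧ u 0 = x ∧ deriv u 0 = y := by
  obtain ⟨K, hK⟩ := exists_field_lipschitz ha m
  obtain ⟨γ, h0, hγ⟩ := exists_global_solution hK (contDiff_field a m) (x, y)
  have h1 : ∀ t, HasDerivAt (fun t => (γ t).1) (γ t).2 t := fun t =>
    (hasFDerivAt_fst (p := γ t)).comp_hasDerivAt t (hγ t)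
  have h2 : ∀ t, HasDerivAt (fun t => (γ t).2) (m * force a (γ t).1) t := fun t =>
    (hasFDerivAt_snd (p := γ t)).comp_hasDerivAt t (hγ t)
  have h3 : deriv (fun t => (γ t).1) = fun t => (γ t).2 := funext fun t => (h1 t).deriv
  refine ⟨fun t => (γ t).1, ⟨fun t => (h1 t).differentiableAt, fun t => ?_⟩, by simp [h0], ?_⟩
  · rw [h3]; exact h2 t
  · rw [h3]; simp [h0]

/-- The equation contains no first derivative, hence is reversible in time. -/
theorem Solves.comp_neg {a m : ℝ} {u : ℝ → ℝ} (h : Solves a m u) :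
    Solves a m (fun t => u (-t)) := by
  have e : deriv (fun t => u (-t)) = fun t => -deriv u (-t) := funext fun t => by
    rw [deriv_comp_neg]
  refine ⟨h.1.comp differentiable_neg, fun t => ?_⟩
  rw [e]
  exact (((h.2 (-t)).scomp t (hasDerivAt_neg t)).neg).congr_deriv (by simp)

theorem Solves.comp_add_const {a m : ℝ} {u : ℝ → ℝ} (h : Solves a m u) (s : ℝ) :
    Solves a m (fun t => u (t + s)) := by
  have e : deriv (fun t => u (t + s)) = fun t => deriv u (t + s) := funext fun t => by
    rw [deriv_comp_add_const]
  refine ⟨h.1.comp (differentiable_id.add_const s), fun t => ?_⟩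
  rw [e]
  exact (h.2 (t + s)).comp_add_const t s

/-- Continuous dependence on initial values and on the parameter, forwards in time. -/
theorem Solves.dist_le_forward {a m m' : ℝ} {u v : ℝ → ℝ} {K : NNReal} {C : ℝ}
    (hK : LipschitzWith K (field a m)) (hC : ∀ x, |force a x| ≤ C)
    (hu : Solves a m u) (hv : Solves a m' v) {t : ℝ} (ht : 0 ≤ t) :
    dist (u t, deriv u t) (v t, deriv v t) ≤
      gronwallBound (dist (u 0, deriv u 0) (v 0, deriv v 0)) K (|m - m'| * C) t := by
  -- The solution for m' is a trajectory of `field a m` up to the error |m - m'| · C.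
  have := dist_le_of_approx_trajectories_ODE (v := fun _ => field a m) (K := K)
    (f := fun t => (u t, deriv u t)) (f' := fun t => field a m (u t, deriv u t))
    (g := fun t => (v t, deriv v t)) (g' := fun t => field a m' (v t, deriv v t))
    (a := 0) (b := t) (εf := 0) (εg := |m - m'| * C) (δ := _) (fun _ => hK)
    (fun s _ => (hu.hasDerivAt_prod s).continuousAt.continuousWithinAt)
    (fun s _ => (hu.hasDerivAt_prod s).hasDerivWithinAt) (fun s _ => by simp)
    (fun s _ => (hv.hasDerivAt_prod s).continuousAt.continuousWithinAt)
    (fun s _ => (hv.hasDerivAt_prod s).hasDerivWithinAt) (fun s _ => ?_) le_rfl t ⟨ht, le_rfl⟩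
  · simpa using this
  · have h0 : 0 ≤ |m - m'| * C := mul_nonneg (abs_nonneg _) ((abs_nonneg _).trans (hC 0))
    simp only [field, Prod.dist_eq, dist_self, Real.dist_eq]
    refine max_le h0 ?_
    rw [← sub_mul, abs_mul, abs_sub_comm m']
    gcongr
    exact hC _

theorem Solves.dist_le {a m m' : ℝ} {u v : ℝ → ℝ} {K : NNReal} {C : ℝ}
    (hK : LipschitzWith K (field a m)) (hC : ∀ x, |force a x| ≤ C)
    (hu : Solves a m u) (hv : Solves a m' v) (t : ℝ) :
    dist (u t, deriv u t) (v t, deriv v t) ≤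
      gronwallBound (dist (u 0, deriv u 0) (v 0, deriv v 0)) K (|m - m'| * C) |t| := by
  rcases le_total 0 t with ht | ht
  · rw [abs_of_nonneg ht]
    exact hu.dist_le_forward hK hC hv ht
  · rw [abs_of_nonpos ht]
    have := hu.comp_neg.dist_le_forward hK hC hv.comp_neg (t := -t) (by linarith)
    simp only [deriv_comp_neg, neg_neg, Prod.dist_eq, dist_neg_neg, neg_zero] at this ⊢
    exact this

theorem Solves.unique {a m : ℝ} (ha : 0 < a) {u v : ℝ → ℝ} (hu : Solves a m u)
    (hv : Solves a m v) (t₀ : ℝ) (h0 : u t₀ = v t₀) (h1 : deriv u t₀ = deriv v t₀) : u = v := by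
  obtain ⟨K, hK⟩ := exists_field_lipschitz ha m
  obtain ⟨C, -, hC⟩ := exists_force_bound ha
  have key := (hu.comp_add_const t₀).dist_le hK (fun x => (hC x).1) (hv.comp_add_const t₀)
  funext t
  have := key (t - t₀)
  simp only [deriv_comp_add_const, zero_add, h0, h1, dist_self, sub_self, abs_zero, zero_mul,
    gronwallBound_ε0_δ0, sub_add_cancel] at this
  have := congrArg Prod.fst (dist_le_zero.1 this)
  exact this

/-! ### Elementary calculus on the line -/

theorem tendsto_atBot_of_le_deriv {u : ℝ → ℝ} (hu : Differentiable ℝ u) {d T : ℝ} (hd : 0 < d)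
    (h : ∀ t ≤ T, d ≤ deriv u t) : Tendsto u atBot atBot := by
  have h1 : ∀ t ≤ T, u t ≤ u T + d * (t - T) := by
    intro t ht
    have := (convex_Icc t T).mul_sub_le_image_sub_of_le_deriv hu.continuous.continuousOn
      hu.differentiableOn (fun x hx => by
        rw [interior_Icc] at hx; exact h x hx.2.le) t ⟨le_rfl, ht⟩ T ⟨ht, le_rfl⟩ ht
    linarith
  refine tendsto_atBot_mono' _ ((eventually_le_atBot T).mono h1) ?_
  refine tendsto_atBot_add_const_left _ _ (Tendsto.const_mul_atBot hd ?_)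
  exact tendsto_atBot_add_const_right _ _ tendsto_id

theorem tendsto_atBot_of_deriv_le {u : ℝ → ℝ} (hu : Differentiable ℝ u) {d T : ℝ} (hd : 0 < d)
    (h : ∀ t, T ≤ t → deriv u t ≤ -d) : Tendsto u atTop atBot := by
  have h1 : Tendsto (fun t => u (-t)) atBot atBot :=
    tendsto_atBot_of_le_deriv (hu.comp differentiable_neg) hd (T := -T) fun t ht => by
      rw [deriv_comp_neg]
      linarith [h (-t) (by linarith)]
  simpa [Function.comp_def] using h1.comp tendsto_neg_atTop_atBot

theorem tendsto_atBot_of_tendsto_deriv {u : ℝ → ℝ} (hu : Differentiable ℝ u) {d : ℝ} (hd : 0 < d)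
    (h : Tendsto (deriv u) atBot (𝓝 d)) : Tendsto u atBot atBot := by
  obtain ⟨T, hT⟩ := eventually_atBot.1 (h.eventually (lt_mem_nhds (half_lt_self hd)))
  exact tendsto_atBot_of_le_deriv hu (half_pos hd) fun t ht => (hT t ht).le

theorem neg_of_ne_zero {u : ℝ → ℝ} (hu : Continuous u) {s : Set ℝ} (hs : IsPreconnected s)
    (h : ∀ t ∈ s, u t ≠ 0) {t₀ : ℝ} (ht₀ : t₀ ∈ s) (h0 : u t₀ < 0) : ∀ t ∈ s, u t < 0 := by
  intro t ht
  by_contra! H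
  obtain ⟨r, hr, hr0⟩ := hs.intermediate_value ht₀ ht hu.continuousOn ⟨h0.le, H⟩
  exact h r hr hr0

/-! ### The potential -/

section pot

variable {a : ℝ}

theorem pot_le_pot_zero (ha : 0 < a) (u : ℝ) : pot a u ≤ pot a 0 := by
  apply Real.exp_le_exp.2
  have := Real.add_one_le_exp u
  rw [Real.exp_zero]
  nlinarith

theorem pot_lt_pot_zero (ha : 0 < a) {u : ℝ} (hu : u ≠ 0) : pot a u < pot a 0 := by
  apply Real.exp_lt_exp.2
  have := Real.add_one_lt_exp hu
  rw [Real.exp_zero]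
  nlinarith

theorem pot_strictMonoOn (ha : 0 < a) : StrictMonoOn (pot a) (Iic 0) := by
  refine strictMonoOn_of_deriv_pos (convex_Iic 0) (contDiff_pot a (k := 0)).continuous.continuousOn
    fun u hu => ?_
  rw [interior_Iic] at hu
  rw [(hasDerivAt_pot a u).deriv, force]
  have : Real.exp u < 1 := by simpa using hu
  have := mul_pos (mul_pos ha (pot_pos a u)) (sub_pos.2 this)
  linarith

theorem force_neg {u : ℝ} (hu : u < 0) : force a u < 0 :=
  mul_neg_of_pos_of_neg (pot_pos a u) (by simpa using hu)

theorem tendsto_pot_atBot (ha : 0 < a) : Tendsto (pot a) atBot (𝓝 0) := by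
  refine Real.tendsto_exp_atBot.comp (Tendsto.const_mul_atBot ha ?_)
  refine tendsto_atBot_mono (fun u => ?_) tendsto_id
  have := Real.exp_pos u
  simp only [id]
  linarith

end pot

/-! ### Profiles: negative solutions with slope `2n` at `-∞` -/

section

variable {n : ℕ} {m : ℝ} {u : ℝ → ℝ}

theorem one_div_pos_of_one_le (hn : 1 ≤ n) : (0 : ℝ) < 1 / n := by
  have : (0 : ℝ) < n := by exact_mod_cast hn
  positivity

theorem two_mul_coupling (n : ℕ) : 2 * coupling n = 1 / n := by
  unfold coupling
  rw [one_div, mul_inv]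
  ring

theorem one_div_lamB (n : ℕ) (b : ℝ) : 1 / lamB n b = 2 * n / pot (1 / n) (-b) := by
  unfold lamB pot
  rw [two_mul_coupling, one_div_one_div, div_eq_mul_inv (2 * (n : ℝ)), ← Real.exp_neg]
  congr 2
  ring

theorem lamB_pos (hn : 1 ≤ n) (b : ℝ) : 0 < lamB n b := by
  have : (0 : ℝ) < n := by exact_mod_cast hn
  unfold lamB
  positivity

/-- For a = 1/n the derivative of `pot` is -(1/n) times the force, so the equation is conservative
with potential energy n m `pot`. This quantity is twice the total energy. -/
theorem Solves.energy (hn : 1 ≤ n) (h : Solves (1 / n) m u) (t s : ℝ) :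
    deriv u t ^ 2 + 2 * n * m * pot (1 / n) (u t) = deriv u s ^ 2 + 2 * n * m * pot (1 / n) (u s) := by
  have hn0 : (n : ℝ) ≠ 0 := by positivity
  have hd : ∀ t, HasDerivAt (fun t => deriv u t ^ 2 + 2 * n * m * pot (1 / n) (u t)) 0 t := by
    intro t
    have := ((h.2 t).pow 2).add (((hasDerivAt_pot (1 / n) (u t)).comp t (h.hasDerivAt t)).const_mul
      (2 * n * m))
    refine this.congr_deriv ?_
    field_simp
    push_cast
    ring
  exact is_const_of_deriv_eq_zero (fun t => (hd t).differentiableAt) (fun t => (hd t).deriv) t s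

/-- Where u → -∞ the potential vanishes, so the conserved quantity is the square of the asymptotic
slope. -/
theorem Solves.energy_of_tendsto (hn : 1 ≤ n) (h : Solves (1 / n) m u) {l : Filter ℝ} [l.NeBot]
    (hu : Tendsto u l atBot) {d : ℝ} (hd : Tendsto (deriv u) l (𝓝 d)) (t : ℝ) :
    deriv u t ^ 2 + 2 * n * m * pot (1 / n) (u t) = d ^ 2 := by
  have h1 : Tendsto (fun s => deriv u s ^ 2 + 2 * n * m * pot (1 / n) (u s)) l
      (𝓝 (d ^ 2 + 2 * n * m * 0)) :=
    (hd.pow 2).add (((tendsto_pot_atBot (one_div_pos_of_one_le hn)).comp hu).const_mul _)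
  have h2 := h1.congr fun s => h.energy hn s t
  have := tendsto_nhds_unique tendsto_const_nhds h2
  linarith

theorem Solves.deriv_strictAnti (h : Solves (1 / n) m u) (hm : 0 < m) (hu : ∀ t, u t < 0) :
    StrictAnti (deriv u) := by
  refine strictAnti_of_deriv_neg fun t => ?_
  rw [(h.2 t).deriv]
  exact mul_neg_of_pos_of_neg hm (force_neg (hu t))

/-- A negative solution with slope `2n` at `-∞`. -/
structure Profile (n : ℕ) (m : ℝ) (u : ℝ → ℝ) : Prop where
  one_le : 1 ≤ n
  pos : 0 < m
  solves : Solves (1 / n) m u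
  neg : ∀ t, u t < 0
  at_bot : Tendsto (deriv u) atBot (𝓝 (2 * n))

namespace Profile

variable (h : Profile n m u)
include h

theorem n_pos : (0 : ℝ) < n := by exact_mod_cast h.one_le

theorem tendsto_atBot : Tendsto u atBot atBot :=
  tendsto_atBot_of_tendsto_deriv h.solves.1 (by have := h.n_pos; positivity) h.at_bot

theorem energy (t : ℝ) : deriv u t ^ 2 + 2 * n * m * pot (1 / n) (u t) = (2 * n) ^ 2 :=
  h.solves.energy_of_tendsto h.one_le h.tendsto_atBot h.at_bot t

theorem strictAnti : StrictAnti (deriv u) := h.solves.deriv_strictAnti h.pos h.neg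

theorem abs_deriv_lt (t : ℝ) : |deriv u t| < 2 * n := by
  have hn := h.n_pos
  apply abs_lt_of_sq_lt_sq _ (by positivity)
  have := h.energy t
  have := mul_pos (mul_pos (mul_pos two_pos hn) h.pos) (pot_pos (1 / n) (u t))
  linarith

theorem comp_add_const (s : ℝ) : Profile n m (fun t => u (t + s)) where
  one_le := h.one_le
  pos := h.pos
  solves := h.solves.comp_add_const s
  neg t := h.neg _
  at_bot := by
    have e : deriv (fun t => u (t + s)) = fun t => deriv u (t + s) := funext fun t => by
      rw [deriv_comp_add_const]
    rw [e]
    exact h.at_bot.comp (tendsto_atBot_add_const_right _ _ tendsto_id)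

end Profile

/-! ### Yang's profiles -/

/-- The kinetic term is nonnegative and vanishes at time 0, so `pot` along the solution never
exceeds its value at -b. As `pot` is strictly increasing up to 0, this is a barrier just above -b.
-/
theorem le_of_energy (hn : 1 ≤ n) {b : ℝ} (hb : 0 < b) (hm : 0 < m) (h : Solves (1 / n) m u)
    (h0 : u 0 = -b) (h1 : deriv u 0 = 0) (t : ℝ) : u t ≤ -b := by
  have hn0 : (0 : ℝ) < n := by exact_mod_cast hn
  have ha := one_div_pos_of_one_le hn
  have key : ∀ t, pot (1 / n) (u t) ≤ pot (1 / n) (-b) := by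
    intro t
    have := h.energy hn t 0
    rw [h0, h1] at this
    have h2 : 0 < 2 * n * m := by positivity
    refine le_of_mul_le_mul_left ?_ h2
    nlinarith [sq_nonneg (deriv u t)]
  by_contra! H
  -- The value is capped at -b/2 so that it lies in (-b, 0], where `pot` is monotone, even if u t is
  -- positive.
  obtain ⟨s, -, hs⟩ := isPreconnected_univ.intermediate_value (mem_univ 0) (mem_univ t)
    h.1.continuous.continuousOn (show min (u t) (-b / 2) ∈ Icc (u 0) (u t) from
      ⟨by rw [h0]; exact le_min H.le (by linarith), min_le_left _ _⟩)
  have h3 : -b < u s := by rw [hs]; exact lt_min H (by linarith)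
  have h4 : u s ≤ 0 := by rw [hs]; exact (min_le_right _ _).trans (by linarith)
  exact absurd (key s) (not_le.2 (pot_strictMonoOn ha (by simp [hb.le]) h4 h3))

theorem Solves.even (hn : 1 ≤ n) (h : Solves (1 / n) m u) (h1 : deriv u 0 = 0) (t : ℝ) :
    u (-t) = u t :=
  congrFun (h.comp_neg.unique (one_div_pos_of_one_le hn) h 0 (by simp)
    (by rw [deriv_comp_neg]; simp [h1])) t

theorem Solves.deriv_odd (hn : 1 ≤ n) (h : Solves (1 / n) m u) (h1 : deriv u 0 = 0) (t : ℝ) :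
    deriv u (-t) = -deriv u t := by
  have : (fun t => u (-t)) = u := funext (h.even hn h1)
  have h2 := deriv_comp_neg (f := u) t
  rw [this] at h2
  rw [h2, neg_neg]

/-- The equation and the boundary conditions for Yang's profile. -/
structure YangProfile (n : ℕ) (b m : ℝ) (u : ℝ → ℝ) : Prop extends Profile n m u where
  b_pos : 0 < b
  init : u 0 = -b
  init_deriv : deriv u 0 = 0
  at_top : Tendsto (deriv u) atTop (𝓝 (-(2 * n)))

theorem yangProfile_iff (hn : 1 ≤ n) {b : ℝ} (hb : 0 < b) :
    YangProfile n b m u ↔ 0 < m ∧ Solves (1 / n) m u ∧ u 0 = -b ∧ deriv u 0 = 0 ∧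
      Tendsto (deriv u) atTop (𝓝 (-(2 * n))) ∧ Tendsto (deriv u) atBot (𝓝 (2 * n)) :=
  ⟨fun h => ⟨h.pos, h.solves, h.init, h.init_deriv, h.at_top, h.at_bot⟩,
    fun ⟨hm, h, h0, h1, h2, h3⟩ => ⟨⟨hn, hm, h, fun t =>
      (le_of_energy hn hb hm h h0 h1 t).trans_lt (by linarith), h3⟩, hb, h0, h1, h2⟩⟩

theorem YangProfile.le {b : ℝ} (h : YangProfile n b m u) (t : ℝ) : u t ≤ -b :=
  le_of_energy h.one_le h.b_pos h.pos h.solves h.init h.init_deriv t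

/-- At time 0 the slope vanishes, and the energy is already known from the slope at -∞; only m is
left. -/
theorem YangProfile.eq {b : ℝ} (h : YangProfile n b m u) : m = 1 / lamB n b := by
  have hn := h.n_pos
  have := h.energy 0
  rw [h.init, h.init_deriv] at this
  rw [one_div_lamB, eq_div_iff (pot_pos _ _).ne']
  have h2 : 2 * (n : ℝ) ≠ 0 := by positivity
  apply mul_left_cancel₀ h2
  linarith

/-- The solution starting at rest at -b stays negative, hence is concave and falls to -∞ for t → +∞.
With this m its energy is (2n)², so |u'| → 2n there; evenness gives the other end. -/
theorem exists_yangProfile (hn : 1 ≤ n) {b : ℝ} (hb : 0 < b) :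
    ∃ u, YangProfile n b (1 / lamB n b) u := by
  have hn0 : (0 : ℝ) < n := by exact_mod_cast hn
  have hm := one_div_pos.2 (lamB_pos hn b)
  obtain ⟨u, h, h0, h1⟩ := exists_solves (one_div_pos_of_one_le hn) (1 / lamB n b) (-b) 0
  have hneg : ∀ t, u t < 0 := fun t => (le_of_energy hn hb hm h h0 h1 t).trans_lt (by linarith)
  have hanti := h.deriv_strictAnti hm hneg
  have hd1 : deriv u 1 < 0 := h1 ▸ hanti one_pos
  have htop : Tendsto u atTop atBot := tendsto_atBot_of_deriv_le h.1 (neg_pos.2 hd1) (T := 1)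
    fun t ht => by simpa using hanti.antitone ht
  have hen : ∀ t, deriv u t ^ 2 = (2 * n) ^ 2 - 2 * n * (1 / lamB n b) * pot (1 / n) (u t) := by
    intro t
    have h2 := h.energy hn t 0
    rw [h0, h1, one_div_lamB] at h2
    rw [one_div_lamB]
    have : 2 * n * (2 * n / pot (1 / n) (-b)) * pot (1 / n) (-b) = (2 * n : ℝ) ^ 2 := by
      have := (pot_pos (1 / n) (-b)).ne'
      field_simp
    linarith
  have hsq : Tendsto (fun t => deriv u t ^ 2) atTop (𝓝 ((2 * n) ^ 2)) := by
    have := (((tendsto_pot_atBot (one_div_pos_of_one_le hn)).comp htop).const_mul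
      (2 * n * (1 / lamB n b))).const_sub ((2 * n : ℝ) ^ 2)
    rw [mul_zero, sub_zero] at this
    exact this.congr fun t => (hen t).symm
  have hT : Tendsto (deriv u) atTop (𝓝 (-(2 * n))) := by
    have := (Real.continuous_sqrt.tendsto _).comp hsq
    rw [Real.sqrt_sq (by positivity)] at this
    refine this.neg.congr' ?_
    filter_upwards [eventually_ge_atTop 1] with t ht
    have : deriv u t < 0 := (hanti.antitone ht).trans_lt hd1
    rw [Function.comp_apply, Real.sqrt_sq_eq_abs, abs_of_neg this, neg_neg]
  refine ⟨u, (yangProfile_iff hn hb).2 ⟨hm, h, h0, h1, hT, ?_⟩⟩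
  have := (hT.comp tendsto_neg_atBot_atTop).neg
  rw [neg_neg] at this
  refine this.congr fun t => ?_
  simp [h.deriv_odd hn h1]

/-! ### The limit profile -/

/-- The difference of the two sides vanishes at 0 and is monotone, its derivative being e^x - 1 - x.
This bound and the next, on the deviation of u - e^u from its maximum, produce the two explicit
rates. -/
theorem exp_sub_le {u : ℝ} (hu : u ≤ 0) : Real.exp u - 1 - u ≤ u ^ 2 / 2 := by
  have hd : ∀ x : ℝ, HasDerivAt (fun x => Real.exp x - 1 - x - x ^ 2 / 2) (Real.exp x - 1 - x) x := by
    intro x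
    have := (((Real.hasDerivAt_exp x).sub_const 1).sub (hasDerivAt_id x)).sub
      ((hasDerivAt_pow 2 x).div_const 2)
    refine this.congr_deriv ?_
    simp
  have hm := monotone_of_deriv_nonneg (fun x => (hd x).differentiableAt) fun x => by
    rw [(hd x).deriv]
    linarith [Real.add_one_le_exp x]
  have := hm hu
  simp only [Real.exp_zero] at this
  linarith

/-- After multiplication by e^{-u} and with x = -u, the claim is x²/2 ≤ 1 + (x - 1) e^x. Both sides
vanish at 0, and the difference has derivative x (e^x - 1) ≥ 0. -/
theorem le_exp_sub {u : ℝ} (hu : u ≤ 0) : u ^ 2 / 2 * Real.exp u ≤ Real.exp u - 1 - u := by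
  have hd : ∀ x : ℝ, HasDerivAt (fun x => 1 + (x - 1) * Real.exp x - x ^ 2 / 2)
      (x * (Real.exp x - 1)) x := by
    intro x
    have := ((((hasDerivAt_id x).sub_const 1).mul (Real.hasDerivAt_exp x)).const_add 1).sub
      ((hasDerivAt_pow 2 x).div_const 2)
    refine this.congr_deriv ?_
    simp
    ring
  have hm := monotone_of_deriv_nonneg (fun x => (hd x).differentiableAt) fun x => by
    rw [(hd x).deriv]
    rcases le_total 0 x with h | h
    · exact mul_nonneg h (by linarith [Real.add_one_le_exp x])
    · exact mul_nonneg_of_nonpos_of_nonpos h (by linarith [Real.exp_le_one_iff.2 h])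
  have h1 := hm (neg_nonneg.2 hu)
  simp only [Real.exp_zero] at h1
  have h2 : Real.exp (-u) * Real.exp u = 1 := by rw [← Real.exp_add]; simp
  have h3 := mul_le_mul_of_nonneg_right h1 (Real.exp_pos u).le
  have h4 : (1 + (-u - 1) * Real.exp (-u) - (-u) ^ 2 / 2) * Real.exp u
      = Real.exp u + (-u - 1) * (Real.exp (-u) * Real.exp u) - u ^ 2 / 2 * Real.exp u := by ring
  rw [h4, h2] at h3
  linarith

theorem pot_div_pot_zero (a u : ℝ) :
    pot a u / pot a 0 = Real.exp (-(a * (Real.exp u - 1 - u))) := by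
  unfold pot
  rw [← Real.exp_sub, Real.exp_zero]
  congr 1
  ring

theorem one_sub_pot_le {a u : ℝ} (ha : 0 < a) (hu : u ≤ 0) :
    1 - pot a u / pot a 0 ≤ a / 2 * u ^ 2 := by
  rw [pot_div_pot_zero]
  have h1 := Real.one_sub_le_exp_neg (a * (Real.exp u - 1 - u))
  have h2 := exp_sub_le hu
  nlinarith

/-- With k = e^u - 1 - u the right side is 1 - e^{-ak} ≥ a k e^{-ak}. In the factor k one uses k ≥
(u²/2) e^{-c}, and in the exponent that k is at most its value at u = -c. -/
theorem le_one_sub_pot {a u c : ℝ} (ha : 0 < a) (hu : u ≤ 0) (hc : -c ≤ u) :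
    a / 2 * u ^ 2 * Real.exp (-(a * (Real.exp (-c) - (1 - c))) - c) ≤ 1 - pot a u / pot a 0 := by
  rw [pot_div_pot_zero]
  set k := Real.exp u - 1 - u with hk
  have hk0 : 0 ≤ k := by linarith [Real.add_one_le_exp u]
  have hkc : k ≤ Real.exp (-c) - (1 - c) := by
    have hd : ∀ x : ℝ, HasDerivAt (fun x => Real.exp x - x) (Real.exp x - 1) x := fun x =>
      (Real.hasDerivAt_exp x).sub (hasDerivAt_id x)
    have hm : AntitoneOn (fun x => Real.exp x - x) (Iic (0 : ℝ)) :=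
      antitoneOn_of_deriv_nonpos (convex_Iic 0) (by fun_prop)
        (fun x _ => (hd x).differentiableAt.differentiableWithinAt) fun x hx => by
          rw [interior_Iic] at hx
          rw [(hd x).deriv]
          linarith [Real.exp_le_one_iff.2 (le_of_lt hx)]
    have := hm (hc.trans hu) hu hc
    simp only at this
    rw [hk]
    linarith
  have h1 : a * k * Real.exp (-(a * k)) ≤ 1 - Real.exp (-(a * k)) := by
    have h2 := Real.add_one_le_exp (a * k)
    have h3 : Real.exp (a * k) * Real.exp (-(a * k)) = 1 := by rw [← Real.exp_add]; simp
    have h4 := mul_le_mul_of_nonneg_right h2 (Real.exp_pos (-(a * k))).le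
    linarith
  refine le_trans ?_ h1
  rw [sub_eq_add_neg, Real.exp_add]
  have h5 : u ^ 2 / 2 * Real.exp (-c) ≤ k := by
    refine le_trans ?_ (le_exp_sub hu)
    gcongr
  have h6 : Real.exp (-(a * (Real.exp (-c) - (1 - c)))) ≤ Real.exp (-(a * k)) := by gcongr
  calc a / 2 * u ^ 2 * (Real.exp (-(a * (Real.exp (-c) - (1 - c)))) * Real.exp (-c))
      = a * (u ^ 2 / 2 * Real.exp (-c)) * Real.exp (-(a * (Real.exp (-c) - (1 - c)))) := by ring
    _ ≤ a * k * Real.exp (-(a * k)) := by gcongr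

/-- The increasing negative solution of zero total energy. -/
structure LimitProfile (n : ℕ) (u : ℝ → ℝ) : Prop extends Profile n (1 / lamB n 0) u where
  deriv_pos : ∀ t, 0 < deriv u t

theorem two_mul_n_mul_one_div_lamB (n : ℕ) (b x : ℝ) :
    2 * n * (1 / lamB n b) * x = (2 * n) ^ 2 * (x / pot (1 / n) (-b)) := by
  rw [one_div_lamB]
  ring

namespace LimitProfile

variable (h : LimitProfile n u)
include h

/-- For the critical m the equilibrium u = 0 has the same energy (2n)², so the slope is controlled
by the distance of `pot` from its maximum. -/
theorem deriv_sq (t : ℝ) :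
    deriv u t ^ 2 = (2 * n) ^ 2 * (1 - pot (1 / n) (u t) / pot (1 / n) 0) := by
  have := h.energy t
  rw [two_mul_n_mul_one_div_lamB, neg_zero] at this
  linarith

/-- Compare squares: 1 - `pot` u / `pot` 0 is at most (a/2) u², and a/2 is the coupling constant. -/
theorem deriv_le (t : ℝ) : deriv u t ≤ 2 * n * √(coupling n) * (-u t) := by
  have hn := h.n_pos
  have hc : 0 ≤ coupling n := by unfold coupling; positivity
  have hu := h.neg t
  apply le_of_sq_le_sq _ (by have := Real.sqrt_nonneg (coupling n); have : 0 ≤ -u t := (by linarith); positivity)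
  rw [h.deriv_sq, mul_pow _ (-u t), mul_pow _ (√(coupling n)), Real.sq_sqrt hc, mul_assoc]
  have := one_sub_pot_le (one_div_pos_of_one_le h.one_le) hu.le
  have e : coupling n = 1 / n / 2 := by rw [← two_mul_coupling]; ring
  rw [e, neg_sq]
  gcongr

theorem le_deriv {c t : ℝ} (hc : -c ≤ u t) :
    2 * n * √(coupling n) * Real.exp (-coupling n * (Real.exp (-c) - (1 - c)) - c / 2) * (-u t) ≤
      deriv u t := by
  have hn := h.n_pos
  have hc0 : 0 ≤ coupling n := by unfold coupling; positivity
  have hu := h.neg t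
  apply le_of_sq_le_sq _ (h.deriv_pos t).le
  have := le_one_sub_pot (one_div_pos_of_one_le h.one_le) hu.le hc
  have e : coupling n = 1 / n / 2 := by rw [← two_mul_coupling]; ring
  rw [h.deriv_sq, mul_pow, mul_pow, mul_pow, Real.sq_sqrt hc0, ← Real.exp_nat_mul, mul_assoc,
    mul_assoc, neg_sq]
  have e2 : ((2 : ℕ) : ℝ) * (-coupling n * (Real.exp (-c) - (1 - c)) - c / 2) =
      -(1 / n * (Real.exp (-c) - (1 - c))) - c := by
    rw [← two_mul_coupling]; push_cast; ring
  rw [e2, e]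
  refine mul_le_mul_of_nonneg_left (le_trans (le_of_eq ?_) this) (by positivity)
  ring

theorem strictMono : StrictMono u := strictMono_of_deriv_pos h.deriv_pos

/-- The inequality u' ≤ κ (-u) says that -u e^{κt} is increasing. -/
theorem lower_bound {c : ℝ} (h0 : u 0 = -c) {t : ℝ} (ht : 0 ≤ t) :
    c * Real.exp (-(2 * n * √(coupling n) * t)) ≤ -u t := by
  set κ := 2 * n * √(coupling n) with hκ
  have hd : ∀ t, HasDerivAt (fun t => -u t * Real.exp (κ * t))
      (Real.exp (κ * t) * (κ * (-u t) - deriv u t)) t := by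
    intro t
    have := (h.solves.hasDerivAt t).neg.mul ((hasDerivAt_id t).const_mul κ).exp
    refine this.congr_deriv ?_
    simp
    ring
  have hm := monotone_of_deriv_nonneg (fun x => (hd x).differentiableAt) fun x => by
    rw [(hd x).deriv]
    exact mul_nonneg (Real.exp_pos _).le (sub_nonneg.2 (h.deriv_le x))
  have := hm ht
  simp only [h0, mul_zero, Real.exp_zero, mul_one, neg_neg] at this
  rw [Real.exp_neg, ← div_eq_mul_inv, div_le_iff₀ (Real.exp_pos _)]
  exact this

/-- Now u' ≥ κ (-u), with a smaller κ, makes -u e^{κt} decreasing. This κ is valid only where u ≥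
-c, which for an increasing u is the half-line t ≥ 0. -/
theorem upper_bound {c : ℝ} (h0 : u 0 = -c) {t : ℝ} (ht : 0 ≤ t) :
    -u t ≤ c * Real.exp (-(2 * n * √(coupling n) *
          Real.exp (-coupling n * (Real.exp (-c) - (1 - c)) - c / 2) * t)) := by
  set κ := 2 * n * √(coupling n) *
          Real.exp (-coupling n * (Real.exp (-c) - (1 - c)) - c / 2) with hκ
  have hd : ∀ t, HasDerivAt (fun t => -u t * Real.exp (κ * t))
      (Real.exp (κ * t) * (κ * (-u t) - deriv u t)) t := by
    intro t
    have := (h.solves.hasDerivAt t).neg.mul ((hasDerivAt_id t).const_mul κ).exp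
    refine this.congr_deriv ?_
    simp
    ring
  have hm : AntitoneOn (fun t => -u t * Real.exp (κ * t)) (Ici 0) :=
    antitoneOn_of_deriv_nonpos (convex_Ici 0)
      (fun t _ => (hd t).continuousAt.continuousWithinAt)
      (fun t _ => (hd t).differentiableAt.differentiableWithinAt) fun x hx => by
        rw [interior_Ici] at hx
        rw [(hd x).deriv]
        refine mul_nonpos_of_nonneg_of_nonpos (Real.exp_pos _).le (sub_nonpos.2 (h.le_deriv ?_))
        rw [← h0]
        exact h.strictMono.monotone (le_of_lt hx)
  have := hm (mem_Ici.2 le_rfl) (mem_Ici.2 ht) ht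
  simp only [h0, mul_zero, Real.exp_zero, mul_one, neg_neg] at this
  rw [Real.exp_neg, ← div_eq_mul_inv, le_div_iff₀ (Real.exp_pos _)]
  exact this

theorem tendsto_zero : Tendsto u atTop (𝓝 0) := by
  have hn := h.n_pos
  obtain ⟨c, hc⟩ : ∃ c, u 0 = -c := ⟨-u 0, by ring⟩
  have hc0 : 0 < coupling n := by unfold coupling; positivity
  have hκ : 0 < 2 * n * √(coupling n) *
          Real.exp (-coupling n * (Real.exp (-c) - (1 - c)) - c / 2) := by
    have := Real.sqrt_pos.2 hc0
    positivity
  have h1 := ((Real.tendsto_exp_neg_atTop_nhds_zero.comp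
    (Tendsto.const_mul_atTop hκ tendsto_id)).const_mul c)
  rw [mul_zero] at h1
  have h2 : Tendsto (fun t => -u t) atTop (𝓝 0) := by
    refine tendsto_of_tendsto_of_tendsto_of_le_of_le' tendsto_const_nhds h1
      (Eventually.of_forall fun t => by linarith [h.neg t]) ?_
    filter_upwards [eventually_ge_atTop 0] with t ht
    exact h.upper_bound hc ht
  simpa using h2.neg

theorem deriv_tendsto_zero : Tendsto (deriv u) atTop (𝓝 0) := by
  have h1 := (h.tendsto_zero.neg).const_mul (2 * n * √(coupling n))
  rw [neg_zero, mul_zero] at h1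
  exact tendsto_of_tendsto_of_tendsto_of_le_of_le tendsto_const_nhds h1
    (fun t => (h.deriv_pos t).le) h.deriv_le

theorem comp_add_const (s : ℝ) : LimitProfile n (fun t => u (t + s)) :=
  ⟨h.toProfile.comp_add_const s, fun t => by rw [deriv_comp_add_const]; exact h.deriv_pos _⟩

end LimitProfile

/-- A zero of u' would give `pot` (u t) = `pot` 0 by energy, impossible for u t < 0. So u' keeps the
positive sign that it has near -∞. -/
theorem Profile.limitProfile_of_eq (h : Profile n (1 / lamB n 0) u) : LimitProfile n u := by
  refine ⟨h, fun t => ?_⟩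
  have ha := one_div_pos_of_one_le h.one_le
  have hn := h.n_pos
  have hne : ∀ t ∈ univ, -deriv u t ≠ 0 := by
    intro t _ h0
    have := h.energy t
    rw [two_mul_n_mul_one_div_lamB, neg_zero, neg_eq_zero.1 h0] at this
    have h1 := (div_lt_one (pot_pos (1 / n) 0)).2 (pot_lt_pot_zero ha (h.neg t).ne)
    have h2 : 0 < (2 * n : ℝ) ^ 2 := by positivity
    nlinarith
  have hcont : Continuous (deriv u) := continuous_iff_continuousAt.2 fun t =>
    (h.solves.2 t).continuousAt
  obtain ⟨T, hT⟩ := eventually_atBot.1 (h.at_bot.eventually (lt_mem_nhds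
    (show (0 : ℝ) < 2 * n by positivity)))
  have := neg_of_ne_zero (u := fun t => -deriv u t) hcont.neg isPreconnected_univ hne (mem_univ T)
    (neg_lt_zero.2 (hT T le_rfl)) t (mem_univ t)
  exact neg_lt_zero.1 this

theorem exists_limitProfile (hn : 1 ≤ n) {c : ℝ} (hc : 0 < c) :
    ∃ u, LimitProfile n u ∧ u 0 = -c := by
  have hn0 : (0 : ℝ) < n := by exact_mod_cast hn
  have ha := one_div_pos_of_one_le hn
  have hm := one_div_pos.2 (lamB_pos hn 0)
  have hr : 0 < 1 - pot (1 / n) (-c) / pot (1 / n) 0 := sub_pos.2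
    ((div_lt_one (pot_pos _ _)).2 (pot_lt_pot_zero ha (by linarith)))
  -- The initial slope is the one for which the energy equals (2n)².
  set p₀ := 2 * n * √(1 - pot (1 / n) (-c) / pot (1 / n) 0) with hp₀
  have hp0 : 0 < p₀ := mul_pos (by positivity) (Real.sqrt_pos.2 hr)
  obtain ⟨u, h, h0, h1⟩ := exists_solves ha (1 / lamB n 0) (-c) p₀
  have hen : ∀ t, deriv u t ^ 2 = (2 * n) ^ 2 * (1 - pot (1 / n) (u t) / pot (1 / n) 0) := by
    intro t
    have h2 := h.energy hn t 0
    rw [h0, h1, two_mul_n_mul_one_div_lamB, two_mul_n_mul_one_div_lamB, neg_zero, hp₀,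
      mul_pow _ (√_), Real.sq_sqrt hr.le] at h2
    linarith
  -- At a zero of u the energy gives u' = 0 as well; by uniqueness u would be the equilibrium.
  have hne : ∀ t ∈ univ, u t ≠ 0 := by
    intro t _ ht
    have h2 := hen t
    rw [ht, div_self (pot_pos _ _).ne', sub_self, mul_zero] at h2
    have hz : Solves (1 / n) (1 / lamB n 0) (fun _ : ℝ => (0 : ℝ)) := by
      refine ⟨differentiable_const _, fun t => ?_⟩
      have : deriv (fun _ : ℝ => (0 : ℝ)) = fun _ => 0 := by ext; simp
      rw [this]
      simpa [force] using hasDerivAt_const t (0 : ℝ)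
    have h3 := h.unique ha hz t ht (by simpa using h2)
    rw [h3] at h0
    linarith
  have hneg : ∀ t, u t < 0 := fun t => neg_of_ne_zero h.1.continuous isPreconnected_univ hne
    (mem_univ 0) (by linarith) t (mem_univ t)
  have hanti := h.deriv_strictAnti hm hneg
  have hbot : Tendsto u atBot atBot := tendsto_atBot_of_le_deriv h.1 hp0 (T := 0)
    fun t ht => h1 ▸ hanti.antitone ht
  refine ⟨u, Profile.limitProfile_of_eq ⟨hn, hm, h, hneg, ?_⟩, h0⟩
  have h3 := ((((tendsto_pot_atBot ha).comp hbot).div_const (pot (1 / n) 0)).const_sub 1).const_mul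
    ((2 * n : ℝ) ^ 2)
  rw [zero_div, sub_zero, mul_one] at h3
  have h4 := (Real.continuous_sqrt.tendsto _).comp (h3.congr fun t => (hen t).symm)
  rw [Real.sqrt_sq (by positivity)] at h4
  refine h4.congr' ?_
  filter_upwards [eventually_le_atBot 0] with t ht
  have : 0 < deriv u t := hp0.trans_le (h1 ▸ hanti.antitone ht)
  rw [Function.comp_apply, Real.sqrt_sq this.le]

theorem not_tendsto_deriv_zero (hu : ∀ t, HasDerivAt (deriv u) (m * force (1 / n) (u t)) t) {ε T : ℝ}
    (hε : 0 < ε) (h : ∀ t, T ≤ t → m * force (1 / n) (u t) ≤ -ε) :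
    ¬ Tendsto (deriv u) atTop (𝓝 0) := fun h0 => by
  have h1 := tendsto_atBot_of_deriv_le (u := deriv u) (fun t => (hu t).differentiableAt) hε (T := T)
    fun t ht => by rw [(hu t).deriv]; exact h t ht
  exact not_tendsto_nhds_of_tendsto_atBot h1 0 h0

/-- A solution with slopes `2n` at `-∞` and `0` at `+∞` is the limit profile. -/
theorem limitProfile_of_tendsto (hn : 1 ≤ n) (hm : 0 < m) (h : Solves (1 / n) m u)
    (hbot : Tendsto (deriv u) atBot (𝓝 (2 * n))) (htop : Tendsto (deriv u) atTop (𝓝 0)) :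
    m = 1 / lamB n 0 ∧ LimitProfile n u := by
  have hn0 : (0 : ℝ) < n := by exact_mod_cast hn
  have ha := one_div_pos_of_one_le hn
  have hub : Tendsto u atBot atBot := tendsto_atBot_of_tendsto_deriv h.1 (by positivity) hbot
  have hen := h.energy_of_tendsto hn hub hbot
  have hpot : Tendsto (fun t => pot (1 / n) (u t)) atTop (𝓝 (2 * n / m)) := by
    have h1 := ((htop.pow 2).const_sub ((2 * n : ℝ) ^ 2)).div_const (2 * n * m)
    have e : ((2 * n : ℝ) ^ 2 - 0 ^ 2) / (2 * n * m) = 2 * n / m := by field_simp; ring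
    rw [e] at h1
    refine h1.congr fun t => ?_
    rw [← hen t]
    field_simp
    ring
  have hle : 2 * n / m ≤ pot (1 / n) 0 := le_of_tendsto' hpot fun t => pot_le_pot_zero ha _
  -- If the limit of `pot` ∘ u were below the maximum, u would eventually stay at distance η from 0,
  -- with constant sign. As `pot` ∘ u has a positive limit, the force would be bounded away from 0
  -- with that sign, and u' would tend to ±∞ instead of 0.
  have heq : 2 * n / m = pot (1 / n) 0 := by
    by_contra hne
    have hlt := lt_of_le_of_ne hle hne
    have hL : 0 < 2 * n / m := by positivity
    obtain ⟨x, hx1, hx2⟩ := exists_between hlt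
    have hnhds : {v | pot (1 / n) v ≤ x}ᶜ ∈ 𝓝 (0 : ℝ) := by
      refine IsOpen.mem_nhds ?_ (by simpa using hx2)
      exact (isClosed_le (contDiff_pot _ (k := 0)).continuous continuous_const).isOpen_compl
    obtain ⟨η, hη, hball⟩ := Metric.mem_nhds_iff.1 hnhds
    obtain ⟨T, hT⟩ := eventually_atTop.1 ((hpot.eventually (gt_mem_nhds hx1)).and
      (hpot.eventually (lt_mem_nhds (half_lt_self hL))))
    have habs : ∀ t ∈ Ici T, η ≤ |u t| := by
      intro t ht
      by_contra! H
      have := hball (show u t ∈ Metric.ball 0 η by simpa using H)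
      exact this (hT t ht).1.le
    have hne : ∀ t ∈ Ici T, u t ≠ 0 := fun t ht h0 => by
      have := habs t ht
      rw [h0, abs_zero] at this
      linarith
    rcases lt_or_gt_of_ne (hne T (mem_Ici.2 le_rfl)) with h0 | h0
    · have hneg := neg_of_ne_zero h.1.continuous isPreconnected_Ici hne (mem_Ici.2 le_rfl) h0
      have he : Real.exp (-η) < 1 := by simpa using hη
      refine not_tendsto_deriv_zero h.2 (T := T)
        (ε := m * (2 * n / m / 2 * (1 - Real.exp (-η))))
        (mul_pos hm (mul_pos (half_pos hL) (by linarith))) (fun t ht => ?_) htop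
      rw [← mul_neg]
      refine mul_le_mul_of_nonneg_left ?_ hm.le
      have h1 : Real.exp (u t) ≤ Real.exp (-η) := by
        have := habs t ht
        rw [abs_of_neg (hneg t ht)] at this
        exact Real.exp_le_exp.2 (by linarith)
      have h2 := (hT t ht).2
      unfold force
      nlinarith [mul_le_mul h2.le (show 1 - Real.exp (-η) ≤ 1 - Real.exp (u t) by linarith)
        (by linarith) (pot_pos _ _).le]
    · have hpos : ∀ t ∈ Ici T, -u t < 0 := neg_of_ne_zero (u := fun t => -u t)
        h.1.continuous.neg isPreconnected_Ici (fun t ht => neg_ne_zero.2 (hne t ht))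
        (mem_Ici.2 le_rfl) (neg_lt_zero.2 h0)
      have he : 1 < Real.exp η := by simpa using hη
      have hd : ∀ t, HasDerivAt (deriv fun t => -u t) (-m * force (1 / n) (u t)) t := by
        intro t
        have e : deriv (fun t => -u t) = fun t => -deriv u t := by
          ext; simp
        rw [e]
        exact (h.2 t).neg.congr_deriv (by ring)
      have htop' : Tendsto (deriv fun t => -u t) atTop (𝓝 0) := by
        have e : deriv (fun t => -u t) = fun t => -deriv u t := by
          ext; simp
        rw [e]
        simpa using htop.neg
      have h1 := tendsto_atBot_of_deriv_le (u := deriv fun t => -u t)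
        (fun t => (hd t).differentiableAt) (d := m * (2 * n / m / 2 * (Real.exp η - 1)))
        (mul_pos hm (mul_pos (half_pos hL) (by linarith))) (T := T) fun t ht => by
          rw [(hd t).deriv, neg_mul]
          refine neg_le_neg (mul_le_mul_of_nonneg_left ?_ hm.le)
          have h1 : Real.exp η ≤ Real.exp (u t) := by
            have := habs t ht
            rw [abs_of_pos (by linarith [hpos t ht])] at this
            exact Real.exp_le_exp.2 (by linarith)
          have h2 := (hT t ht).2
          unfold force
          exact mul_le_mul h2.le (by linarith) (by linarith) (pot_pos _ _).le
      exact not_tendsto_nhds_of_tendsto_atBot h1 0 htop'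
  have hmeq : m = 1 / lamB n 0 := by
    rw [one_div_lamB, neg_zero, ← heq]
    field_simp
  refine ⟨hmeq, Profile.limitProfile_of_eq ⟨hn, hmeq ▸ hm, hmeq ▸ h, ?_, hbot⟩⟩
  -- At a zero of u the energy makes the slope vanish too, so u would be identically 0, against u →
  -- -∞ at -∞.
  have hne : ∀ t ∈ univ, u t ≠ 0 := by
    intro t _ ht
    have h2 := hen t
    rw [ht, hmeq, two_mul_n_mul_one_div_lamB, neg_zero, div_self (pot_pos _ _).ne', mul_one] at h2
    have h2' : deriv u t = 0 := by nlinarith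
    have hz : Solves (1 / n) m (fun _ : ℝ => (0 : ℝ)) := by
      refine ⟨differentiable_const _, fun t => ?_⟩
      have : deriv (fun _ : ℝ => (0 : ℝ)) = fun _ => 0 := by ext; simp
      rw [this]
      simpa [force] using hasDerivAt_const t (0 : ℝ)
    have h3 := h.unique ha hz t ht (by simpa using h2')
    rw [h3] at hub
    exact not_tendsto_const_atBot (0 : ℝ) atBot hub
  obtain ⟨T, hT⟩ := (hub.eventually (eventually_lt_atBot 0)).exists
  exact fun t => neg_of_ne_zero h.1.continuous isPreconnected_univ hne
    (mem_univ T) hT t (mem_univ t)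

/-- The energy and the positivity of the slope determine u' from u, so one common value is enough
initial data. -/
theorem LimitProfile.unique {v : ℝ → ℝ} (hu : LimitProfile n u) (hv : LimitProfile n v)
    {t : ℝ} (h : u t = v t) : u = v := by
  refine hu.solves.unique (one_div_pos_of_one_le hu.one_le) hv.solves t h ?_
  have h1 := hu.deriv_sq t
  rw [h, ← hv.deriv_sq t] at h1
  exact (pow_left_inj₀ (hu.deriv_pos t).le (hv.deriv_pos t).le two_ne_zero).1 h1

end

/-! ### Continuous convergence of families of functions -/

section ContConv

variable {ι X Y E : Type*} [TopologicalSpace X] [TopologicalSpace Y]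

/-- Continuous convergence on `S` along `l`: `f i x' → f₀ x` as `i → l` and `x' → x` in `S`. -/
def ContConv [TopologicalSpace E] (l : Filter ι) (S : Set X) (f : ι → X → E) (f₀ : X → E) : Prop :=
  ∀ x ∈ S, Tendsto (fun q : ι × X => f q.1 q.2) (l ×ˢ 𝓝[S] x) (𝓝 (f₀ x))

variable {l : Filter ι} {S : Set X}

theorem contConv_const [TopologicalSpace E] {f₀ : X → E} (h : ContinuousOn f₀ S) :
    ContConv l S (fun _ => f₀) f₀ := fun x hx =>
  (h x hx).tendsto.comp tendsto_snd

theorem contConv_of_tendsto [TopologicalSpace E] {f : ι → E} {c : E} (h : Tendsto f l (𝓝 c)) :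
    ContConv l S (fun i _ => f i) (fun _ => c) := fun _ _ => h.comp tendsto_fst

theorem ContConv.map [TopologicalSpace E] {F : Type*} [TopologicalSpace F]
    {f : ι → X → E} {f₀ : X → E} (hf : ContConv l S f f₀) {φ : E → F} (hφ : Continuous φ) :
    ContConv l S (fun i x => φ (f i x)) (fun x => φ (f₀ x)) := fun x hx =>
  (hφ.tendsto _).comp (hf x hx)

theorem ContConv.add [TopologicalSpace E] [Add E] [ContinuousAdd E] {f g : ι → X → E}
    {f₀ g₀ : X → E} (hf : ContConv l S f f₀) (hg : ContConv l S g g₀) :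
    ContConv l S (fun i x => f i x + g i x) (fun x => f₀ x + g₀ x) := fun x hx =>
  (hf x hx).add (hg x hx)

theorem ContConv.mul [TopologicalSpace E] [Mul E] [ContinuousMul E] {f g : ι → X → E}
    {f₀ g₀ : X → E} (hf : ContConv l S f f₀) (hg : ContConv l S g g₀) :
    ContConv l S (fun i x => f i x * g i x) (fun x => f₀ x * g₀ x) := fun x hx =>
  (hf x hx).mul (hg x hx)

theorem ContConv.smul [TopologicalSpace E] [SMul ℝ E] [ContinuousSMul ℝ E] {f : ι → X → ℝ}
    {f₀ : X → ℝ} {g : ι → X → E} {g₀ : X → E} (hf : ContConv l S f f₀) (hg : ContConv l S g g₀) :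
    ContConv l S (fun i x => f i x • g i x) (fun x => f₀ x • g₀ x) := fun x hx =>
  (hf x hx).smul (hg x hx)

theorem ContConv.comp [TopologicalSpace E] {f : ι → X → E} {f₀ : X → E} (hf : ContConv l S f f₀)
    {Ω : Set Y} {θ : Y → X} (hθ : ContinuousOn θ Ω) (hm : MapsTo θ Ω S) :
    ContConv l Ω (fun i y => f i (θ y)) (fun y => f₀ (θ y)) := fun y hy => by
  have h1 : Tendsto θ (𝓝[Ω] y) (𝓝[S] θ y) := ContinuousWithinAt.tendsto_nhdsWithin (hθ y hy) hm
  exact (hf (θ y) (hm hy)).comp ((tendsto_id (x := l)).prodMap h1)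

theorem ContConv.congr [TopologicalSpace E] {f g : ι → X → E} {f₀ g₀ : X → E}
    (hf : ContConv l S f f₀) {I : Set ι} (hI : I ∈ l) (h : ∀ i ∈ I, ∀ x ∈ S, f i x = g i x)
    (h₀ : ∀ x ∈ S, f₀ x = g₀ x) : ContConv l S g g₀ := fun x hx => by
  rw [← h₀ x hx]
  refine (hf x hx).congr' ?_
  filter_upwards [prod_mem_prod hI self_mem_nhdsWithin] with q hq using h _ hq.1 _ hq.2

/-- Continuous convergence passes through products and substitutions without auxiliary bounds. With
a continuous limit it amounts to locally uniform convergence, hence is uniform on compact sets. -/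
theorem ContConv.tendstoUniformlyOn [PseudoMetricSpace E] {f : ι → X → E} {f₀ : X → E}
    (hf : ContConv l S f f₀) (h₀ : ContinuousOn f₀ S) {K : Set X} (hK : IsCompact K) (hKS : K ⊆ S) :
    TendstoUniformlyOn f f₀ l K := by
  rw [← tendstoLocallyUniformlyOn_iff_tendstoUniformlyOn_of_compact hK,
    tendstoLocallyUniformlyOn_iff_forall_tendsto]
  intro x hx
  have h1 : Tendsto (fun q : ι × X => f q.1 q.2) (l ×ˢ 𝓝[K] x) (𝓝 (f₀ x)) :=
    (hf x (hKS hx)).mono_left (prod_mono le_rfl (nhdsWithin_mono _ hKS))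
  have h2 : Tendsto (fun q : ι × X => f₀ q.2) (l ×ˢ 𝓝[K] x) (𝓝 (f₀ x)) :=
    (((h₀ x (hKS hx)).mono hKS).tendsto).comp tendsto_snd
  exact (h2.prodMk_nhds h1).mono_right (nhds_le_uniformity (f₀ x))

end ContConv

/-! ### Algebras of functions closed under derivation -/

section DiffAlg

variable {ι : Type*}

/-- The members of `A` have derivatives in `A` on `S`, for the indices in `I`. -/
def DiffAlg (I : Set ι) (S : Set ℝ) (A : Subalgebra ℝ (ι → ℝ → ℝ)) : Prop :=
  ∀ f ∈ A, ∃ f' ∈ A, ∀ i ∈ I, ∀ s ∈ S, HasDerivWithinAt (f i) (f' i s) S s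

theorem diffAlg_adjoin {I : Set ι} {S : Set ℝ} {G : Set (ι → ℝ → ℝ)}
    (h : ∀ f ∈ G, ∃ f' ∈ Algebra.adjoin ℝ G, ∀ i ∈ I, ∀ s ∈ S,
      HasDerivWithinAt (f i) (f' i s) S s) : DiffAlg I S (Algebra.adjoin ℝ G) := by
  intro f hf
  induction hf using Algebra.adjoin_induction with
  | mem x hx => exact h x hx
  | algebraMap r =>
    exact ⟨0, zero_mem _, fun i _ s _ => hasDerivWithinAt_const s S r⟩
  | add x y _ _ ihx ihy =>
    obtain ⟨x', hx', hx⟩ := ihx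
    obtain ⟨y', hy', hy⟩ := ihy
    exact ⟨x' + y', add_mem hx' hy', fun i hi s hs => (hx i hi s hs).add (hy i hi s hs)⟩
  | mul x y hxA hyA ihx ihy =>
    obtain ⟨x', hx', hx⟩ := ihx
    obtain ⟨y', hy', hy⟩ := ihy
    exact ⟨x' * y + x * y', add_mem (mul_mem hx' hyA) (mul_mem hxA hy'),
      fun i hi s hs => (hx i hi s hs).mul (hy i hi s hs)⟩

theorem contConv_adjoin {l : Filter ι} {S : Set ℝ} {G : Set (ι → ℝ → ℝ)} {i₀ : ι}
    (h : ∀ f ∈ G, ContConv l S f (f i₀)) : ∀ f ∈ Algebra.adjoin ℝ G, ContConv l S f (f i₀) := by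
  intro f hf
  induction hf using Algebra.adjoin_induction with
  | mem x hx => exact h x hx
  | algebraMap r => exact contConv_const continuousOn_const
  | add x y _ _ ihx ihy => exact ihx.add ihy
  | mul x y _ _ ihx ihy => exact ihx.mul ihy

variable {I : Set ι} {S : Set ℝ} {A : Subalgebra ℝ (ι → ℝ → ℝ)} {Ω : Set ℂ} {θ : ℂ → ℝ}

/-- The derivative of g(θ) • L is again a sum of terms of this shape, with new vector factors and
with coefficients g and g'. Inductions on the order therefore run over all target spaces E at once.
A derivative of g within S suffices because θ takes its values in S; this admits the boundary point
s = 0 of [0, ∞). -/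
theorem hasFDerivAt_comp_smul {E : Type} [NormedAddCommGroup E] [NormedSpace ℝ E] {L : ℂ → E}
    {g : ℝ → ℝ} {g' : ℝ} {z : ℂ} (hΩ : Ω ∈ 𝓝 z) (hm : MapsTo θ Ω S)
    (hθ : DifferentiableAt ℝ θ z) (hL : DifferentiableAt ℝ L z)
    (hg : HasDerivWithinAt g g' S (θ z)) :
    HasFDerivAt (fun w => g (θ w) • L w)
      (g (θ z) • fderiv ℝ L z + g' • (fderiv ℝ θ z).smulRight (L z)) z := by
  have h1 : HasFDerivAt (fun w => g (θ w)) (g' • fderiv ℝ θ z) z :=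
    (hg.comp_hasFDerivWithinAt z hθ.hasFDerivAt.hasFDerivWithinAt hm).hasFDerivAt hΩ
  refine (h1.smul hL.hasFDerivAt).congr_fderiv ?_
  ext v
  simp [smul_smul]

theorem DiffAlg.contDiffOn (hA : DiffAlg I S A) (hΩ : IsOpen Ω) (hm : MapsTo θ Ω S)
    (hθ : ContDiffOn ℝ ∞ θ Ω) {i : ι} (hi : i ∈ I) {E : Type} [NormedAddCommGroup E]
    [NormedSpace ℝ E] {L : ℂ → E} (hL : ContDiffOn ℝ ∞ L Ω) {f : ι → ℝ → ℝ} (hf : f ∈ A) :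
    ContDiffOn ℝ ∞ (fun z => f i (θ z) • L z) Ω := by
  rw [contDiffOn_infty]
  intro k
  induction k generalizing E f with
  | zero =>
    obtain ⟨f', -, hf'⟩ := hA f hf
    have h1 : ContinuousOn (f i) S := fun s hs => (hf' i hi s hs).continuousWithinAt
    exact contDiffOn_zero.2 ((h1.comp hθ.continuousOn hm).smul hL.continuousOn)
  | succ k ih =>
    obtain ⟨f', hf'A, hf'⟩ := hA f hf
    have hd : ∀ z ∈ Ω, HasFDerivAt (fun w => f i (θ w) • L w)
        (f i (θ z) • fderiv ℝ L z + f' i (θ z) • (fderiv ℝ θ z).smulRight (L z)) z := fun z hz =>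
      hasFDerivAt_comp_smul (hΩ.mem_nhds hz) hm
        ((hθ.contDiffAt (hΩ.mem_nhds hz)).differentiableAt (by simp))
        ((hL.contDiffAt (hΩ.mem_nhds hz)).differentiableAt (by simp)) (hf' i hi _ (hm hz))
    push_cast
    rw [contDiffOn_succ_iff_fderiv_of_isOpen hΩ]
    refine ⟨fun z hz => (hd z hz).differentiableAt.differentiableWithinAt, by simp, ?_⟩
    have hL' := ((contDiffOn_infty_iff_fderiv_of_isOpen hΩ).1 hL).2
    have hθ' := ((contDiffOn_infty_iff_fderiv_of_isOpen hΩ).1 hθ).2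
    exact ((ih hL' hf).add (ih (hθ'.smulRight hL) hf'A)).congr fun z hz => (hd z hz).fderiv

theorem DiffAlg.contConv_iteratedFDeriv (hA : DiffAlg I S A) (hΩ : IsOpen Ω) (hm : MapsTo θ Ω S)
    (hθ : ContDiffOn ℝ ∞ θ Ω) {l : Filter ι} (hI : I ∈ l) {i₀ : ι} (hi₀ : i₀ ∈ I)
    (hc : ∀ f ∈ A, ContConv l S f (f i₀)) (k : ℕ) {E : Type} [NormedAddCommGroup E]
    [NormedSpace ℝ E] {L : ℂ → E} (hL : ContDiffOn ℝ ∞ L Ω) {f : ι → ℝ → ℝ} (hf : f ∈ A) :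
    ContConv l Ω (fun i => iteratedFDeriv ℝ k (fun z => f i (θ z) • L z))
      (iteratedFDeriv ℝ k (fun z => f i₀ (θ z) • L z)) := by
  induction k generalizing E f with
  | zero =>
    have h1 := ((hc f hf).comp hθ.continuousOn hm).smul (contConv_const hL.continuousOn)
    have h2 := h1.map (continuousMultilinearCurryFin0 ℝ ℂ E).symm.continuous
    exact h2
  | succ k ih =>
    obtain ⟨f', hf'A, hf'⟩ := hA f hf
    have hd : ∀ i ∈ I, ∀ z ∈ Ω, HasFDerivAt (fun w => f i (θ w) • L w)
        (f i (θ z) • fderiv ℝ L z + f' i (θ z) • (fderiv ℝ θ z).smulRight (L z)) z := fun i hi z hz =>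
      hasFDerivAt_comp_smul (hΩ.mem_nhds hz) hm
        ((hθ.contDiffAt (hΩ.mem_nhds hz)).differentiableAt (by simp))
        ((hL.contDiffAt (hΩ.mem_nhds hz)).differentiableAt (by simp)) (hf' i hi _ (hm hz))
    have hL' := ((contDiffOn_infty_iff_fderiv_of_isOpen hΩ).1 hL).2
    have hθ' := ((contDiffOn_infty_iff_fderiv_of_isOpen hΩ).1 hθ).2
    have hL'' : ContDiffOn ℝ ∞ (fun z => (fderiv ℝ θ z).smulRight (L z)) Ω := hθ'.smulRight hL
    have h1 := ((ih hL' hf).add (ih hL'' hf'A)).map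
      (continuousMultilinearCurryRightEquiv' ℝ k ℂ E).symm.continuous
    have key : ∀ i ∈ I, ∀ z ∈ Ω,
        (continuousMultilinearCurryRightEquiv' ℝ k ℂ E).symm
          (iteratedFDeriv ℝ k (fun z => f i (θ z) • fderiv ℝ L z) z +
            iteratedFDeriv ℝ k (fun z => f' i (θ z) • (fderiv ℝ θ z).smulRight (L z)) z) =
          iteratedFDeriv ℝ (k + 1) (fun z => f i (θ z) • L z) z := by
      intro i hi z hz
      have c1 := (hA.contDiffOn hΩ hm hθ hi hL' hf).contDiffAt (hΩ.mem_nhds hz)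
      have c2 := (hA.contDiffOn hΩ hm hθ hi hL'' hf'A).contDiffAt (hΩ.mem_nhds hz)
      have hk : (k : WithTop ℕ∞) ≤ (∞ : WithTop ℕ∞) := by exact_mod_cast le_top
      rw [iteratedFDeriv_succ_eq_comp_right, Function.comp_apply,
        ← iteratedFDeriv_add_apply (c1.of_le hk) (c2.of_le hk)]
      congr 1
      have : (fun y => fderiv ℝ (fun z => f i (θ z) • L z) y) =ᶠ[𝓝 z]
          ((fun z => f i (θ z) • fderiv ℝ L z) +
            fun z => f' i (θ z) • (fderiv ℝ θ z).smulRight (L z)) := by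
        filter_upwards [hΩ.mem_nhds hz] with w hw using (hd i hi w hw).fderiv
      exact (this.iteratedFDeriv ℝ k).eq_of_nhds.symm
    exact h1.congr hI key (key i₀ hi₀)

/-- Smooth convergence of `f b (θ z) • L z` for `f` in an algebra closed under derivation. -/
theorem DiffAlg.smoothConv {I : Set ℝ} {A : Subalgebra ℝ (ℝ → ℝ → ℝ)} (hA : DiffAlg I S A)
    (hΩ : IsOpen Ω) (hm : MapsTo θ Ω S) (hθ : ContDiffOn ℝ ∞ θ Ω) (hI : I ∈ 𝓝[>] (0 : ℝ))
    (hI₀ : (0 : ℝ) ∈ I) (hc : ∀ f ∈ A, ContConv (𝓝[>] 0) S f (f 0)) {E : Type}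
    [NormedAddCommGroup E] [NormedSpace ℝ E] {L : ℂ → E} (hL : ContDiffOn ℝ ∞ L Ω)
    {f : ℝ → ℝ → ℝ} (hf : f ∈ A) {F : ℝ → ℂ → E} {F₀ : ℂ → E}
    (hF : ∀ b ∈ I, b ≠ 0 → ∀ z ∈ Ω, F b z = f b (θ z) • L z)
    (hF₀ : ∀ z ∈ Ω, F₀ z = f 0 (θ z) • L z) : SmoothConv Ω F F₀ := by
  intro k K hK hKc
  have hcongr : ∀ {G G' : ℂ → E}, (∀ z ∈ Ω, G z = G' z) → ∀ z ∈ Ω,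
      iteratedFDeriv ℝ k G z = iteratedFDeriv ℝ k G' z := by
    intro G G' h z hz
    have : G =ᶠ[𝓝 z] G' := by filter_upwards [hΩ.mem_nhds hz] with w hw using h w hw
    exact (this.iteratedFDeriv ℝ k).eq_of_nhds
  have h1 := hA.contConv_iteratedFDeriv hΩ hm hθ hI hI₀ hc k hL hf
  have h2 : ContConv (𝓝[>] (0 : ℝ)) Ω (fun b => iteratedFDeriv ℝ k (F b)) (iteratedFDeriv ℝ k F₀) :=
    h1.congr (inter_mem hI self_mem_nhdsWithin)
      (fun b hb z hz => (hcongr (hF b hb.1 (ne_of_gt hb.2)) z hz).symm)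
      (fun z hz => (hcongr hF₀ z hz).symm)
  refine h2.tendstoUniformlyOn ?_ hKc hK
  have hk : (k : WithTop ℕ∞) ≤ (∞ : WithTop ℕ∞) := by exact_mod_cast le_top
  have h3 : ContDiffOn ℝ ∞ F₀ Ω := (hA.contDiffOn hΩ hm hθ hI₀ hL hf).congr hF₀
  refine ((h3.continuousOn_iteratedFDerivWithin hk hΩ.uniqueDiffOn)).congr fun z hz => ?_
  rw [iteratedFDerivWithin_of_isOpen k hΩ hz]

end DiffAlg

/-! ### The profile as a regular function of `s = |z|²` -/

/-- `log h = u - 2 n t` as a function of `s = e^{2t}`, extended to `s = 0`. -/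
noncomputable def logWeight (n : ℕ) (u : ℝ → ℝ) (s : ℝ) : ℝ :=
  if s = 0 then limUnder atBot (fun t => u t - 2 * n * t) else u (Real.log s / 2) - n * Real.log s

/-- The weight `h` as a function of `s = |z|²`. -/
noncomputable def weight (n : ℕ) (u : ℝ → ℝ) (s : ℝ) : ℝ := Real.exp (logWeight n u s)

/-- The slope `u'` as a function of `s = e^{2t}`, extended to `s = 0`. -/
noncomputable def slope (n : ℕ) (u : ℝ → ℝ) (s : ℝ) : ℝ :=
  if s = 0 then 2 * n else deriv u (Real.log s / 2)

/-- The reciprocal of `u' + 2 n`. -/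
noncomputable def invSlope (n : ℕ) (u : ℝ → ℝ) (s : ℝ) : ℝ := (slope n u s + 2 * n)⁻¹

/-- The conformal factor as a function of `s = |z|²`. -/
noncomputable def factor (n : ℕ) (m : ℝ) (u : ℝ → ℝ) (s : ℝ) : ℝ :=
  m * Real.exp ((logWeight n u s - s ^ n * weight n u s) / n)

section

variable {n : ℕ} {m : ℝ} {u : ℝ → ℝ}

theorem weight_pos (n : ℕ) (u : ℝ → ℝ) (s : ℝ) : 0 < weight n u s := Real.exp_pos _

theorem pow_mul_weight {s : ℝ} (hs : 0 < s) :
    s ^ n * weight n u s = Real.exp (u (Real.log s / 2)) := by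
  have : s ^ n = Real.exp (n * Real.log s) := by
    rw [Real.exp_nat_mul, Real.exp_log hs]
  rw [weight, logWeight, if_neg hs.ne', this, ← Real.exp_add]
  congr 1
  ring

theorem factor_mul {s : ℝ} (hn : 1 ≤ n) (hs : 0 < s) :
    factor n m u s * s = m * pot (1 / n) (u (Real.log s / 2)) := by
  have hn0 : (n : ℝ) ≠ 0 := by positivity
  rw [factor, pow_mul_weight hs, logWeight, if_neg hs.ne', mul_assoc]
  congr 1
  nth_rewrite 4 [← Real.exp_log hs]
  rw [← Real.exp_add, pot]
  congr 1
  field_simp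
  ring

theorem tendsto_log_div_two : Tendsto (fun s : ℝ => Real.log s / 2) (𝓝[>] 0) atBot :=
  Real.tendsto_log_nhdsGT_zero.atBot_div_const two_pos

namespace Profile

variable (h : Profile n m u)
include h

theorem factor_pos (s : ℝ) : 0 < factor n m u s := mul_pos h.pos (Real.exp_pos _)

theorem hasDerivAt_sub (t : ℝ) : HasDerivAt (fun t => u t - 2 * n * t) (deriv u t - 2 * n) t :=
  ((h.solves.hasDerivAt t).sub ((hasDerivAt_id t).const_mul (2 * n : ℝ))).congr_deriv (by simp)

theorem antitone_sub : Antitone (fun t => u t - 2 * n * t) :=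
  antitone_of_deriv_nonpos (fun t => (h.hasDerivAt_sub t).differentiableAt) fun t => by
    rw [(h.hasDerivAt_sub t).deriv]
    linarith [(abs_lt.1 (h.abs_deriv_lt t)).2]

/-- The energy identity (2n - u')(2n + u') = 2 n m `pot` u gives 2n - u' ≤ m e^{u/n} where u' ≥ 0.
For u' ≥ δ this is at most (m/δ) u' e^{u/n}, the derivative of (n m/δ) e^{u/n}; adding that term
makes u - 2nt increasing. The bound uses data at t₁ only, hence is uniform in families. -/
theorem sub_le_of_le {δ t₀ t₁ t : ℝ} (hδ : 0 < δ) (h0 : δ ≤ deriv u t₀) (h1 : t₁ ≤ t₀)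
    (ht : t ≤ t₁) :
    u t - 2 * n * t ≤ u t₁ - 2 * n * t₁ + n * m / δ * Real.exp (1 / n * u t₁) := by
  have hn := h.n_pos
  have hm := h.pos
  have hd : ∀ t, HasDerivAt (fun t => u t - 2 * n * t + n * m / δ * Real.exp (1 / n * u t))
      (deriv u t - 2 * n + m / δ * Real.exp (1 / n * u t) * deriv u t) t := by
    intro t
    have := (h.hasDerivAt_sub t).add
      ((((h.solves.hasDerivAt t).const_mul (1 / n : ℝ)).exp).const_mul (n * m / δ))
    refine this.congr_deriv ?_
    field_simp
  have hmono : MonotoneOn (fun t => u t - 2 * n * t + n * m / δ * Real.exp (1 / n * u t))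
      (Iic t₀) := by
    refine monotoneOn_of_deriv_nonneg (convex_Iic _)
      (fun t _ => (hd t).continuousAt.continuousWithinAt)
      (fun t _ => (hd t).differentiableAt.differentiableWithinAt) fun x hx => ?_
    rw [interior_Iic] at hx
    rw [(hd x).deriv]
    have hx0 : δ ≤ deriv u x := h0.trans (h.strictAnti.antitone (le_of_lt hx))
    have e1 := h.energy x
    have e2 : pot (1 / n) (u x) ≤ Real.exp (1 / n * u x) := by
      apply Real.exp_le_exp.2
      have := mul_pos (one_div_pos_of_one_le h.one_le) (Real.exp_pos (u x))
      linarith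
    have e3 : m * Real.exp (1 / n * u x) ≤ m / δ * Real.exp (1 / n * u x) * deriv u x := by
      have : m / δ * Real.exp (1 / n * u x) * δ ≤ m / δ * Real.exp (1 / n * u x) * deriv u x := by
        gcongr
      have e : m / δ * Real.exp (1 / n * u x) * δ = m * Real.exp (1 / n * u x) := by field_simp
      linarith
    have e4 : 2 * n - deriv u x ≤ m * pot (1 / n) (u x) := by
      have hp := (abs_lt.1 (h.abs_deriv_lt x)).2
      have : 2 * n * (2 * n - deriv u x) ≤ 2 * n * (m * pot (1 / n) (u x)) := by nlinarith
      exact le_of_mul_le_mul_left this (by positivity)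
    have e5 := mul_le_mul_of_nonneg_left e2 hm.le
    linarith
  have h2 := hmono (mem_Iic.2 (ht.trans h1)) (mem_Iic.2 h1) ht
  simp only at h2
  have : 0 < n * m / δ * Real.exp (1 / n * u t) := by positivity
  linarith

theorem exists_deriv_ge : ∃ t₀, ∀ t ≤ t₀, (n : ℝ) < deriv u t :=
  eventually_atBot.1 (h.at_bot.eventually (lt_mem_nhds (by linarith [h.n_pos])))

/-- As t decreases u - 2nt increases and stays bounded. So the limit in the definition of
`logWeight` at 0 exists. -/
theorem tendsto_logWeight :
    Tendsto (fun t => u t - 2 * n * t) atBot (𝓝 (logWeight n u 0)) := by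
  obtain ⟨t₀, ht₀⟩ := h.exists_deriv_ge
  have hb : BddAbove (range fun t => u t - 2 * n * t) := by
    refine ⟨u t₀ - 2 * n * t₀ + n * m / n * Real.exp (1 / n * u t₀), ?_⟩
    rintro _ ⟨t, rfl⟩
    rcases le_total t t₀ with ht | ht
    · exact h.sub_le_of_le h.n_pos (ht₀ t₀ le_rfl).le le_rfl ht
    · have := h.antitone_sub ht
      have hn := h.n_pos
      have hm := h.pos
      have : 0 < n * m / n * Real.exp (1 / n * u t₀) := by positivity
      simp only at *
      linarith
  have := tendsto_atBot_ciSup h.antitone_sub hb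
  rw [logWeight, if_pos rfl]
  exact tendsto_nhds_limUnder ⟨_, this⟩

/-- Both ends of the interval are read off at the single time t₁, so they pass to the limit in a
family. This replaces compactness near s = 0. -/
theorem logWeight_mem {δ t₀ t₁ s : ℝ} (hδ : 0 < δ) (h0 : δ ≤ deriv u t₀) (h1 : t₁ ≤ t₀)
    (hs : 0 ≤ s) (hs1 : s ≤ Real.exp (2 * t₁)) :
    logWeight n u s ∈ Icc (u t₁ - 2 * n * t₁)
      (u t₁ - 2 * n * t₁ + n * m / δ * Real.exp (1 / n * u t₁)) := by
  have key : ∀ t ≤ t₁, u t - 2 * n * t ∈ Icc (u t₁ - 2 * n * t₁)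
      (u t₁ - 2 * n * t₁ + n * m / δ * Real.exp (1 / n * u t₁)) := fun t ht =>
    ⟨h.antitone_sub ht, h.sub_le_of_le hδ h0 h1 ht⟩
  rcases hs.eq_or_lt with rfl | hs
  · exact isClosed_Icc.mem_of_tendsto h.tendsto_logWeight ((eventually_le_atBot t₁).mono key)
  · have := key (Real.log s / 2) (by
      have := Real.log_le_log hs hs1
      rw [Real.log_exp] at this
      linarith)
    rw [logWeight, if_neg hs.ne']
    have e : 2 * n * (Real.log s / 2) = n * Real.log s := by ring
    rwa [e] at this

theorem slope_mem {t₁ s : ℝ} (hs : 0 ≤ s) (hs1 : s ≤ Real.exp (2 * t₁)) :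
    slope n u s ∈ Icc (deriv u t₁) (2 * n) := by
  rcases hs.eq_or_lt with rfl | hs
  · rw [slope, if_pos rfl]
    exact ⟨(abs_lt.1 (h.abs_deriv_lt t₁)).2.le, le_rfl⟩
  · rw [slope, if_neg hs.ne']
    refine ⟨h.strictAnti.antitone ?_, (abs_lt.1 (h.abs_deriv_lt _)).2.le⟩
    have := Real.log_le_log hs hs1
    rw [Real.log_exp] at this
    linarith

theorem slope_add_pos (s : ℝ) : 0 < slope n u s + 2 * n := by
  have hn := h.n_pos
  unfold slope
  split_ifs
  · positivity
  · linarith [(abs_lt.1 (h.abs_deriv_lt (Real.log s / 2))).1]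

/-- The energy identity divided by 2n + u', with m `pot` u = s · `factor`. It exhibits 2n - u' as
divisible by s, and so removes the pole from the derivative (u' - 2n)/(2s) of `logWeight`. -/
theorem mul_factor_mul_invSlope {s : ℝ} (hs : 0 ≤ s) :
    2 * n * (s * (factor n m u s * invSlope n u s)) = 2 * n - slope n u s := by
  have hp := h.slope_add_pos s
  rcases hs.eq_or_lt with rfl | hs
  · simp [slope]
  · have e1 := factor_mul (m := m) (u := u) h.one_le hs
    have e2 := h.energy (Real.log s / 2)
    rw [invSlope, ← mul_assoc s, mul_comm s, e1, ← div_eq_mul_inv, mul_div_assoc', div_eq_iff hp.ne']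
    rw [slope, if_neg hs.ne']
    linarith

theorem continuousWithinAt_logWeight : ContinuousWithinAt (logWeight n u) (Ioi 0) 0 := by
  refine (h.tendsto_logWeight.comp tendsto_log_div_two).congr' ?_
  filter_upwards [self_mem_nhdsWithin] with s hs
  rw [logWeight, if_neg (ne_of_gt hs), Function.comp_apply]
  ring

theorem continuousWithinAt_slope : ContinuousWithinAt (slope n u) (Ioi 0) 0 := by
  have := h.at_bot.comp tendsto_log_div_two
  rw [ContinuousWithinAt]
  have e : slope n u 0 = 2 * n := if_pos rfl
  rw [e]
  refine this.congr' ?_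
  filter_upwards [self_mem_nhdsWithin] with s hs
  rw [slope, if_neg (ne_of_gt hs), Function.comp_apply]

theorem hasDerivAt_logWeight {s : ℝ} (hs : 0 < s) :
    HasDerivAt (logWeight n u) (-(n * (factor n m u s * invSlope n u s))) s := by
  have h1 := (h.solves.hasDerivAt (Real.log s / 2)).comp s ((Real.hasDerivAt_log hs.ne').div_const 2)
  have h2 := h1.sub ((Real.hasDerivAt_log hs.ne').const_mul (n : ℝ))
  have h3 := h2.congr_of_eventuallyEq (f₁ := logWeight n u) (by
    filter_upwards [lt_mem_nhds hs] with r hr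
    rw [logWeight, if_neg (ne_of_gt hr)]
    rfl)
  refine h3.congr_deriv ?_
  have e := h.mul_factor_mul_invSlope hs.le
  rw [slope, if_neg hs.ne'] at e
  field_simp
  linarith

theorem hasDerivAt_slope {s : ℝ} (hs : 0 < s) :
    HasDerivAt (slope n u) (factor n m u s * (s ^ n * weight n u s - 1) / 2) s := by
  have h1 := (h.solves.2 (Real.log s / 2)).comp s ((Real.hasDerivAt_log hs.ne').div_const 2)
  have h3 := h1.congr_of_eventuallyEq (f₁ := slope n u) (by
    filter_upwards [lt_mem_nhds hs] with r hr
    rw [slope, if_neg (ne_of_gt hr)]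
    rfl)
  refine h3.congr_deriv ?_
  have e1 := factor_mul (m := m) (u := u) h.one_le hs
  rw [pow_mul_weight hs, force]
  field_simp
  linear_combination -(Real.exp (u (Real.log s / 2)) - 1) * e1

theorem continuousWithinAt_factor : ContinuousWithinAt (factor n m u) (Ioi 0) 0 := by
  have := h.continuousWithinAt_logWeight
  unfold factor weight
  fun_prop

theorem hasDerivWithinAt_logWeight {s : ℝ} (hs : s ∈ Ici (0 : ℝ)) :
    HasDerivWithinAt (logWeight n u) (-(n * (factor n m u s * invSlope n u s))) (Ici 0) s := by
  rcases (mem_Ici.1 hs).eq_or_lt with rfl | hs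
  -- At the end point the one-sided derivative is the limit of the interior derivatives, whose
  -- formula is continuous at 0.
  · refine hasDerivWithinAt_Ici_of_tendsto_deriv (s := Ioi 0)
      (fun r hr => (h.hasDerivAt_logWeight hr).differentiableAt.differentiableWithinAt)
      h.continuousWithinAt_logWeight self_mem_nhdsWithin ?_
    have h1 : ContinuousWithinAt (fun s => -(n * (factor n m u s * invSlope n u s))) (Ioi 0) 0 := by
      have h2 := h.continuousWithinAt_factor
      have h3 : ContinuousWithinAt (invSlope n u) (Ioi 0) 0 :=
        (h.continuousWithinAt_slope.add_const _).inv₀ (h.slope_add_pos 0).ne'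
      fun_prop
    refine h1.tendsto.congr' ?_
    filter_upwards [self_mem_nhdsWithin] with r hr using (h.hasDerivAt_logWeight hr).deriv.symm
  · exact (h.hasDerivAt_logWeight hs).hasDerivWithinAt

theorem hasDerivWithinAt_slope {s : ℝ} (hs : s ∈ Ici (0 : ℝ)) :
    HasDerivWithinAt (slope n u) (factor n m u s * (s ^ n * weight n u s - 1) / 2) (Ici 0) s := by
  rcases (mem_Ici.1 hs).eq_or_lt with rfl | hs
  · refine hasDerivWithinAt_Ici_of_tendsto_deriv (s := Ioi 0)
      (fun r hr => (h.hasDerivAt_slope hr).differentiableAt.differentiableWithinAt)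
      h.continuousWithinAt_slope self_mem_nhdsWithin ?_
    have h1 : ContinuousWithinAt (fun s => factor n m u s * (s ^ n * weight n u s - 1) / 2)
        (Ioi 0) 0 := by
      have h2 := h.continuousWithinAt_factor
      have h3 := h.continuousWithinAt_logWeight
      unfold weight
      fun_prop
    refine h1.tendsto.congr' ?_
    filter_upwards [self_mem_nhdsWithin] with r hr using (h.hasDerivAt_slope hr).deriv.symm
  · exact (h.hasDerivAt_slope hs).hasDerivWithinAt

theorem hasDerivWithinAt_weight {s : ℝ} (hs : s ∈ Ici (0 : ℝ)) :
    HasDerivWithinAt (weight n u) (-(n * (factor n m u s * invSlope n u s)) * weight n u s)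
      (Ici 0) s :=
  (h.hasDerivWithinAt_logWeight hs).exp.congr_deriv (mul_comm _ _)

theorem hasDerivWithinAt_invSlope {s : ℝ} (hs : s ∈ Ici (0 : ℝ)) :
    HasDerivWithinAt (invSlope n u)
      (-(factor n m u s * (s ^ n * weight n u s - 1) / 2) * invSlope n u s ^ 2) (Ici 0) s := by
  have := ((h.hasDerivWithinAt_slope hs).add_const (2 * n : ℝ)).inv (h.slope_add_pos s).ne'
  refine this.congr_deriv ?_
  rw [invSlope, div_eq_mul_inv _ ((slope n u s + 2 * n) ^ 2), inv_pow]

theorem hasDerivWithinAt_factor {s : ℝ} (hs : s ∈ Ici (0 : ℝ)) :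
    HasDerivWithinAt (factor n m u)
      (factor n m u s * (-(factor n m u s * invSlope n u s) - s ^ (n - 1) * weight n u s +
        s ^ n * (factor n m u s * invSlope n u s * weight n u s))) (Ici 0) s := by
  have hn := h.n_pos
  have h1 := (hasDerivAt_pow n s).hasDerivWithinAt (s := Ici 0)
  have := ((((h.hasDerivWithinAt_logWeight hs).sub
    (h1.mul (h.hasDerivWithinAt_weight hs))).div_const (n : ℝ)).exp).const_mul m
  refine this.congr_deriv ?_
  simp only [factor, Pi.sub_apply, Pi.mul_apply]
  field_simp
  ring

end Profile

/-! ### The algebra generated by a family of profiles -/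

variable {ι : Type*} {M : ι → ℝ} {U : ι → ℝ → ℝ} {I : Set ι}

/-- Generators of an algebra of functions of `s = |z|²` that is closed under derivation. -/
def planeGen (n : ℕ) (M : ι → ℝ) (U : ι → ℝ → ℝ) : Set (ι → ℝ → ℝ) :=
  {fun _ s => s, fun i => weight n (U i), fun i => slope n (U i), fun i => invSlope n (U i),
    fun i => factor n (M i) (U i)}

/-- The algebra generated by `planeGen`. -/
noncomputable def planeAlg (n : ℕ) (M : ι → ℝ) (U : ι → ℝ → ℝ) : Subalgebra ℝ (ι → ℝ → ℝ) :=
  Algebra.adjoin ℝ (planeGen n M U)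

theorem var_mem_planeAlg : (fun _ s => s) ∈ planeAlg n M U :=
  Algebra.subset_adjoin (by simp [planeGen])

theorem weight_mem_planeAlg : (fun i => weight n (U i)) ∈ planeAlg n M U :=
  Algebra.subset_adjoin (by simp [planeGen])

theorem invSlope_mem_planeAlg : (fun i => invSlope n (U i)) ∈ planeAlg n M U :=
  Algebra.subset_adjoin (by simp [planeGen])

theorem factor_mem_planeAlg : (fun i => factor n (M i) (U i)) ∈ planeAlg n M U :=
  Algebra.subset_adjoin (by simp [planeGen])

/-- None of the derivative formulas divides by s; the only lowered exponent is in s ^ (n - 1),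
harmless as n ≥ 1. Including the reciprocal of u' + 2n among the generators is what closes the
system. -/
theorem diffAlg_planeAlg (h : ∀ i ∈ I, Profile n (M i) (U i)) :
    DiffAlg I (Ici 0) (planeAlg n M U) := by
  have hs := var_mem_planeAlg (n := n) (M := M) (U := U)
  have hH := weight_mem_planeAlg (n := n) (M := M) (U := U)
  have hR := invSlope_mem_planeAlg (n := n) (M := M) (U := U)
  have hF := factor_mem_planeAlg (n := n) (M := M) (U := U)
  set S : ι → ℝ → ℝ := fun _ s => s with hS
  set H : ι → ℝ → ℝ := fun i => weight n (U i) with hHdef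
  set R : ι → ℝ → ℝ := fun i => invSlope n (U i) with hRdef
  set F : ι → ℝ → ℝ := fun i => factor n (M i) (U i) with hFdef
  have hFR := mul_mem hF hR
  have hP : (1 / 2 : ℝ) • (F * (S ^ n * H - 1)) ∈ planeAlg n M U :=
    Subalgebra.smul_mem _ (mul_mem hF (sub_mem (mul_mem (pow_mem hs n) hH) (one_mem _))) _
  refine diffAlg_adjoin fun f hf => ?_
  simp only [planeGen, mem_insert_iff, mem_singleton_iff] at hf
  rcases hf with rfl | rfl | rfl | rfl | rfl
  · exact ⟨1, one_mem _, fun i _ s _ => hasDerivWithinAt_id s _⟩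
  · refine ⟨(-(n : ℝ)) • (F * R * H), Subalgebra.smul_mem _ (mul_mem hFR hH) _,
      fun i hi s hs => ((h i hi).hasDerivWithinAt_weight hs).congr_deriv ?_⟩
    simp [H, F, R]
    ring
  · refine ⟨_, hP, fun i hi s hs => ((h i hi).hasDerivWithinAt_slope hs).congr_deriv ?_⟩
    simp [H, F, S]
    ring
  · refine ⟨-((1 / 2 : ℝ) • (F * (S ^ n * H - 1)) * R ^ 2),
      neg_mem (mul_mem hP (pow_mem hR 2)),
      fun i hi s hs => ((h i hi).hasDerivWithinAt_invSlope hs).congr_deriv ?_⟩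
    simp [H, F, S, R]
    ring
  · refine ⟨F * (-(F * R) - S ^ (n - 1) * H + S ^ n * (F * R * H)),
      mul_mem hF (add_mem (sub_mem (neg_mem hFR) (mul_mem (pow_mem hs _) hH))
        (mul_mem (pow_mem hs _) (mul_mem hFR hH))),
      fun i hi s hs => (h i hi).hasDerivWithinAt_factor hs⟩

/-! ### Convergence of families of profiles -/

/-- Convergence of profiles together with their slopes, uniformly on compact sets. -/
structure ProfileConv (n : ℕ) (l : Filter ι) (M : ι → ℝ) (U : ι → ℝ → ℝ) (m₀ : ℝ) (u₀ : ℝ → ℝ) :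
    Prop where
  param : Tendsto M l (𝓝 m₀)
  value : ContConv l univ U u₀
  slope : ContConv l univ (fun i => deriv (U i)) (deriv u₀)

theorem ContConv.tendsto_apply {l : Filter ι} {f : ι → ℝ → ℝ} {f₀ : ℝ → ℝ}
    (h : ContConv l univ f f₀) (t : ℝ) : Tendsto (fun i => f i t) l (𝓝 (f₀ t)) :=
  (h t (mem_univ t)).comp ((tendsto_id (x := l)).prodMk (by
    rw [nhdsWithin_univ]; exact tendsto_const_nhds))

theorem ContConv.tendsto_comp {l : Filter ι} {f : ι → ℝ → ℝ} {f₀ : ℝ → ℝ}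
    (h : ContConv l univ f f₀) {X : Type*} {F : Filter X} {θ : X → ℝ} {x : ℝ}
    (hθ : Tendsto θ F (𝓝 x)) :
    Tendsto (fun q : ι × X => f q.1 (θ q.2)) (l ×ˢ F) (𝓝 (f₀ x)) := by
  have h1 := h x (mem_univ x)
  rw [nhdsWithin_univ] at h1
  exact h1.comp ((tendsto_id (x := l)).prodMap hθ)

theorem mem_Ici_inter_nhds {t : ℝ} : {s | s ≤ Real.exp (2 * t)} ∩ Ici 0 ∈ 𝓝[Ici 0] (0 : ℝ) :=
  inter_mem (mem_nhdsWithin_of_mem_nhds (Iic_mem_nhds (Real.exp_pos _))) self_mem_nhdsWithin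

theorem contConv_logWeight {l : Filter ι} {i₀ : ι} (hI : I ∈ l) (hi₀ : i₀ ∈ I)
    (h : ∀ i ∈ I, Profile n (M i) (U i)) (hc : ProfileConv n l M U (M i₀) (U i₀)) :
    ContConv l (Ici 0) (fun i => logWeight n (U i)) (logWeight n (U i₀)) := by
  intro s hs
  have h₀ := h i₀ hi₀
  have hn := h₀.n_pos
  rcases (mem_Ici.1 hs).eq_or_lt with rfl | hs
  · rw [Metric.tendsto_nhds]
    intro ε hε
    obtain ⟨t₀, ht₀⟩ := h₀.exists_deriv_ge
    have hexp : Tendsto (fun t => n * M i₀ / n * Real.exp (1 / n * U i₀ t)) atBot (𝓝 0) := by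
      have := (Real.tendsto_exp_atBot.comp (Tendsto.const_mul_atBot
        (one_div_pos_of_one_le h₀.one_le) h₀.tendsto_atBot)).const_mul (n * M i₀ / n)
      simpa using this
    -- The time t₁ is so early that, for the limit profile, the interval of `logWeight_mem` is
    -- shorter than ε/4 and its left end is ε/4-close to the value at s = 0. Convergence at t₀ and
    -- t₁ alone then controls all nearby profiles on 0 ≤ s ≤ e^{2t₁}.
    obtain ⟨t₁, h1, h2, h3⟩ := ((eventually_le_atBot t₀).and
      ((hexp.eventually (gt_mem_nhds (show 0 < ε / 4 by positivity))).and
        (Metric.tendsto_nhds.1 h₀.tendsto_logWeight (ε / 4) (by positivity)))).exists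
    have e1 := (hc.slope.tendsto_apply t₀).eventually (lt_mem_nhds (ht₀ t₀ le_rfl))
    have hexp' : Tendsto (fun i => n * M i / n * Real.exp (1 / n * U i t₁)) l
        (𝓝 (n * M i₀ / n * Real.exp (1 / n * U i₀ t₁))) :=
      ((hc.param.const_mul (n : ℝ)).div_const (n : ℝ)).mul
        (((hc.value.tendsto_apply t₁).const_mul (1 / n : ℝ)).rexp)
    have e2 := hexp'.eventually (gt_mem_nhds h2)
    have e3 := Metric.tendsto_nhds.1 (hc.value.tendsto_apply t₁) (ε / 4) (by positivity)
    filter_upwards [prod_mem_prod (inter_mem hI (inter_mem e1 (inter_mem e2 e3)))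
      (mem_Ici_inter_nhds (t := t₁))] with q hq
    obtain ⟨⟨q1, q2, q3, q4⟩, q5, q6⟩ := hq
    have := (h _ q1).logWeight_mem hn (le_of_lt q2) h1 q6 q5
    simp only [Real.dist_eq, mem_ofPred_eq, mem_Icc] at *
    rw [abs_lt] at h3 q4 ⊢
    constructor <;> linarith [h3.1, h3.2, q4.1, q4.2, this.1, this.2]
  · have hlog : ContinuousAt Real.log s := Real.continuousAt_log hs.ne'
    have h1 : Tendsto (fun q : ι × ℝ => U q.1 (Real.log q.2 / 2)) (l ×ˢ 𝓝[Ici 0] s)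
        (𝓝 (U i₀ (Real.log s / 2))) :=
      hc.value.tendsto_comp ((hlog.div_const 2).tendsto.mono_left nhdsWithin_le_nhds)
    have h2 : Tendsto (fun q : ι × ℝ => n * Real.log q.2) (l ×ˢ 𝓝[Ici 0] s)
        (𝓝 (n * Real.log s)) :=
      ((hlog.tendsto.mono_left nhdsWithin_le_nhds).const_mul (n : ℝ)).comp tendsto_snd
    have h3 := h1.sub h2
    rw [logWeight, if_neg hs.ne']
    refine h3.congr' ?_
    filter_upwards [tendsto_snd.eventually (mem_nhdsWithin_of_mem_nhds (lt_mem_nhds hs))] with q hq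
    rw [logWeight, if_neg (ne_of_gt hq)]

theorem contConv_slope {l : Filter ι} {i₀ : ι} (hI : I ∈ l) (hi₀ : i₀ ∈ I)
    (h : ∀ i ∈ I, Profile n (M i) (U i)) (hc : ProfileConv n l M U (M i₀) (U i₀)) :
    ContConv l (Ici 0) (fun i => slope n (U i)) (slope n (U i₀)) := by
  intro s hs
  have h₀ := h i₀ hi₀
  rcases (mem_Ici.1 hs).eq_or_lt with rfl | hs
  · have e0 : slope n (U i₀) 0 = 2 * n := if_pos rfl
    rw [Metric.tendsto_nhds, e0]
    intro ε hε
    -- Slopes decrease in t and stay below 2n, so one time t₁ with slope near 2n pins the slope for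
    -- all smaller s.
    obtain ⟨t₁, h1⟩ := (h₀.at_bot.eventually
      (lt_mem_nhds (show 2 * (n : ℝ) - ε < 2 * n by linarith))).exists
    have e1 := (hc.slope.tendsto_apply t₁).eventually (lt_mem_nhds h1)
    filter_upwards [prod_mem_prod (inter_mem hI e1) (mem_Ici_inter_nhds (t := t₁))] with q hq
    obtain ⟨⟨q1, q2⟩, q5, q6⟩ := hq
    have := (h _ q1).slope_mem q6 q5
    simp only [mem_ofPred_eq, mem_Icc] at q2 this
    rw [Real.dist_eq, abs_lt]
    constructor <;> linarith [this.1, this.2]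
  · have hlog : ContinuousAt Real.log s := Real.continuousAt_log hs.ne'
    have h1 : Tendsto (fun q : ι × ℝ => deriv (U q.1) (Real.log q.2 / 2)) (l ×ˢ 𝓝[Ici 0] s)
        (𝓝 (deriv (U i₀) (Real.log s / 2))) :=
      hc.slope.tendsto_comp ((hlog.div_const 2).tendsto.mono_left nhdsWithin_le_nhds)
    rw [slope, if_neg hs.ne']
    refine h1.congr' ?_
    filter_upwards [tendsto_snd.eventually (mem_nhdsWithin_of_mem_nhds (lt_mem_nhds hs))] with q hq
    rw [slope, if_neg (ne_of_gt hq)]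

theorem contConv_planeAlg {l : Filter ι} {i₀ : ι} (hI : I ∈ l) (hi₀ : i₀ ∈ I)
    (h : ∀ i ∈ I, Profile n (M i) (U i)) (hc : ProfileConv n l M U (M i₀) (U i₀)) :
    ∀ f ∈ planeAlg n M U, ContConv l (Ici 0) f (f i₀) := by
  have hW := contConv_logWeight hI hi₀ h hc
  have hP := contConv_slope hI hi₀ h hc
  have hS : ContConv l (Ici (0 : ℝ)) (fun _ s => s) (fun s => s) := contConv_const continuousOn_id
  have hH : ContConv l (Ici 0) (fun i => weight n (U i)) (weight n (U i₀)) :=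
    hW.map Real.continuous_exp
  refine contConv_adjoin fun f hf => ?_
  simp only [planeGen, mem_insert_iff, mem_singleton_iff] at hf
  rcases hf with rfl | rfl | rfl | rfl | rfl
  · exact hS
  · exact hH
  · exact hP
  · intro s hs
    exact ((hP s hs).add_const _).inv₀ ((h i₀ hi₀).slope_add_pos s).ne'
  · intro s hs
    exact (hc.param.comp tendsto_fst).mul
      ((((hW s hs).sub (((hS s hs).pow n).mul (hH s hs))).div_const (n : ℝ)).rexp)

end

/-! ### Radial functions on the plane -/

theorem mapsTo_norm_sq (Ω : Set ℂ) : MapsTo (fun z : ℂ => ‖z‖ ^ 2) Ω (Ici 0) :=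
  fun z _ => sq_nonneg ‖z‖

theorem fderiv_norm_sq_complex (z : ℂ) :
    fderiv ℝ (fun z : ℂ => ‖z‖ ^ 2) z = 2 • (innerSL ℝ z) := by
  simp

/-- The Laplacian of a radial function. -/
theorem laplacian_comp_norm_sq {g g₁ : ℝ → ℝ} {g₂ : ℝ} {z : ℂ}
    (h₁ : ∀ᶠ w in 𝓝 z, HasDerivWithinAt g (g₁ (‖w‖ ^ 2)) (Ici 0) (‖w‖ ^ 2))
    (h₂ : HasDerivWithinAt g₁ g₂ (Ici 0) (‖z‖ ^ 2)) :
    Laplacian.laplacian (fun w : ℂ => g (‖w‖ ^ 2)) z = 4 * (g₁ (‖z‖ ^ 2) + ‖z‖ ^ 2 * g₂) := by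
  have hθ : ∀ w : ℂ, DifferentiableAt ℝ (fun z : ℂ => ‖z‖ ^ 2) w := fun w =>
    (contDiff_norm_sq ℝ (n := 1)).differentiable (by simp) w
  have e1 : fderiv ℝ (fun w : ℂ => g (‖w‖ ^ 2)) =ᶠ[𝓝 z]
      fun w => g₁ (‖w‖ ^ 2) • (2 • innerSL ℝ w) := by
    filter_upwards [h₁] with w hw
    have := (hw.comp_hasFDerivWithinAt w (hθ w).hasFDerivAt.hasFDerivWithinAt
      (mapsTo_norm_sq univ)).hasFDerivAt univ_mem
    rw [fderiv_norm_sq_complex] at this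
    exact this.fderiv
  have hL : HasFDerivAt (fun w : ℂ => (2 • innerSL ℝ w : ℂ →L[ℝ] ℝ))
      ((2 : ℝ) • (innerSL ℝ : ℂ →L[ℝ] ℂ →L[ℝ] ℝ)) z := by
    have := ((2 : ℝ) • (innerSL ℝ : ℂ →L[ℝ] ℂ →L[ℝ] ℝ)).hasFDerivAt (x := z)
    refine this.congr_of_eventuallyEq (Eventually.of_forall fun w => ?_)
    ext v
    simp only [FunLike.coe_smul, Pi.smul_apply, nsmul_eq_mul, smul_eq_mul]
    push_cast
    rfl
  have e2 := hasFDerivAt_comp_smul univ_mem (mapsTo_norm_sq univ) (hθ z) hL.differentiableAt h₂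
  rw [hL.fderiv, fderiv_norm_sq_complex] at e2
  have e3 := (e2.congr_of_eventuallyEq e1).fderiv
  have e4 : ‖z‖ ^ 2 = z.re ^ 2 + z.im ^ 2 := by
    rw [← Complex.normSq_eq_norm_sq, Complex.normSq_apply]; ring
  rw [InnerProductSpace.laplacian_eq_iteratedFDeriv_complexPlane]
  simp only [iteratedFDeriv_two_apply, e3]
  have i1 : innerSL ℝ (1 : ℂ) (1 : ℂ) = (1 : ℝ) := by rw [innerSL_apply_apply]; simp
  have i2 : innerSL ℝ Complex.I Complex.I = (1 : ℝ) := by rw [innerSL_apply_apply]; simp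
  simp [Complex.inner, i1, i2]
  rw [e4]
  ring

/-- The Laplacian of a function of `t = log |z|`. -/
theorem laplacian_of_log {F : ℂ → ℝ} {f f₁ : ℝ → ℝ} {f₂ : ℝ} {z : ℂ} (hz : z ≠ 0)
    (hF : ∀ w : ℂ, w ≠ 0 → F w = f (Real.log ‖w‖)) (h₁ : ∀ t, HasDerivAt f (f₁ t) t)
    (h₂ : HasDerivAt f₁ f₂ (Real.log ‖z‖)) :
    Laplacian.laplacian F z = f₂ / ‖z‖ ^ 2 := by
  have hz0 : 0 < ‖z‖ := norm_pos_iff.2 hz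
  have hlog : ∀ w : ℂ, Real.log (‖w‖ ^ 2) / 2 = Real.log ‖w‖ := fun w => by
    rw [Real.log_pow]; push_cast; ring
  have e : F =ᶠ[𝓝 z] fun w => (fun s => f (Real.log s / 2)) (‖w‖ ^ 2) := by
    filter_upwards [isOpen_compl_singleton.mem_nhds hz] with w hw
    rw [hF w hw, hlog]
  rw [(InnerProductSpace.laplacian_congr_nhds e).eq_of_nhds]
  have h3 : ∀ᶠ w in 𝓝 z, HasDerivWithinAt (fun s => f (Real.log s / 2))
      ((fun s => f₁ (Real.log s / 2) * (s⁻¹ / 2)) (‖w‖ ^ 2)) (Ici 0) (‖w‖ ^ 2) := by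
    filter_upwards [isOpen_compl_singleton.mem_nhds hz] with w hw
    have : ‖w‖ ^ 2 ≠ 0 := pow_ne_zero 2 (norm_ne_zero_iff.2 hw)
    exact ((h₁ _).comp _ ((Real.hasDerivAt_log this).div_const 2)).hasDerivWithinAt
  have hne : ‖z‖ ^ 2 ≠ 0 := by positivity
  rw [← hlog] at h₂
  have h4 : HasDerivWithinAt (fun s => f₁ (Real.log s / 2) * (s⁻¹ / 2)) _ (Ici 0) (‖z‖ ^ 2) :=
    ((h₂.comp (‖z‖ ^ 2) ((Real.hasDerivAt_log hne).div_const 2)).mul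
    ((hasDerivAt_inv hne).div_const 2)).hasDerivWithinAt (s := Ici 0)
  rw [laplacian_comp_norm_sq h3 h4]
  simp only [Function.comp_apply]
  field_simp
  ring

/-! ### The metrics on the plane determined by a profile -/

/-- The conformal factor on `ℂ` determined by a profile. -/
noncomputable def planeMetric (n : ℕ) (m : ℝ) (u : ℝ → ℝ) (z : ℂ) : ℝ := factor n m u (‖z‖ ^ 2)

/-- The Hermitian weight on `ℂ` determined by a profile. -/
noncomputable def planeHerm (n : ℕ) (u : ℝ → ℝ) (z : ℂ) : ℝ := weight n u (‖z‖ ^ 2)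

section

variable {n : ℕ} {m : ℝ} {u : ℝ → ℝ}

theorem log_norm_sq (z : ℂ) : Real.log (‖z‖ ^ 2) / 2 = Real.log ‖z‖ := by
  rw [Real.log_pow]; push_cast; ring

theorem planeMetric_mul (hn : 1 ≤ n) {z : ℂ} (hz : z ≠ 0) :
    planeMetric n m u z * ‖z‖ ^ 2 = m * pot (1 / n) (u (Real.log ‖z‖)) := by
  have := factor_mul (m := m) (u := u) hn (show 0 < ‖z‖ ^ 2 by have := norm_pos_iff.2 hz; positivity)
  rwa [log_norm_sq] at this

theorem planeHerm_mul {z : ℂ} (hz : z ≠ 0) :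
    planeHerm n u z * ‖z‖ ^ (2 * n) = Real.exp (u (Real.log ‖z‖)) := by
  have := pow_mul_weight (n := n) (u := u)
    (show 0 < ‖z‖ ^ 2 by have := norm_pos_iff.2 hz; positivity)
  rw [log_norm_sq, ← pow_mul, mul_comm] at this
  exact this

theorem givenBy_iff {lam : ℝ} {ρ h : ℂ → ℝ} :
    GivenBy n lam u ρ h ↔ ∀ z : ℂ, z ≠ 0 →
      ρ z * ‖z‖ ^ 2 = 1 / lam * pot (1 / n) (u (Real.log ‖z‖)) ∧
      h z * ‖z‖ ^ (2 * n) = Real.exp (u (Real.log ‖z‖)) := by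
  refine forall₂_congr fun z hz => and_congr_left fun _ => ?_
  have : ‖z‖ ^ 2 ≠ 0 := by have := norm_pos_iff.2 hz; positivity
  rw [eq_div_iff this, two_mul_coupling, pot]

theorem givenBy_plane (hn : 1 ≤ n) (lam : ℝ) :
    GivenBy n lam u (planeMetric n (1 / lam) u) (planeHerm n u) :=
  givenBy_iff.2 fun _ hz => ⟨planeMetric_mul hn hz, planeHerm_mul hz⟩

theorem eq_of_eq_on_compl_zero {f g : ℂ → ℝ} (hf : Continuous f) (hg : Continuous g)
    (h : ∀ z, z ≠ 0 → f z = g z) : f = g :=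
  hf.ext_on (dense_compl_singleton 0) hg fun z hz => h z hz

theorem norm_mul_of_norm_one {a : ℂ} (ha : ‖a‖ = 1) (z : ℂ) : ‖a * z‖ = ‖z‖ := by
  rw [norm_mul, ha, one_mul]

theorem isRotInvariant_planeMetric : IsRotInvariant (planeMetric n m u) := fun a z ha => by
  rw [planeMetric, planeMetric, norm_mul_of_norm_one ha]

theorem isRotInvariant_planeHerm : IsRotInvariant (planeHerm n u) := fun a z ha => by
  rw [planeHerm, planeHerm, norm_mul_of_norm_one ha]

theorem contDiffOn_norm_sq (Ω : Set ℂ) : ContDiffOn ℝ ∞ (fun z : ℂ => ‖z‖ ^ 2) Ω :=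
  (contDiff_norm_sq ℝ).contDiffOn

theorem stateFn_eq (z : ℂ) :
    stateFn (planeHerm n u) (fun z => z ^ n) z = (‖z‖ ^ 2) ^ n * weight n u (‖z‖ ^ 2) := by
  rw [stateFn, planeHerm, norm_pow, mul_comm, ← pow_mul, ← pow_mul, mul_comm n]

namespace Profile

variable (h : Profile n m u)
include h

theorem diffAlg : DiffAlg (univ : Set Unit) (Ici 0) (planeAlg n (fun _ => m) (fun _ : Unit => u)) :=
  diffAlg_planeAlg fun _ _ => h

theorem contDiff_of_mem {f : Unit → ℝ → ℝ} (hf : f ∈ planeAlg n (fun _ => m) (fun _ : Unit => u)) :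
    ContDiff ℝ ∞ fun z : ℂ => f () (‖z‖ ^ 2) := by
  rw [← contDiffOn_univ]
  have := h.diffAlg.contDiffOn isOpen_univ (mapsTo_norm_sq univ) (contDiffOn_norm_sq univ)
    (mem_univ ()) (L := fun _ => (1 : ℝ)) contDiffOn_const hf
  simpa using this

theorem contDiff_planeMetric : ContDiff ℝ ∞ (planeMetric n m u) :=
  h.contDiff_of_mem (f := fun _ => factor n m u) factor_mem_planeAlg

theorem contDiff_planeHerm : ContDiff ℝ ∞ (planeHerm n u) :=
  h.contDiff_of_mem (f := fun _ => weight n u) weight_mem_planeAlg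

theorem eq_plane {lam : ℝ} (hm : m = 1 / lam) {ρ k : ℂ → ℝ} (hρ : Continuous ρ) (hk : Continuous k)
    (hg : GivenBy n lam u ρ k) : ρ = planeMetric n m u ∧ k = planeHerm n u := by
  rw [givenBy_iff] at hg
  refine ⟨eq_of_eq_on_compl_zero hρ h.contDiff_planeMetric.continuous fun z hz => ?_,
    eq_of_eq_on_compl_zero hk h.contDiff_planeHerm.continuous fun z hz => ?_⟩
  · have hz0 : ‖z‖ ^ 2 ≠ 0 := pow_ne_zero _ (norm_ne_zero_iff.2 hz)
    exact mul_right_cancel₀ hz0 ((hg z hz).1.trans (hm ▸ (planeMetric_mul h.one_le hz).symm))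
  · have hz0 : ‖z‖ ^ (2 * n) ≠ 0 := pow_ne_zero _ (norm_ne_zero_iff.2 hz)
    exact mul_right_cancel₀ hz0 ((hg z hz).2.trans (planeHerm_mul hz).symm)

/-- For a radial function the Laplacian is 4 (s g')', and here s g' = (`slope` - 2n)/2. It is thus
twice the derivative of the slope in s, given by the differential equation; the argument includes s
= 0 because one-sided derivatives on [0, ∞) are unique. -/
theorem laplacian_log_herm (z : ℂ) :
    Laplacian.laplacian (fun w : ℂ => logWeight n u (‖w‖ ^ 2)) z =
      planeMetric n m u z * (stateFn (planeHerm n u) (fun z => z ^ n) z - 1) := by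
  have hFR : (fun _ : Unit => factor n m u) * (fun _ : Unit => invSlope n u) ∈
    planeAlg n (fun _ => m) (fun _ : Unit => u) := mul_mem factor_mem_planeAlg invSlope_mem_planeAlg
  obtain ⟨g, -, hg⟩ := h.diffAlg _ (neg_mem (Subalgebra.smul_mem _ hFR (n : ℝ)))
  have hs : ‖z‖ ^ 2 ∈ Ici (0 : ℝ) := mem_Ici.2 (sq_nonneg _)
  have hg' : HasDerivWithinAt (fun s => -(n * (factor n m u s * invSlope n u s)))
      (g () (‖z‖ ^ 2)) (Ici 0) (‖z‖ ^ 2) := hg () (mem_univ _) _ hs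
  rw [laplacian_comp_norm_sq (Eventually.of_forall fun w =>
    h.hasDerivWithinAt_logWeight (mem_Ici.2 (sq_nonneg ‖w‖))) hg']
  have h1 : HasDerivWithinAt (fun s => s * -(n * (factor n m u s * invSlope n u s))) _ (Ici 0)
      (‖z‖ ^ 2) := (hasDerivWithinAt_id (‖z‖ ^ 2) (Ici 0)).mul hg'
  have h2 : HasDerivWithinAt (fun s => (slope n u s - 2 * n) / 2)
      (factor n m u (‖z‖ ^ 2) * ((‖z‖ ^ 2) ^ n * weight n u (‖z‖ ^ 2) - 1) / 2 / 2) (Ici 0)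
      (‖z‖ ^ 2) := ((h.hasDerivWithinAt_slope hs).sub_const _).div_const 2
  have e : ∀ s ∈ Ici (0 : ℝ), (slope n u s - 2 * n) / 2 =
      s * -(n * (factor n m u s * invSlope n u s)) := fun s hs => by
    linarith [h.mul_factor_mul_invSlope hs]
  have h3 := h1.congr e (e _ hs)
  have h4 := (uniqueDiffOn_Ici (0 : ℝ) _ hs).eq_deriv _ h3 h2
  rw [stateFn_eq, planeMetric]
  simp only [id] at h4
  linarith

theorem curv_eq (z : ℂ) : curv (planeHerm n u) z =
    -(1 / 2) * (planeMetric n m u z * (stateFn (planeHerm n u) (fun z => z ^ n) z - 1)) := by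
  have e : (fun w => Real.log (planeHerm n u w)) = fun w : ℂ => logWeight n u (‖w‖ ^ 2) := by
    ext w
    rw [planeHerm, weight, Real.log_exp]
  rw [curv, e, h.laplacian_log_herm]

/-- By construction log ρ = log m + (log h - |φ|²)/n. As α = 1/(2n), the Laplacians of |φ|² in the
second equation cancel, and what is left is the Laplacian of log h, known from the first. -/
theorem solvesEB : SolvesEB (coupling n) 1 (planeMetric n m u) (planeHerm n u)
    (fun z => z ^ n) := by
  intro z
  have hn := h.n_pos
  have hρ : 0 < planeMetric n m u z := h.factor_pos _
  refine ⟨by rw [h.curv_eq]; ring, ?_⟩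
  have hs : ∀ w : ℂ, ‖w‖ ^ 2 ∈ Ici (0 : ℝ) := fun w => mem_Ici.2 (sq_nonneg _)
  have hFR : (fun _ : Unit => factor n m u) * (fun _ : Unit => invSlope n u) ∈
    planeAlg n (fun _ => m) (fun _ : Unit => u) := mul_mem factor_mem_planeAlg invSlope_mem_planeAlg
  obtain ⟨g, -, hg⟩ := h.diffAlg _ (neg_mem (Subalgebra.smul_mem _ hFR (n : ℝ)))
  have hg' : HasDerivWithinAt (fun s => -(n * (factor n m u s * invSlope n u s)))
      (g () (‖z‖ ^ 2)) (Ici 0) (‖z‖ ^ 2) := hg () (mem_univ _) _ (hs z)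
  have hX : (fun _ s => s) ^ n * (fun _ : Unit => weight n u) ∈
    planeAlg n (fun _ => m) (fun _ : Unit => u) :=
    mul_mem (pow_mem var_mem_planeAlg n) weight_mem_planeAlg
  obtain ⟨X₁, hX₁, hX₁d⟩ := h.diffAlg _ hX
  obtain ⟨X₂, -, hX₂d⟩ := h.diffAlg _ hX₁
  have d1 : ∀ w : ℂ, HasDerivWithinAt (fun s => s ^ n * weight n u s) (X₁ () (‖w‖ ^ 2)) (Ici 0)
      (‖w‖ ^ 2) := fun w => hX₁d () (mem_univ _) _ (hs w)
  have d2 := hX₂d () (mem_univ _) _ (hs z)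
  have hlapl := laplacian_comp_norm_sq (Eventually.of_forall fun w => (d1 w).sub_const 1) d2
  have hlogh := laplacian_comp_norm_sq (Eventually.of_forall fun w =>
    h.hasDerivWithinAt_logWeight (hs w)) hg'
  have hlogρ := laplacian_comp_norm_sq (Eventually.of_forall fun w : ℂ =>
    (((h.hasDerivWithinAt_logWeight (hs w)).sub (d1 w)).div_const (n : ℝ)).const_add (Real.log m))
    ((hg'.sub d2).div_const (n : ℝ))
  rw [h.laplacian_log_herm] at hlogh
  have e1 : (fun w => Real.log (planeMetric n m u w)) = fun w : ℂ =>
      Real.log m + (logWeight n u - fun s => s ^ n * weight n u s) (‖w‖ ^ 2) / n := by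
    ext w
    rw [planeMetric, factor, Real.log_mul h.pos.ne' (Real.exp_pos _).ne', Real.log_exp]
    rfl
  have e2 : (fun w => stateFn (planeHerm n u) (fun z => z ^ n) w - 1) =
      fun w : ℂ => (‖w‖ ^ 2) ^ n * weight n u (‖w‖ ^ 2) - 1 := by
    ext w
    rw [stateFn_eq]
  rw [scal, lapl, e1, e2, hlapl, hlogρ]
  have e3 : coupling n = 1 / n / 2 := by rw [← two_mul_coupling]; ring
  simp only [Pi.sub_apply] at hlogh ⊢
  rw [e3]
  field_simp
  linear_combination hlogh

theorem isEBPlane : IsEBPlane (coupling n) n (planeMetric n m u) (planeHerm n u) where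
  smooth_metric := h.contDiff_planeMetric
  pos_metric _ := h.factor_pos _
  smooth_herm := h.contDiff_planeHerm
  pos_herm _ := weight_pos _ _ _
  eb := h.solvesEB

end Profile

end

/-! ### Lower bounds for lengths -/

/-- A function with |df| ≤ C √ρ is C-Lipschitz along curves measured by ρ. Completeness and the
diameter are both tested with such functions. -/
theorem enorm_sub_le_arcLength {E : Type*} [NormedAddCommGroup E] [NormedSpace ℝ E] {f : ℂ → E}
    (hf : ContDiff ℝ 1 f) {ρ : ℂ → ℝ} {C : ℝ} (hC : 0 ≤ C)
    (h : ∀ z, ‖fderiv ℝ f z‖ ≤ C * √(ρ z)) {γ : ℝ → ℂ} (hγ : ContDiff ℝ 1 γ) :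
    ‖f (γ 1) - f (γ 0)‖ₑ ≤ ENNReal.ofReal C * arcLength ρ γ := by
  have h1 := enorm_sub_le_lintegral_deriv_of_contDiffOn_Icc (f := f ∘ γ)
    (hf.comp hγ).contDiffOn zero_le_one
  refine h1.trans ?_
  rw [arcLength, ← lintegral_const_mul' _ _ ENNReal.ofReal_ne_top]
  refine lintegral_mono fun s => ?_
  rw [← ofReal_norm, ← ENNReal.ofReal_mul hC]
  apply ENNReal.ofReal_le_ofReal
  have hd : HasDerivAt (f ∘ γ) (fderiv ℝ f (γ s) (deriv γ s)) s :=
    ((hf.differentiable (by simp)) (γ s)).hasFDerivAt.comp_hasDerivAt s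
      ((hγ.differentiable (by simp)) s).hasDerivAt
  rw [hd.deriv, ← mul_assoc]
  exact ((fderiv ℝ f (γ s)).le_opNorm _).trans (by gcongr; exact h _)

theorem enorm_sub_le_distPlane {E : Type*} [NormedAddCommGroup E] [NormedSpace ℝ E] {f : ℂ → E}
    (hf : ContDiff ℝ 1 f) {ρ : ℂ → ℝ} {C : ℝ} (hC : 0 ≤ C)
    (h : ∀ z, ‖fderiv ℝ f z‖ ≤ C * √(ρ z)) (x y : ℂ) :
    ‖f x - f y‖ₑ / ENNReal.ofReal C ≤ distPlane ρ x y := by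
  refine le_iInf₂ fun γ hγ => ENNReal.div_le_of_le_mul' ?_
  obtain ⟨h1, rfl, rfl⟩ := hγ
  rw [← enorm_neg, neg_sub]
  exact enorm_sub_le_arcLength hf hC h h1

theorem distPlane_le_of_segment {ρ : ℂ → ℝ} {x y : ℂ} {B : ℝ}
    (h : ∀ s ∈ Icc (0 : ℝ) 1, √(ρ (x + s * (y - x))) ≤ B) :
    distPlane ρ x y ≤ ENNReal.ofReal (B * ‖y - x‖) := by
  have hγ : ContDiff ℝ 1 (fun s : ℝ => x + (s : ℂ) * (y - x)) :=
    contDiff_const.add (Complex.ofRealCLM.contDiff.mul contDiff_const)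
  refine (iInf₂_le (fun s : ℝ => x + (s : ℂ) * (y - x)) ⟨hγ, by simp, by simp⟩).trans ?_
  have hd : ∀ s : ℝ, deriv (fun s : ℝ => x + (s : ℂ) * (y - x)) s = y - x := fun s => by
    have h1 : HasDerivAt (fun s : ℝ => (s : ℂ)) 1 s := Complex.ofRealCLM.hasDerivAt
    have := ((h1.mul_const (y - x)).const_add x).deriv
    simpa using this
  rw [arcLength]
  calc _ ≤ ∫⁻ _ in Icc (0 : ℝ) 1, ENNReal.ofReal (B * ‖y - x‖) := by
        refine setLIntegral_mono measurable_const fun s hs => ENNReal.ofReal_le_ofReal ?_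
        rw [hd]
        gcongr
        exact h s hs
    _ = _ := by simp

theorem norm_fderiv_norm_sq (z : ℂ) : ‖fderiv ℝ (fun z : ℂ => ‖z‖ ^ 2) z‖ = 2 * ‖z‖ := by
  have : fderiv ℝ (fun z : ℂ => ‖z‖ ^ 2) z = (2 : ℝ) • innerSL ℝ z := by
    rw [fderiv_norm_sq_complex]
    ext v
    simp
    ring
  rw [this, norm_smul, innerSL_apply_norm]
  simp

theorem hasFDerivAt_radial {g : ℝ → ℝ} {g' : ℝ} {z : ℂ} (hg : HasDerivAt g g' (‖z‖ ^ 2)) :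
    HasFDerivAt (fun w : ℂ => g (‖w‖ ^ 2)) (g' • fderiv ℝ (fun z : ℂ => ‖z‖ ^ 2) z) z :=
  hg.comp_hasFDerivAt z ((contDiff_norm_sq ℝ (n := 1)).differentiable (by simp) z).hasFDerivAt

/-- A metric that decays at most like `1 / |z|²` is complete. -/
theorem isCompleteMetric_of_le {ρ : ℂ → ℝ} (hρ : Continuous ρ) {c : ℝ} (hc : 0 < c)
    (h : ∀ z, c / (1 + ‖z‖ ^ 2) ≤ ρ z) : IsCompleteMetric ρ := by
  have hpos : ∀ z : ℂ, 0 < 1 + ‖z‖ ^ 2 := fun z => by positivity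
  have hsqrt : ∀ z : ℂ, 1 / √(1 + ‖z‖ ^ 2) ≤ 1 / √c * √(ρ z) := fun z => by
    have := Real.sqrt_le_sqrt (h z)
    rw [Real.sqrt_div hc.le] at this
    have hc' := Real.sqrt_pos.2 hc
    calc 1 / √(1 + ‖z‖ ^ 2) = 1 / √c * (√c / √(1 + ‖z‖ ^ 2)) := by field_simp
      _ ≤ _ := by gcongr
  have hnorm : ∀ z : ℂ, ‖z‖ / (1 + ‖z‖ ^ 2) ≤ 1 / √(1 + ‖z‖ ^ 2) := fun z => by
    have h1 := Real.sqrt_pos.2 (hpos z)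
    have h2 := Real.sq_sqrt (hpos z).le
    have h3 : ‖z‖ ≤ √(1 + ‖z‖ ^ 2) := Real.le_sqrt_of_sq_le (by linarith)
    rw [div_le_div_iff₀ (hpos z) h1]
    nlinarith
  have hone : ∀ z : ℂ, 1 / (1 + ‖z‖ ^ 2) ≤ 1 / √(1 + ‖z‖ ^ 2) := fun z => by
    have h1 := Real.sqrt_pos.2 (hpos z)
    have h2 := Real.sq_sqrt (hpos z).le
    have h3 : 1 ≤ √(1 + ‖z‖ ^ 2) := Real.le_sqrt_of_sq_le (by nlinarith [sq_nonneg ‖z‖])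
    apply one_div_le_one_div_of_le h1
    nlinarith
  -- Both f₁ = log(1 + |z|²) and f₂ = z/(1 + |z|²) have gradient at most a multiple of (1 +
  -- |z|²)^{-1/2}, and z = e^{f₁} f₂. So a Cauchy sequence for the metric converges in ℂ.
  set f₁ : ℂ → ℝ := fun z => Real.log (1 + ‖z‖ ^ 2) with hf₁
  set f₂ : ℂ → ℂ := fun z => (1 + ‖z‖ ^ 2)⁻¹ • z with hf₂
  have c₁ : ContDiff ℝ 1 f₁ :=
    (contDiff_const.add (contDiff_norm_sq ℝ)).log fun z => (hpos z).ne'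
  have c₂ : ContDiff ℝ 1 f₂ :=
    ((contDiff_const.add (contDiff_norm_sq ℝ)).inv fun z => (hpos z).ne').smul contDiff_id
  have b₁ : ∀ z, ‖fderiv ℝ f₁ z‖ ≤ 3 / √c * √(ρ z) := fun z => by
    have e := (hasFDerivAt_radial (z := z) (((hasDerivAt_id (‖z‖ ^ 2)).const_add 1).log
      (hpos z).ne')).fderiv
    simp only [id] at e
    rw [hf₁, e, norm_smul, norm_fderiv_norm_sq, Real.norm_of_nonneg (by positivity)]
    have := hsqrt z
    have := hnorm z
    have e2 : 1 / (1 + ‖z‖ ^ 2) * (2 * ‖z‖) = 2 * (‖z‖ / (1 + ‖z‖ ^ 2)) := by ring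
    have e3 : 3 / √c * √(ρ z) = 3 * (1 / √c * √(ρ z)) := by ring
    have : 0 ≤ 1 / √c * √(ρ z) := by positivity
    rw [e2, e3]
    linarith
  have b₂ : ∀ z, ‖fderiv ℝ f₂ z‖ ≤ 3 / √c * √(ρ z) := fun z => by
    have e1 := hasFDerivAt_radial (z := z) (((hasDerivAt_id (‖z‖ ^ 2)).const_add 1).inv
      (hpos z).ne')
    have e := (e1.smul (hasFDerivAt_id z)).fderiv
    simp only [id] at e
    have e' : fderiv ℝ f₂ z = _ := e
    rw [e']
    have n1 : ‖(-1 / (1 + ‖z‖ ^ 2) ^ 2) • fderiv ℝ (fun z : ℂ => ‖z‖ ^ 2) z‖ ≤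
        2 * (‖z‖ / (1 + ‖z‖ ^ 2) ^ 2) := by
      rw [norm_smul, norm_fderiv_norm_sq, norm_div, norm_neg, norm_one,
        Real.norm_of_nonneg (by positivity)]
      apply le_of_eq
      ring
    have n2 : ‖z‖ ^ 2 / (1 + ‖z‖ ^ 2) ≤ 1 := by
      rw [div_le_one (hpos z)]; linarith
    have n3 : ‖((-1 / (1 + ‖z‖ ^ 2) ^ 2) • fderiv ℝ (fun z : ℂ => ‖z‖ ^ 2) z).smulRight z‖ ≤
        2 * (1 / (1 + ‖z‖ ^ 2)) := by
      rw [ContinuousLinearMap.norm_smulRight_apply]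
      calc _ ≤ 2 * (‖z‖ / (1 + ‖z‖ ^ 2) ^ 2) * ‖z‖ := by gcongr
        _ = 2 * (1 / (1 + ‖z‖ ^ 2) * (‖z‖ ^ 2 / (1 + ‖z‖ ^ 2))) := by
          have := (hpos z).ne'
          field_simp
        _ ≤ 2 * (1 / (1 + ‖z‖ ^ 2) * 1) := by
          have := hpos z
          gcongr
        _ = _ := by ring
    have n4 : ‖(1 + ‖z‖ ^ 2)⁻¹ • ContinuousLinearMap.id ℝ ℂ‖ ≤ 1 / (1 + ‖z‖ ^ 2) := by
      rw [norm_smul, Real.norm_of_nonneg (by positivity), one_div]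
      exact mul_le_of_le_one_right (by positivity) ContinuousLinearMap.norm_id_le
    refine (norm_add_le _ _).trans ?_
    have := hsqrt z
    have := hone z
    have e3 : 3 / √c * √(ρ z) = 3 * (1 / √c * √(ρ z)) := by ring
    rw [e3]
    refine (add_le_add n4 n3).trans ?_
    linarith
  intro x hx
  have hC : 0 < 3 / √c := by have := Real.sqrt_pos.2 hc; positivity
  have cau : ∀ {E : Type} [NormedAddCommGroup E] [NormedSpace ℝ E] {f : ℂ → E},
      ContDiff ℝ 1 f → (∀ z, ‖fderiv ℝ f z‖ ≤ 3 / √c * √(ρ z)) → CauchySeq fun i => f (x i) := by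
    intro E _ _ f hf hb
    rw [Metric.cauchySeq_iff]
    intro ε hε
    obtain ⟨k, hk⟩ := hx (ENNReal.ofReal (ε / (3 / √c))) (by
      rw [ENNReal.ofReal_pos]; positivity)
    refine ⟨k, fun i hi j hj => ?_⟩
    have h1 := (enorm_sub_le_distPlane hf hC.le hb (x i) (x j)).trans_lt (hk i j hi hj)
    rw [ENNReal.ofReal_div_of_pos hC] at h1
    have h2 := (ENNReal.div_lt_div_iff_left (by simpa using hC) ENNReal.ofReal_ne_top).1 h1
    rw [← ofReal_norm, ENNReal.ofReal_lt_ofReal_iff hε] at h2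
    rwa [dist_eq_norm]
  obtain ⟨a₁, ha₁⟩ := cauchySeq_tendsto_of_complete (cau c₁ b₁)
  obtain ⟨a₂, ha₂⟩ := cauchySeq_tendsto_of_complete (cau c₂ b₂)
  have hlim : Tendsto x atTop (𝓝 (Real.exp a₁ • a₂)) := by
    refine (((Real.continuous_exp.tendsto _).comp ha₁).smul ha₂).congr fun i => ?_
    simp only [f₁, f₂, Function.comp_apply]
    rw [Real.exp_log (hpos _), smul_smul, mul_inv_cancel₀ (hpos _).ne', one_smul]
  set a := Real.exp a₁ • a₂ with ha
  refine ⟨a, ?_⟩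
  -- Near the limit point ρ is bounded, and straight segments turn Euclidean convergence into
  -- convergence for the metric.
  obtain ⟨B, hB⟩ := (isCompact_closedBall a 1).exists_bound_of_continuousOn
    (Real.continuous_sqrt.comp hρ).continuousOn
  have h1 : ∀ᶠ i in atTop, distPlane ρ (x i) a ≤ ENNReal.ofReal (B * ‖a - x i‖) := by
    filter_upwards [hlim.eventually (Metric.closedBall_mem_nhds a one_pos)] with i hi
    refine distPlane_le_of_segment fun s hs => ?_
    have hmem : x i + s * (a - x i) ∈ Metric.closedBall a 1 := by
      have := (convex_closedBall a 1).add_smul_sub_mem hi (Metric.mem_closedBall_self zero_le_one) hs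
      simpa using this
    exact (le_abs_self _).trans (hB _ hmem)
  have h2 : Tendsto (fun i => ENNReal.ofReal (B * ‖a - x i‖)) atTop (𝓝 0) := by
    have : Tendsto (fun i => B * ‖a - x i‖) atTop (𝓝 (B * ‖a - a‖)) :=
      ((tendsto_const_nhds.sub hlim).norm).const_mul B
    simpa using ENNReal.tendsto_ofReal this
  exact tendsto_of_tendsto_of_tendsto_of_le_of_le' tendsto_const_nhds h2
    (Eventually.of_forall fun _ => zero_le) h1

/-! ### Lower bound for the diameter -/

/-- A function on the projective line that varies by `log K`. -/
noncomputable def gauge (K : ℝ) : P1 → ℝ :=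
  Projectivization.lift (fun v : { v : Fin 2 → ℂ // v ≠ 0 } =>
    1 / 2 * Real.log ((‖v.1 0‖ ^ 2 + K * ‖v.1 1‖ ^ 2) / (K * ‖v.1 0‖ ^ 2 + ‖v.1 1‖ ^ 2)))
    (by
      rintro ⟨a, ha⟩ ⟨b, hb⟩ t (rfl : a = t • b)
      have ht : ‖t‖ ^ 2 ≠ 0 := by
        refine pow_ne_zero 2 (norm_ne_zero_iff.2 ?_)
        rintro rfl
        simp at ha
      congr 2
      simp only [Pi.smul_apply, smul_eq_mul, norm_mul, mul_pow]
      rw [← mul_div_mul_left (‖b 0‖ ^ 2 + K * ‖b 1‖ ^ 2) _ ht]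
      congr 1 <;> ring)

/-- The function `gauge K` in the affine chart centred at `0`. -/
noncomputable def gaugeChart (K : ℝ) (z : ℂ) : ℝ :=
  1 / 2 * (Real.log (1 + K * ‖z‖ ^ 2) - Real.log (K + ‖z‖ ^ 2))

/-- Exchanging the homogeneous coordinates inverts the quotient inside the logarithm. Hence one
gradient estimate serves both charts, and the values at the two zeros are opposite. -/
theorem gauge_chart {K : ℝ} (hK : 0 < K) (i : Fin 2) (z : ℂ) :
    gauge K (chart i z) = (if i = 0 then 1 else -1) * gaugeChart K z := by
  have h1 : 1 + K * ‖z‖ ^ 2 ≠ 0 := by positivity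
  have h2 : K + ‖z‖ ^ 2 ≠ 0 := by positivity
  rw [gauge, chart, Projectivization.lift_mk]
  fin_cases i
  · simp only [homog, gaugeChart]
    simp
    rw [Real.log_div h1 h2]
  · simp only [homog, gaugeChart]
    simp
    rw [Real.log_div (by positivity) (by positivity), add_comm (‖z‖ ^ 2), add_comm (K * ‖z‖ ^ 2)]
    ring

theorem contDiff_gaugeChart {K : ℝ} (hK : 0 < K) : ContDiff ℝ 1 (gaugeChart K) := by
  have h0 : ContDiff ℝ 1 (fun z : ℂ => ‖z‖ ^ 2) := contDiff_norm_sq ℝ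
  exact contDiff_const.mul
    (((contDiff_const.add (contDiff_const.mul h0)).log fun z => by positivity).sub
      ((contDiff_const.add h0).log fun z => by positivity))

theorem norm_fderiv_gaugeChart {K : ℝ} (hK : 1 < K) (z : ℂ) :
    ‖fderiv ℝ (gaugeChart K) z‖ =
      ‖z‖ * (K ^ 2 - 1) / ((1 + K * ‖z‖ ^ 2) * (K + ‖z‖ ^ 2)) := by
  have h1 : 1 + K * ‖z‖ ^ 2 ≠ 0 := by positivity
  have h2 : K + ‖z‖ ^ 2 ≠ 0 := by positivity
  have hd := ((((hasDerivAt_id (‖z‖ ^ 2)).const_mul K).const_add 1).log h1).sub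
    (((hasDerivAt_id (‖z‖ ^ 2)).const_add K).log h2)
  have e : fderiv ℝ (gaugeChart K) z = _ := (hasFDerivAt_radial (hd.const_mul (1 / 2))).fderiv
  rw [e, norm_smul, norm_fderiv_norm_sq]
  have e2 : 1 / 2 * (K * 1 / (1 + K * id (‖z‖ ^ 2)) - 1 / (K + id (‖z‖ ^ 2))) =
      1 / 2 * ((K ^ 2 - 1) / ((1 + K * ‖z‖ ^ 2) * (K + ‖z‖ ^ 2))) := by
    simp only [id]
    field_simp
    ring
  have h3 : 0 ≤ (K ^ 2 - 1) / ((1 + K * ‖z‖ ^ 2) * (K + ‖z‖ ^ 2)) :=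
    div_nonneg (by nlinarith) (by positivity)
  rw [e2, Real.norm_of_nonneg (by positivity)]
  ring

/-- In the cylindrical coordinate the gradient is at most 1, and it decays in the two caps |z| ≤ 1/K
and |z| ≥ K. The three bounds match the lower bounds for √ρ available in the three regions. -/
theorem norm_fderiv_gaugeChart_le {K : ℝ} (hK : 1 < K) (z : ℂ) :
    (‖z‖ ≤ 1 / K → ‖fderiv ℝ (gaugeChart K) z‖ ≤ 1) ∧
    (z ≠ 0 → ‖fderiv ℝ (gaugeChart K) z‖ ≤ 1 / ‖z‖) ∧
    (K ≤ ‖z‖ → ‖fderiv ℝ (gaugeChart K) z‖ ≤ 1 / ‖z‖ ^ 2) := by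
  rw [norm_fderiv_gaugeChart hK]
  have hK0 : 0 < K := by linarith
  have hr := norm_nonneg z
  set r := ‖z‖ with hr'
  refine ⟨fun h => ?_, fun h => ?_, fun h => ?_⟩
  · rw [div_le_one (by positivity)]
    rw [le_div_iff₀ hK0] at h
    have : r * K ^ 2 ≤ K := by nlinarith
    have h2 : K ≤ (1 + K * r ^ 2) * (K + r ^ 2) := by
      have : (1 + K * r ^ 2) * (K + r ^ 2) = K + (r ^ 2 + K ^ 2 * r ^ 2 + K * r ^ 2 * r ^ 2) := by
        ring
      have h3 : 0 ≤ r ^ 2 + K ^ 2 * r ^ 2 + K * r ^ 2 * r ^ 2 := by positivity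
      linarith
    nlinarith
  · have hr0 : 0 < r := norm_pos_iff.2 h
    rw [div_le_div_iff₀ (by positivity) hr0]
    have : (1 + K * r ^ 2) * (K + r ^ 2) =
      K ^ 2 * r ^ 2 + (K + r ^ 2 + K * r ^ 2 * r ^ 2) := by ring
    have h3 : 0 ≤ K + r ^ 2 + K * r ^ 2 * r ^ 2 := by positivity
    nlinarith [sq_nonneg r]
  · have hr0 : 0 < r := hK0.trans_le h
    rw [div_le_div_iff₀ (by positivity) (by positivity)]
    have e : (1 + K * r ^ 2) * (K + r ^ 2) =
      K * r ^ 4 + (K + K ^ 2 * r ^ 2 + r ^ 2) := by ring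
    have h3 : 0 ≤ K + K ^ 2 * r ^ 2 + r ^ 2 := by positivity
    have h4 : K ^ 2 * r ^ 3 ≤ K * r ^ 4 := by
      have : K ^ 2 * r ^ 3 = K * r ^ 3 * K := by ring
      have h5 : K * r ^ 4 = K * r ^ 3 * r := by ring
      rw [this, h5]
      gcongr
    have h6 : 0 ≤ r ^ 3 := by positivity
    rw [e]
    nlinarith

theorem JoinedBy.enorm_sub_le {g : KahlerP1} {K : ℝ} (hK : 0 < K)
    (h : ∀ i z, ‖fderiv ℝ (gaugeChart K) z‖ ≤ 2 * √(g.ρ i z)) {p q : P1} {ℓ : ℝ≥0∞}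
    (hpq : JoinedBy g p q ℓ) : ‖gauge K q - gauge K p‖ₑ ≤ 2 * ℓ := by
  induction hpq with
  | refl => simp
  | arc ℓ i γ hγ hp ih =>
    have h1 := enorm_sub_le_arcLength (contDiff_gaugeChart hK) zero_le_two (h i) hγ
    have h2 : ‖gauge K (chart i (γ 1)) - gauge K (chart i (γ 0))‖ₑ =
        ‖gaugeChart K (γ 1) - gaugeChart K (γ 0)‖ₑ := by
      rw [gauge_chart hK, gauge_chart hK, ← mul_sub, enorm_mul]
      split_ifs <;> simp
    have e : gauge K (chart i (γ 1)) - gauge K p =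
      (gauge K (chart i (γ 0)) - gauge K p) +
        (gauge K (chart i (γ 1)) - gauge K (chart i (γ 0))) := by ring
    rw [e, mul_add]
    refine (enorm_add_le _ _).trans (add_le_add ih ?_)
    rw [h2]
    simpa using h1

theorem log_le_diamP1 {g : KahlerP1} {K : ℝ} (hK : 1 < K)
    (h : ∀ i z, ‖fderiv ℝ (gaugeChart K) z‖ ≤ 2 * √(g.ρ i z)) :
    ENNReal.ofReal (Real.log K / 2) ≤ diamP1 g := by
  have hK0 : 0 < K := by linarith
  refine le_trans ?_ (le_iSup₂ (f := fun p q => distP1 g p q) (chart 0 0) (chart 1 0))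
  refine le_iInf₂ fun ℓ hℓ => ?_
  have h1 := hℓ.enorm_sub_le hK0 h
  have e : gauge K (chart 1 0) - gauge K (chart 0 0) = Real.log K := by
    rw [gauge_chart hK0, gauge_chart hK0]
    simp [gaugeChart]
    ring
  rw [e, ← ofReal_norm, Real.norm_of_nonneg (Real.log_nonneg hK.le)] at h1
  rw [ENNReal.ofReal_div_of_pos two_pos]
  refine ENNReal.div_le_of_le_mul' ?_
  simpa using h1

/-! ### The total curvature -/

/-- In polar coordinates the radial density of the curvature is an exact derivative. -/
theorem Profile.hasDerivAt_half_slope {n : ℕ} {m : ℝ} {u : ℝ → ℝ} (h : Profile n m u) {r : ℝ}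
    (hr : 0 < r) : HasDerivAt (fun r => -(1 / 2) * slope n u (r ^ 2))
      (r * (-(1 / 2) * (factor n m u (r ^ 2) * ((r ^ 2) ^ n * weight n u (r ^ 2) - 1)))) r := by
  have := (((h.hasDerivAt_slope (s := r ^ 2) (by positivity)).comp r
    (hasDerivAt_pow 2 r))).const_mul (-(1 / 2) : ℝ)
  refine this.congr_deriv ?_
  push_cast
  ring

/-- The radial integral is half of the drop of u' from 2n at the origin to 0 at infinity.
Integrability costs nothing because u < 0 makes the density nonnegative. -/
theorem Profile.integral_curv {n : ℕ} {m : ℝ} {u : ℝ → ℝ} (h : Profile n m u)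
    (htop : Tendsto (deriv u) atTop (𝓝 0)) :
    Integrable (curv (planeHerm n u)) volume ∧
      1 / (2 * Real.pi) * ∫ z, curv (planeHerm n u) z = n := by
  set f : ℝ → ℝ := fun r =>
    -(1 / 2) * (factor n m u (r ^ 2) * ((r ^ 2) ^ n * weight n u (r ^ 2) - 1)) with hf
  have e : curv (planeHerm n u) = fun z => f ‖z‖ := by
    ext z
    rw [h.curv_eq, stateFn_eq]
    rfl
  have hcont : ContinuousWithinAt (fun r => -(1 / 2) * slope n u (r ^ 2)) (Ici 0) 0 := by
    have h1 : ContinuousWithinAt (slope n u) (Ici 0) ((0 : ℝ) ^ 2) :=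
      (h.hasDerivWithinAt_slope (s := (0 : ℝ) ^ 2) (by simp)).continuousWithinAt
    have h2 : ContinuousWithinAt (fun r : ℝ => r ^ 2) (Ici 0) 0 := by fun_prop
    exact continuousWithinAt_const.mul (ContinuousWithinAt.comp (g := slope n u)
      (f := fun r : ℝ => r ^ 2) h1 h2 fun r _ => sq_nonneg r)
  have hderiv : ∀ r ∈ Ioi (0 : ℝ), HasDerivAt (fun r => -(1 / 2) * slope n u (r ^ 2)) (r * f r) r :=
    fun r hr => h.hasDerivAt_half_slope hr
  have hnonneg : ∀ r ∈ Ioi (0 : ℝ), 0 ≤ r * f r := by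
    intro r hr
    have hr0 : 0 < r := hr
    have h1 := pow_mul_weight (n := n) (u := u) (show 0 < r ^ 2 by positivity)
    have h2 : Real.exp (u (Real.log (r ^ 2) / 2)) < 1 := by simpa using h.neg _
    have h3 := h.factor_pos (r ^ 2)
    have h4 := mul_nonneg h3.le (show 0 ≤ 1 - (r ^ 2) ^ n * weight n u (r ^ 2) by
      rw [h1]; linarith)
    refine mul_nonneg hr0.le ?_
    simp only [hf]
    linarith
  have htend : Tendsto (fun r => -(1 / 2) * slope n u (r ^ 2)) atTop (𝓝 0) := by
    have h1 := (htop.comp Real.tendsto_log_atTop).const_mul (-(1 / 2) : ℝ)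
    rw [mul_zero] at h1
    refine h1.congr' ?_
    filter_upwards [eventually_gt_atTop 0] with r hr
    have e2 : Real.log (r ^ 2) / 2 = Real.log r := by rw [Real.log_pow]; push_cast; ring
    rw [slope, if_neg (by positivity), e2]
    rfl
  have hint := integrableOn_Ioi_deriv_of_nonneg hcont hderiv hnonneg htend
  have hval := integral_Ioi_of_hasDerivAt_of_nonneg hcont hderiv hnonneg htend
  have hs0 : slope n u ((0 : ℝ) ^ 2) = 2 * n := by simp [slope]
  rw [hs0] at hval
  rw [e]
  constructor
  · rw [integrable_fun_norm_addHaar]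
    simpa [Complex.finrank_real_complex] using hint
  · rw [integral_fun_norm_addHaar volume f]
    simp only [Complex.finrank_real_complex, Nat.reduceSub, pow_one, smul_eq_mul, hval]
    have hvol : (volume : Measure ℂ).real (Metric.ball 0 1) = Real.pi := by
      simp [Measure.real, Complex.volume_ball]
    rw [hvol]
    have := Real.pi_pos.ne'
    simp
    field_simp

section

variable {n : ℕ} {ι : Type*} {M : ι → ℝ} {U : ι → ℝ → ℝ} {I : Set ι}

/-! ### Continuous dependence -/

theorem Solves.dist_le_exp {a m m' : ℝ} {u v : ℝ → ℝ} {K : NNReal} {C : ℝ}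
    (hK : LipschitzWith K (field a m)) (hC : ∀ x, |force a x| ≤ C)
    (hu : Solves a m u) (hv : Solves a m' v) {t T : ℝ} (ht : |t| ≤ T) :
    dist (u t, deriv u t) (v t, deriv v t) ≤
      dist (u 0, deriv u 0) (v 0, deriv v 0) * Real.exp ((K + 1) * T) +
        |m - m'| * C * Real.exp ((K + 1) * T) := by
  have hC0 : 0 ≤ C := (abs_nonneg _).trans (hC 0)
  -- The constant K + 1 in place of K excludes the degenerate case K = 0 of Grönwall's bound.
  have h1 := hu.dist_le (K := K + 1) (hK.weaken (by simp)) hC hv t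
  have hK1 : ((K + 1 : NNReal) : ℝ) ≠ 0 := by positivity
  rw [gronwallBound_of_K_ne_0 hK1] at h1
  push_cast at h1
  refine h1.trans (add_le_add (by gcongr) ?_)
  have h2 : |m - m'| * C / ((K : ℝ) + 1) ≤ |m - m'| * C :=
    div_le_self (by positivity) (by linarith [K.2])
  have h3 : Real.exp (((K : ℝ) + 1) * |t|) - 1 ≤ Real.exp ((K + 1) * T) := by
    have : Real.exp (((K : ℝ) + 1) * |t|) ≤ Real.exp ((K + 1) * T) := by gcongr
    linarith
  calc _ ≤ |m - m'| * C / ((K : ℝ) + 1) * Real.exp ((K + 1) * T) := by gcongr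
    _ ≤ _ := by gcongr

/-- Continuous dependence on initial values and on the parameter. -/
theorem profileConv_of_init (hn : 1 ≤ n) {l : Filter ι} {i₀ : ι} (hI : I ∈ l) (hi₀ : i₀ ∈ I)
    (h : ∀ i ∈ I, Solves (1 / n) (M i) (U i)) (hM : Tendsto M l (𝓝 (M i₀)))
    (h0 : Tendsto (fun i => U i 0) l (𝓝 (U i₀ 0)))
    (h1 : Tendsto (fun i => deriv (U i) 0) l (𝓝 (deriv (U i₀) 0))) :
    ProfileConv n l M U (M i₀) (U i₀) := by
  have ha := one_div_pos_of_one_le hn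
  obtain ⟨K, hK⟩ := exists_field_lipschitz ha (M i₀)
  obtain ⟨C, -, hC⟩ := exists_force_bound ha
  have key : ∀ t : ℝ, Tendsto (fun q : ι × ℝ => (U q.1 q.2, deriv (U q.1) q.2)) (l ×ˢ 𝓝 t)
      (𝓝 (U i₀ t, deriv (U i₀) t)) := by
    intro t
    have hcont : Tendsto (fun q : ι × ℝ => (U i₀ q.2, deriv (U i₀) q.2)) (l ×ˢ 𝓝 t)
        (𝓝 (U i₀ t, deriv (U i₀) t)) :=
      ((h i₀ hi₀).hasDerivAt_prod t).continuousAt.tendsto.comp tendsto_snd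
    refine hcont.congr_dist ?_
    have hb : Tendsto (fun i => dist (U i₀ 0, deriv (U i₀) 0) (U i 0, deriv (U i) 0) *
        Real.exp ((K + 1) * (|t| + 1)) + |M i₀ - M i| * C * Real.exp ((K + 1) * (|t| + 1))) l
        (𝓝 0) := by
      have e1 : Tendsto (fun i => dist (U i₀ 0, deriv (U i₀) 0) (U i 0, deriv (U i) 0)) l (𝓝 0) := by
        have := (tendsto_const_nhds (x := (U i₀ 0, deriv (U i₀) 0))).dist (h0.prodMk_nhds h1)
        rwa [dist_self] at this
      have e2 : Tendsto (fun i => |M i₀ - M i|) l (𝓝 0) := by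
        have := ((tendsto_const_nhds (x := M i₀)).sub hM).abs
        rwa [sub_self, abs_zero] at this
      have := (e1.mul_const (Real.exp ((K + 1) * (|t| + 1)))).add
        ((e2.mul_const C).mul_const (Real.exp ((K + 1) * (|t| + 1))))
      simpa using this
    have hnear : ∀ᶠ s in 𝓝 t, |s| ≤ |t| + 1 := by
      have := (continuous_abs.tendsto t).eventually (gt_mem_nhds (show |t| < |t| + 1 by linarith))
      exact this.mono fun s hs => le_of_lt hs
    refine squeeze_zero' (Eventually.of_forall fun _ => dist_nonneg) ?_ (hb.comp tendsto_fst)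
    filter_upwards [prod_mem_prod hI hnear] with q hq
    exact (h i₀ hi₀).dist_le_exp hK (fun x => (hC x).1) (h q.1 hq.1) hq.2
  refine ⟨hM, fun t _ => ?_, fun t _ => ?_⟩
  · rw [nhdsWithin_univ]
    exact (continuous_fst.tendsto _).comp (key t)
  · rw [nhdsWithin_univ]
    exact (continuous_snd.tendsto _).comp (key t)

/-! ### The algebra of functions on the cylinder -/

/-- Generators of an algebra of functions of `t = log |z|` that is closed under derivation. -/
def cylGen (n : ℕ) (M : ι → ℝ) (U : ι → ℝ → ℝ) : Set (ι → ℝ → ℝ) :=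
  {fun i t => Real.exp (U i t) - 1, fun i => deriv (U i), fun i t => pot (1 / n) (U i t),
    fun i _ => M i}

/-- The algebra generated by `cylGen`. -/
noncomputable def cylAlg (n : ℕ) (M : ι → ℝ) (U : ι → ℝ → ℝ) : Subalgebra ℝ (ι → ℝ → ℝ) :=
  Algebra.adjoin ℝ (cylGen n M U)

theorem exp_sub_one_mem_cylAlg : (fun i t => Real.exp (U i t) - 1) ∈ cylAlg n M U :=
  Algebra.subset_adjoin (by simp [cylGen])

theorem deriv_mem_cylAlg : (fun i => deriv (U i)) ∈ cylAlg n M U :=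
  Algebra.subset_adjoin (by simp [cylGen])

theorem pot_mem_cylAlg : (fun i t => pot (1 / n) (U i t)) ∈ cylAlg n M U :=
  Algebra.subset_adjoin (by simp [cylGen])

theorem param_mem_cylAlg : (fun i _ => M i) ∈ cylAlg n M U :=
  Algebra.subset_adjoin (by simp [cylGen])

theorem Solves.hasDerivAt_exp_sub_one {a m : ℝ} {u : ℝ → ℝ} (h : Solves a m u) (t : ℝ) :
    HasDerivAt (fun t => Real.exp (u t) - 1) ((1 + (Real.exp (u t) - 1)) * deriv u t) t :=
  ((h.hasDerivAt t).exp.sub_const 1).congr_deriv (by ring)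

theorem Solves.hasDerivAt_deriv {a m : ℝ} {u : ℝ → ℝ} (h : Solves a m u) (t : ℝ) :
    HasDerivAt (deriv u) (m * pot a (u t) * (Real.exp (u t) - 1)) t :=
  (h.2 t).congr_deriv (by rw [force]; ring)

theorem Solves.hasDerivAt_pot {a m : ℝ} {u : ℝ → ℝ} (h : Solves a m u) (t : ℝ) :
    HasDerivAt (fun t => pot a (u t)) (-a * ((Real.exp (u t) - 1) * deriv u t * pot a (u t))) t :=
  ((EinsteinBogomolnyi.hasDerivAt_pot a (u t)).comp t (h.hasDerivAt t)).congr_deriv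
    (by rw [force]; ring)

/-- The second derivative m `pot` (e^u - 1) stays in the algebra. The generator is e^u - 1 rather
than e^u because it is of the order of u, which the decay estimates use. -/
theorem diffAlg_cylAlg (h : ∀ i ∈ I, Solves (1 / n) (M i) (U i)) :
    DiffAlg I univ (cylAlg n M U) := by
  have hx := exp_sub_one_mem_cylAlg (n := n) (M := M) (U := U)
  have hp := deriv_mem_cylAlg (n := n) (M := M) (U := U)
  have hv := pot_mem_cylAlg (n := n) (M := M) (U := U)
  have hm := param_mem_cylAlg (n := n) (M := M) (U := U)
  refine diffAlg_adjoin fun f hf => ?_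
  simp only [cylGen, mem_insert_iff, mem_singleton_iff] at hf
  rcases hf with rfl | rfl | rfl | rfl
  · exact ⟨_, mul_mem (add_mem (one_mem _) hx) hp,
      fun i hi s _ => ((h i hi).hasDerivAt_exp_sub_one s).hasDerivWithinAt⟩
  · exact ⟨_, mul_mem (mul_mem hm hv) hx,
      fun i hi s _ => ((h i hi).hasDerivAt_deriv s).hasDerivWithinAt⟩
  · exact ⟨_, Subalgebra.smul_mem _ (mul_mem (mul_mem hx hp) hv) (-(1 / n : ℝ)),
      fun i hi s _ => ((h i hi).hasDerivAt_pot s).hasDerivWithinAt⟩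
  · exact ⟨0, zero_mem _, fun i hi s _ => hasDerivWithinAt_const s _ _⟩

theorem contConv_cylAlg {l : Filter ι} {i₀ : ι} (hc : ProfileConv n l M U (M i₀) (U i₀)) :
    ∀ f ∈ cylAlg n M U, ContConv l univ f (f i₀) := by
  refine contConv_adjoin fun f hf => ?_
  simp only [cylGen, mem_insert_iff, mem_singleton_iff] at hf
  rcases hf with rfl | rfl | rfl | rfl
  · exact hc.value.map (φ := fun x => Real.exp x - 1) (by fun_prop)
  · exact hc.slope
  · exact hc.value.map (contDiff_pot (1 / n) (k := 0)).continuous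
  · exact contConv_of_tendsto hc.param

end

/-! ### Decay of the limit metric -/

/-- A function of `Re ζ` has the same bounds on its derivatives as a function of one variable. -/
theorem norm_iteratedFDeriv_comp_re_le {f : ℝ → ℝ} (hf : ContDiff ℝ ∞ f) (l : ℕ) (ζ : ℂ) :
    ‖iteratedFDeriv ℝ l (fun ξ : ℂ => f ξ.re) ζ‖ ≤ |iteratedDeriv l f ζ.re| := by
  have hl : (l : WithTop ℕ∞) ≤ (∞ : WithTop ℕ∞) := by exact_mod_cast le_top
  have e : (fun ξ : ℂ => f ξ.re) = f ∘ Complex.reCLM := rfl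
  rw [e, Complex.reCLM.iteratedFDeriv_comp_right hf ζ hl]
  refine (ContinuousMultilinearMap.norm_compContinuousLinearMap_le _ _).trans ?_
  rw [norm_iteratedFDeriv_eq_norm_iteratedDeriv]
  simp

section

variable {n : ℕ} {m : ℝ} {u : ℝ → ℝ}

/-- Smoothness and bounds for all derivatives of the members of a set closed under derivation. -/
theorem exists_iteratedFDeriv_bound {J : Set (ℝ → ℝ)} {w : ℝ → ℝ}
    (hJ : ∀ f ∈ J, ∃ f' ∈ J, ∀ t, HasDerivAt f (f' t) t)
    (hb : ∀ f ∈ J, ∃ C : ℝ, ∀ t, 0 ≤ t → |f t| ≤ C * w t) {f : ℝ → ℝ} (hf : f ∈ J) (l : ℕ) :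
    ∃ C : ℝ, ∀ ζ : ℂ, 0 ≤ ζ.re → ‖iteratedFDeriv ℝ l (fun ξ : ℂ => f ξ.re) ζ‖ ≤ C * w ζ.re := by
  have hd : ∀ f ∈ J, deriv f ∈ J := fun f hf => by
    obtain ⟨f', hf', h⟩ := hJ f hf
    rwa [show deriv f = f' from funext fun t => (h t).deriv]
  have hit : ∀ l : ℕ, ∀ f ∈ J, iteratedDeriv l f ∈ J := by
    intro l
    induction l with
    | zero => intro f hf; rwa [iteratedDeriv_zero]
    | succ l ih => intro f hf; rw [iteratedDeriv_succ']; exact ih _ (hd f hf)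
  have hsmooth : ContDiff ℝ ∞ f := by
    refine contDiff_of_differentiable_iteratedDeriv fun k _ => ?_
    obtain ⟨f', -, h⟩ := hJ _ (hit k f hf)
    exact fun t => (h t).differentiableAt
  obtain ⟨C, hC⟩ := hb _ (hit l f hf)
  exact ⟨C, fun ζ hζ => (norm_iteratedFDeriv_comp_re_le hsmooth l ζ).trans (hC _ hζ)⟩

theorem expDecay_of_bound {f : ℂ → ℝ} {w : ℝ → ℝ} {κ B : ℝ} (hκ : 0 < κ) (hw : ∀ t, 0 ≤ w t)
    (hwB : ∀ t, 0 ≤ t → w t ≤ B * Real.exp (-(κ * t)))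
    (h : ∀ l : ℕ, ∃ C : ℝ, ∀ ζ : ℂ, 0 ≤ ζ.re → ‖iteratedFDeriv ℝ l f ζ‖ ≤ C * w ζ.re) :
    ExpDecay f := by
  refine ⟨κ, hκ, fun l => ?_⟩
  obtain ⟨C, hC⟩ := h l
  refine ⟨|C| * B, fun ζ hζ => (hC ζ hζ).trans ?_⟩
  calc C * w ζ.re ≤ |C| * w ζ.re := mul_le_mul_of_nonneg_right (le_abs_self C) (hw _)
    _ ≤ |C| * (B * Real.exp (-(κ * ζ.re))) :=
      mul_le_mul_of_nonneg_left (hwB _ hζ) (abs_nonneg C)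
    _ = _ := by ring

theorem cyl_planeMetric (hn : 1 ≤ n) (ζ : ℂ) :
    cyl (planeMetric n m u) ζ = m * pot (1 / n) (u ζ.re) := by
  rw [cyl, planeMetric_mul hn (Complex.exp_ne_zero ζ), Complex.norm_exp, Real.log_exp]

theorem Profile.cyl_curv (h : Profile n m u) (ζ : ℂ) :
    cyl (curv (planeHerm n u)) ζ =
      -(1 / 2) * (m * pot (1 / n) (u ζ.re) * (Real.exp (u ζ.re) - 1)) := by
  have h1 : stateFn (planeHerm n u) (fun z => z ^ n) (Complex.exp ζ) = Real.exp (u ζ.re) := by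
    have := planeHerm_mul (n := n) (u := u) (Complex.exp_ne_zero ζ)
    rw [Complex.norm_exp, Real.log_exp] at this
    rw [stateFn, norm_pow, Complex.norm_exp, ← pow_mul, mul_comm n]
    exact this
  rw [cyl, h.curv_eq, h1, ← cyl_planeMetric h.one_le, cyl]
  ring

namespace LimitProfile

variable (h : LimitProfile n u)
include h

/-- All generators are bounded since u < 0, and boundedness passes to sums and products. -/
theorem exists_bound_of_mem {f : Unit → ℝ → ℝ}
    (hf : f ∈ cylAlg n (fun _ => 1 / lamB n 0) (fun _ : Unit => u)) :
    ∃ C : ℝ, 0 ≤ C ∧ ∀ t, |f () t| ≤ C := by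
  induction hf using Algebra.adjoin_induction with
  | mem x hx =>
    simp only [cylGen, mem_insert_iff, mem_singleton_iff] at hx
    rcases hx with rfl | rfl | rfl | rfl
    · refine ⟨1, zero_le_one, fun t => ?_⟩
      have h1 := Real.exp_pos (u t)
      have h2 : Real.exp (u t) < 1 := by simpa using h.neg t
      rw [abs_le]
      constructor <;> linarith
    · exact ⟨2 * n, by positivity, fun t => (h.abs_deriv_lt t).le⟩
    · refine ⟨pot (1 / n) 0, (pot_pos _ _).le, fun t => ?_⟩
      rw [abs_of_pos (pot_pos _ _)]
      exact pot_le_pot_zero (one_div_pos_of_one_le h.one_le) _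
    · exact ⟨_, abs_nonneg _, fun _ => le_rfl⟩
  | algebraMap r => exact ⟨|r|, abs_nonneg r, fun t => le_rfl⟩
  | add x y _ _ ihx ihy =>
    obtain ⟨C, hC, hx⟩ := ihx
    obtain ⟨D, hD, hy⟩ := ihy
    exact ⟨C + D, add_nonneg hC hD, fun t => (abs_add_le _ _).trans (add_le_add (hx t) (hy t))⟩
  | mul x y _ _ ihx ihy =>
    obtain ⟨C, hC, hx⟩ := ihx
    obtain ⟨D, hD, hy⟩ := ihy
    refine ⟨C * D, mul_nonneg hC hD, fun t => ?_⟩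
    rw [Pi.mul_apply, Pi.mul_apply, abs_mul]
    exact mul_le_mul (hx t) (hy t) (abs_nonneg _) hC

theorem abs_exp_sub_one_le (t : ℝ) : |Real.exp (u t) - 1| ≤ |u t| := by
  have h1 := Real.add_one_le_exp (u t)
  have h2 : Real.exp (u t) < 1 := by simpa using h.neg t
  rw [abs_of_neg (h.neg t), abs_of_neg (by linarith)]
  linarith

theorem abs_deriv_le (t : ℝ) : |deriv u t| ≤ 2 * n * √(coupling n) * |u t| := by
  rw [abs_of_pos (h.deriv_pos t), abs_of_neg (h.neg t)]
  exact h.deriv_le t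

theorem curv_bound (l : ℕ) : ∃ C : ℝ, ∀ ζ : ℂ, 0 ≤ ζ.re →
    ‖iteratedFDeriv ℝ l (cyl (curv (planeHerm n u))) ζ‖ ≤ C * |u ζ.re| := by
  set A := cylAlg n (fun _ => 1 / lamB n 0) (fun _ : Unit => u) with hA
  have hx : (fun _ t => Real.exp (u t) - 1) ∈ A := exp_sub_one_mem_cylAlg
  have hp : (fun _ => deriv u) ∈ A := deriv_mem_cylAlg
  have hv : (fun _ t => pot (1 / n) (u t)) ∈ A := pot_mem_cylAlg
  have hm : (fun _ _ => 1 / lamB n 0) ∈ A := param_mem_cylAlg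
  have hmv := mul_mem hm hv
  have hD : DiffAlg univ univ A := diffAlg_cylAlg fun _ _ => h.solves
  -- J is the ideal generated by e^u - 1 and u'. It is stable under derivation, since (e^u - 1)' =
  -- e^u u' and u'' = m `pot` (e^u - 1). Its members are O(|u|): both generators are, and the
  -- coefficients are bounded.
  set J : Set (ℝ → ℝ) := {f | ∃ a ∈ A, ∃ b ∈ A,
    ∀ t, f t = (Real.exp (u t) - 1) * a () t + deriv u t * b () t} with hJ
  have hJd : ∀ f ∈ J, ∃ f' ∈ J, ∀ t, HasDerivAt f (f' t) t := by
    rintro f ⟨a, ha, b, hb, hf⟩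
    obtain ⟨a', ha', hda⟩ := hD a ha
    obtain ⟨b', hb', hdb⟩ := hD b hb
    refine ⟨_, ⟨_, add_mem ha' (mul_mem hmv hb),
      _, add_mem (mul_mem (add_mem (one_mem A) hx) ha) hb', fun t => rfl⟩, fun t => ?_⟩
    rw [show f = _ from funext hf]
    have d1 := (hda () (mem_univ _) t (mem_univ _)).hasDerivAt univ_mem
    have d2 := (hdb () (mem_univ _) t (mem_univ _)).hasDerivAt univ_mem
    refine (((h.solves.hasDerivAt_exp_sub_one t).mul d1).add
      ((h.solves.hasDerivAt_deriv t).mul d2)).congr_deriv ?_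
    simp only [Pi.add_apply, Pi.mul_apply, Pi.one_apply]
    ring
  have hJb : ∀ f ∈ J, ∃ C : ℝ, ∀ t, 0 ≤ t → |f t| ≤ C * |u t| := by
    rintro f ⟨a, ha, b, hb, hf⟩
    obtain ⟨C, hC, ha⟩ := h.exists_bound_of_mem ha
    obtain ⟨D, hD, hb⟩ := h.exists_bound_of_mem hb
    refine ⟨C + 2 * n * √(coupling n) * D, fun t _ => ?_⟩
    rw [hf]
    calc _ ≤ |Real.exp (u t) - 1| * |a () t| + |deriv u t| * |b () t| := by
          rw [← abs_mul, ← abs_mul]; exact abs_add_le _ _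
      _ ≤ |u t| * C + 2 * n * √(coupling n) * |u t| * D :=
          add_le_add (mul_le_mul (h.abs_exp_sub_one_le t) (ha t) (abs_nonneg _) (abs_nonneg _))
            (mul_le_mul (h.abs_deriv_le t) (hb t) (abs_nonneg _) (by positivity))
      _ = _ := by ring
  have hmem : (fun t => -(1 / 2) * (1 / lamB n 0 * pot (1 / n) (u t) * (Real.exp (u t) - 1))) ∈ J :=
    ⟨_, A.smul_mem hmv (-(1 / 2)), 0, zero_mem A, fun t => by
      simp only [Pi.smul_apply, Pi.mul_apply, Pi.zero_apply, smul_eq_mul]; ring⟩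
  have e : cyl (curv (planeHerm n u)) = fun ξ : ℂ =>
    (fun t => -(1 / 2) * (1 / lamB n 0 * pot (1 / n) (u t) * (Real.exp (u t) - 1))) ξ.re :=
    funext h.cyl_curv
  rw [e]
  exact exists_iteratedFDeriv_bound hJd hJb hmem l

theorem metric_bound (l : ℕ) : ∃ C : ℝ, ∀ ζ : ℂ, 0 ≤ ζ.re →
    ‖iteratedFDeriv ℝ l (fun ξ => cyl (planeMetric n (1 / lamB n 0) u) ξ - 2 * n) ζ‖ ≤
      C * u ζ.re ^ 2 := by
  set A := cylAlg n (fun _ => 1 / lamB n 0) (fun _ : Unit => u) with hA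
  have hx : (fun _ t => Real.exp (u t) - 1) ∈ A := exp_sub_one_mem_cylAlg
  have hv : (fun _ t => pot (1 / n) (u t)) ∈ A := pot_mem_cylAlg
  have hm : (fun _ _ => 1 / lamB n 0) ∈ A := param_mem_cylAlg
  have hmv := mul_mem hm hv
  have hx1 := add_mem (one_mem A) hx
  have hD : DiffAlg univ univ A := diffAlg_cylAlg fun _ _ => h.solves
  -- The square of the ideal used for the curvature, again stable under derivation; its members are
  -- O(u²).
  set J : Set (ℝ → ℝ) := {f | ∃ a ∈ A, ∃ b ∈ A, ∃ c ∈ A,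
    ∀ t, f t = (Real.exp (u t) - 1) ^ 2 * a () t + (Real.exp (u t) - 1) * deriv u t * b () t +
      deriv u t ^ 2 * c () t} with hJ
  have hJd : ∀ f ∈ J, ∃ f' ∈ J, ∀ t, HasDerivAt f (f' t) t := by
    rintro f ⟨a, ha, b, hb, c, hc, hf⟩
    obtain ⟨a', ha', hda⟩ := hD a ha
    obtain ⟨b', hb', hdb⟩ := hD b hb
    obtain ⟨c', hc', hdc⟩ := hD c hc
    refine ⟨_, ⟨_, add_mem ha' (mul_mem hmv hb),
      _, add_mem (add_mem (A.smul_mem (mul_mem hx1 ha) 2) hb') (A.smul_mem (mul_mem hmv hc) 2),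
      _, add_mem (mul_mem hx1 hb) hc', fun t => rfl⟩, fun t => ?_⟩
    rw [show f = _ from funext hf]
    have d1 := (hda () (mem_univ _) t (mem_univ _)).hasDerivAt univ_mem
    have d2 := (hdb () (mem_univ _) t (mem_univ _)).hasDerivAt univ_mem
    have d3 := (hdc () (mem_univ _) t (mem_univ _)).hasDerivAt univ_mem
    have dx := h.solves.hasDerivAt_exp_sub_one t
    have dp := h.solves.hasDerivAt_deriv t
    refine ((((dx.pow 2).mul d1).add ((dx.mul dp).mul d2)).add ((dp.pow 2).mul d3)).congr_deriv ?_
    simp only [Pi.add_apply, Pi.mul_apply, Pi.one_apply, Pi.smul_apply, Pi.pow_apply, smul_eq_mul]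
    push_cast
    ring
  have hJb : ∀ f ∈ J, ∃ C : ℝ, ∀ t, 0 ≤ t → |f t| ≤ C * u t ^ 2 := by
    rintro f ⟨a, ha, b, hb, c, hc, hf⟩
    obtain ⟨C, hC, ha⟩ := h.exists_bound_of_mem ha
    obtain ⟨D, hD, hb⟩ := h.exists_bound_of_mem hb
    obtain ⟨E, hE, hc⟩ := h.exists_bound_of_mem hc
    set κ := 2 * n * √(coupling n) with hκ
    have hκ0 : 0 ≤ κ := by positivity
    refine ⟨C + κ * D + κ ^ 2 * E, fun t _ => ?_⟩
    have hX := h.abs_exp_sub_one_le t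
    have hP := h.abs_deriv_le t
    rw [hf]
    calc _ ≤ |Real.exp (u t) - 1| ^ 2 * |a () t| + |Real.exp (u t) - 1| * |deriv u t| * |b () t| +
            |deriv u t| ^ 2 * |c () t| := by
          rw [← abs_pow, ← abs_pow, ← abs_mul, ← abs_mul, ← abs_mul, ← abs_mul]
          exact (abs_add_le _ _).trans (add_le_add (abs_add_le _ _) le_rfl)
      _ ≤ |u t| ^ 2 * C + |u t| * (κ * |u t|) * D + (κ * |u t|) ^ 2 * E := by
          have := ha t
          have := hb t
          have := hc t
          gcongr
      _ = (C + κ * D + κ ^ 2 * E) * |u t| ^ 2 := by ring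
      _ = _ := by rw [sq_abs]
  -- By energy m `pot` u - 2n = -u'²/(2n), which is quadratic in u'. This is why the metric
  -- converges at twice the rate of the curvature.
  have hmem : (fun t => 1 / lamB n 0 * pot (1 / n) (u t) - 2 * n) ∈ J := by
    refine ⟨0, zero_mem A, 0, zero_mem A, _, A.smul_mem (one_mem A) (-(1 / (2 * n) : ℝ)), fun t => ?_⟩
    have hn := h.n_pos
    have := h.energy t
    simp only [Pi.smul_apply, Pi.one_apply, Pi.zero_apply, smul_eq_mul, mul_zero, zero_add,
      mul_one]
    rw [show deriv u t ^ 2 = (2 * n : ℝ) ^ 2 - 2 * n * (1 / lamB n 0) * pot (1 / n) (u t) by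
      linarith]
    field_simp
    ring
  have e : (fun ξ => cyl (planeMetric n (1 / lamB n 0) u) ξ - 2 * n) = fun ξ : ℂ =>
    (fun t => 1 / lamB n 0 * pot (1 / n) (u t) - 2 * n) ξ.re :=
    funext fun ξ => by rw [cyl_planeMetric h.one_le]
  rw [e]
  exact exists_iteratedFDeriv_bound hJd hJb hmem l

theorem exists_rate : ∃ κ : ℝ, 0 < κ ∧ ∀ t, 0 ≤ t → |u t| ≤ |u 0| * Real.exp (-(κ * t)) := by
  have hn := h.n_pos
  have hc0 : 0 < coupling n := by unfold coupling; positivity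
  have := Real.sqrt_pos.2 hc0
  refine ⟨2 * n * √(coupling n) *
    Real.exp (-coupling n * (Real.exp (- -u 0) - (1 - -u 0)) - -u 0 / 2), by positivity,
    fun t ht => ?_⟩
  rw [abs_of_neg (h.neg t), abs_of_neg (h.neg 0)]
  exact h.upper_bound (c := -u 0) (by ring) ht

theorem expDecay_curv : ExpDecay (cyl (curv (planeHerm n u))) := by
  obtain ⟨κ, hκ, hb⟩ := h.exists_rate
  exact expDecay_of_bound hκ (fun t => abs_nonneg (u t)) hb h.curv_bound

theorem asymptoticToCylinder : AsymptoticToCylinder (2 * n) (planeMetric n (1 / lamB n 0) u) := by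
  obtain ⟨κ, hκ, hb⟩ := h.exists_rate
  refine expDecay_of_bound (κ := 2 * κ) (B := |u 0| ^ 2) (by positivity)
    (fun t => sq_nonneg (u t)) (fun t ht => ?_) h.metric_bound
  have h1 := pow_le_pow_left₀ (abs_nonneg _) (hb t ht) 2
  rw [sq_abs, mul_pow, ← Real.exp_nat_mul] at h1
  refine h1.trans (le_of_eq ?_)
  push_cast
  ring_nf

/-- For |z| ≥ 1 the product ρ |z|² = m `pot` u is at least its value at t = 0, as u increases and
`pot` increases on (-∞, 0]. On the unit disc ρ has a positive minimum. -/
theorem isCompleteMetric : IsCompleteMetric (planeMetric n (1 / lamB n 0) u) := by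
  have hρ := h.contDiff_planeMetric.continuous
  have hm := h.pos
  set m := 1 / lamB n 0 with hmdef
  obtain ⟨z₀, -, hz₀⟩ := (isCompact_closedBall (0 : ℂ) 1).exists_isMinOn
    ⟨0, by simp⟩ hρ.continuousOn
  have hz₀pos : 0 < planeMetric n m u z₀ := h.factor_pos _
  have hV := pot_pos (1 / n) (u 0)
  refine isCompleteMetric_of_le hρ (c := min (planeMetric n m u z₀) (m * pot (1 / n) (u 0)))
    (lt_min hz₀pos (mul_pos hm hV)) fun z => ?_
  have hz : 0 < 1 + ‖z‖ ^ 2 := by positivity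
  rw [div_le_iff₀ hz]
  have hp : 0 < planeMetric n m u z := h.factor_pos _
  rcases le_total ‖z‖ 1 with h1 | h1
  · have : planeMetric n m u z₀ ≤ planeMetric n m u z := hz₀ (by simpa using h1)
    refine (min_le_left _ _).trans (this.trans ?_)
    nlinarith [mul_nonneg hp.le (sq_nonneg ‖z‖)]
  · have hz0 : z ≠ 0 := by
      rintro rfl
      simp at h1
      linarith
    have e := planeMetric_mul (m := m) (u := u) h.one_le hz0
    have h2 : u 0 ≤ u (Real.log ‖z‖) := h.strictMono.monotone (Real.log_nonneg h1)
    have h3 := (pot_strictMonoOn (one_div_pos_of_one_le h.one_le)).monotoneOn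
      (mem_Iic.2 (h.neg _).le) (mem_Iic.2 (h.neg _).le) h2
    have h4 := mul_le_mul_of_nonneg_left h3 hm.le
    refine (min_le_right _ _).trans (h4.trans ?_)
    rw [← e]
    nlinarith

end LimitProfile

end

section

variable {n : ℕ} {m : ℝ} {u : ℝ → ℝ}

/-! ### Translations of profiles and dilations -/

/-- Translation of t by s is the dilation z ↦ e^s z. The factor e^{2s} comes from |dz|², and e^{2ns}
from the lift to the bundle that preserves z^n. -/
theorem Profile.plane_comp_add (h : Profile n m u) (s : ℝ) (w : ℂ) :
    planeMetric n m (fun t => u (t + s)) w =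
      Real.exp s ^ 2 * planeMetric n m u ((Real.exp s : ℂ) * w) ∧
    planeHerm n (fun t => u (t + s)) w =
      Real.exp s ^ (2 * n) * planeHerm n u ((Real.exp s : ℂ) * w) := by
  have hs := h.comp_add_const s
  have he : (Real.exp s : ℂ) ≠ 0 := by exact_mod_cast (Real.exp_pos s).ne'
  have hnorm : ∀ w : ℂ, ‖(Real.exp s : ℂ) * w‖ = Real.exp s * ‖w‖ := fun w => by
    rw [norm_mul, Complex.norm_real, Real.norm_of_nonneg (Real.exp_pos s).le]
  have hlog : ∀ w : ℂ, w ≠ 0 → Real.log ‖(Real.exp s : ℂ) * w‖ = Real.log ‖w‖ + s := fun w hw => by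
    rw [hnorm, Real.log_mul (Real.exp_pos s).ne' (norm_ne_zero_iff.2 hw), Real.log_exp, add_comm]
  have hc : Continuous fun w : ℂ => (Real.exp s : ℂ) * w := by fun_prop
  refine ⟨congrFun (eq_of_eq_on_compl_zero hs.contDiff_planeMetric.continuous
    (continuous_const.mul (h.contDiff_planeMetric.continuous.comp hc)) fun w hw => ?_) w,
    congrFun (eq_of_eq_on_compl_zero hs.contDiff_planeHerm.continuous
    (continuous_const.mul (h.contDiff_planeHerm.continuous.comp hc)) fun w hw => ?_) w⟩
  · have e1 := planeMetric_mul (m := m) (u := fun t => u (t + s)) h.one_le hw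
    have e2 := planeMetric_mul (m := m) (u := u) h.one_le (mul_ne_zero he hw)
    rw [hlog w hw, hnorm, ← e1] at e2
    have hw0 : ‖w‖ ^ 2 ≠ 0 := pow_ne_zero _ (norm_ne_zero_iff.2 hw)
    apply mul_right_cancel₀ hw0
    change _ = Real.exp s ^ 2 * planeMetric n m u ((Real.exp s : ℂ) * w) * ‖w‖ ^ 2
    rw [← e2]
    ring
  · have e1 := planeHerm_mul (n := n) (u := fun t => u (t + s)) hw
    have e2 := planeHerm_mul (n := n) (u := u) (mul_ne_zero he hw)
    rw [hlog w hw, hnorm, ← e1] at e2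
    have hw0 : ‖w‖ ^ (2 * n) ≠ 0 := pow_ne_zero _ (norm_ne_zero_iff.2 hw)
    apply mul_right_cancel₀ hw0
    change _ = Real.exp s ^ (2 * n) * planeHerm n u ((Real.exp s : ℂ) * w) * ‖w‖ ^ (2 * n)
    rw [← e2]
    ring

/-! ### Radial metrics in the cylindrical coordinate -/

/-- The logarithm of a positive function on the positive ray, as a function of `t = log |z|`. -/
noncomputable def logRay (g : ℂ → ℝ) (t : ℝ) : ℝ := Real.log (g (Real.exp t : ℂ))

theorem tendsto_ofReal_exp_atBot : Tendsto (fun t : ℝ => (Real.exp t : ℂ)) atBot (𝓝 0) := by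
  have := (Complex.continuous_ofReal.tendsto 0).comp Real.tendsto_exp_atBot
  simpa [Function.comp_def] using this

section logRay

variable {g : ℂ → ℝ} (hg : ContDiff ℝ ∞ g) (hpos : ∀ z, 0 < g z)

theorem eq_of_isRotInvariant (hrot : IsRotInvariant g) {w : ℂ} (hw : w ≠ 0) :
    g w = g (Real.exp (Real.log ‖w‖) : ℂ) := by
  have hw0 : ‖w‖ ≠ 0 := norm_ne_zero_iff.2 hw
  rw [Real.exp_log (norm_pos_iff.2 hw)]
  have h1 : ‖w / ‖w‖‖ = 1 := by
    rw [norm_div, Complex.norm_real, norm_norm, div_self hw0]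
  have h2 := hrot (w / ‖w‖) ‖w‖ h1
  rwa [div_mul_cancel₀ _ (by exact_mod_cast hw0)] at h2

include hg hpos

theorem contDiff_logRay : ContDiff ℝ ∞ (logRay g) := by
  have h1 : ContDiff ℝ ∞ fun t : ℝ => (Real.exp t : ℂ) :=
    Complex.ofRealCLM.contDiff.comp Real.contDiff_exp
  exact (hg.comp h1).log fun t => (hpos _).ne'

theorem hasDerivAt_logRay (t : ℝ) : HasDerivAt (logRay g) (deriv (logRay g) t) t :=
  ((contDiff_logRay hg hpos).differentiable (by simp) t).hasDerivAt

theorem hasDerivAt_deriv_logRay (t : ℝ) :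
    HasDerivAt (deriv (logRay g)) (deriv (deriv (logRay g)) t) t :=
  (((contDiff_infty_iff_deriv.1 (contDiff_logRay hg hpos)).2).differentiable (by simp) t).hasDerivAt

theorem tendsto_logRay : Tendsto (logRay g) atBot (𝓝 (Real.log (g 0))) :=
  ((hg.continuous.tendsto 0).comp tendsto_ofReal_exp_atBot).log (hpos 0).ne'

/-- The derivative in t is the differential of log g at z = e^t applied to the vector z itself, and
z → 0. -/
theorem tendsto_deriv_logRay : Tendsto (deriv (logRay g)) atBot (𝓝 0) := by
  have hG : ContDiff ℝ ∞ fun z => Real.log (g z) := hg.log fun z => (hpos z).ne'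
  have hd : ∀ t, deriv (logRay g) t =
      fderiv ℝ (fun z => Real.log (g z)) (Real.exp t : ℂ) (Real.exp t : ℂ) := fun t => by
    have h1 : HasDerivAt (fun t : ℝ => (Real.exp t : ℂ)) (Real.exp t : ℂ) t :=
      (Real.hasDerivAt_exp t).ofReal_comp
    exact ((hG.differentiable (by simp) _).hasFDerivAt.comp_hasDerivAt t h1).deriv
  have hc : Continuous fun z : ℂ => fderiv ℝ (fun z => Real.log (g z)) z z :=
    (hG.continuous_fderiv (by simp)).clm_apply continuous_id
  have := (hc.tendsto 0).comp tendsto_ofReal_exp_atBot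
  rw [map_zero] at this
  exact this.congr fun t => (hd t).symm

end logRay

theorem norm_ofReal_exp (t : ℝ) : ‖(Real.exp t : ℂ)‖ = Real.exp t := by
  rw [Complex.norm_real, Real.norm_of_nonneg (Real.exp_pos t).le]

/-- A rotationally invariant Einstein-Bogomol'nyi metric on the plane comes from a solution of the
ordinary differential equation. -/
theorem exists_solves_of_isEBPlane (hn : 1 ≤ n) {ρ h : ℂ → ℝ} (H : IsEBPlane (coupling n) n ρ h)
    (hρ : IsRotInvariant ρ) (hh : IsRotInvariant h) :
    ∃ m u, 0 < m ∧ Solves (1 / n) m u ∧ Tendsto (deriv u) atBot (𝓝 (2 * n)) ∧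
      ∀ z : ℂ, z ≠ 0 → ρ z * ‖z‖ ^ 2 = m * pot (1 / n) (u (Real.log ‖z‖)) ∧
        h z * ‖z‖ ^ (2 * n) = Real.exp (u (Real.log ‖z‖)) := by
  have hn0 : (0 : ℝ) < n := by exact_mod_cast hn
  set f := logRay h with hf
  set k := logRay ρ with hk
  have hf1 := hasDerivAt_logRay H.smooth_herm H.pos_herm
  have hf2 := hasDerivAt_deriv_logRay H.smooth_herm H.pos_herm
  have hk1 := hasDerivAt_logRay H.smooth_metric H.pos_metric
  have hk2 := hasDerivAt_deriv_logRay H.smooth_metric H.pos_metric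
  rw [← hf] at hf1 hf2
  rw [← hk] at hk1 hk2
  set u : ℝ → ℝ := fun t => f t + 2 * n * t with hu
  have hu1 : ∀ t, HasDerivAt u (deriv f t + 2 * n) t := fun t =>
    ((hf1 t).add ((hasDerivAt_id t).const_mul (2 * n : ℝ))).congr_deriv (by simp)
  have hu' : deriv u = fun t => deriv f t + 2 * n := funext fun t => (hu1 t).deriv
  have hlogh : ∀ w : ℂ, w ≠ 0 → Real.log (h w) = f (Real.log ‖w‖) := fun w hw => by
    rw [hf, logRay, ← eq_of_isRotInvariant hh hw]
  have hlogρ : ∀ w : ℂ, w ≠ 0 → Real.log (ρ w) = k (Real.log ‖w‖) := fun w hw => by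
    rw [hk, logRay, ← eq_of_isRotInvariant hρ hw]
  have hpow : ∀ w : ℂ, w ≠ 0 → ‖w‖ ^ (2 * n) = Real.exp (2 * n * Real.log ‖w‖) := fun w hw => by
    have : (2 * n : ℝ) = ((2 * n : ℕ) : ℝ) := by push_cast; ring
    rw [this, Real.exp_nat_mul, Real.exp_log (norm_pos_iff.2 hw)]
  have hherm : ∀ w : ℂ, w ≠ 0 → h w * ‖w‖ ^ (2 * n) = Real.exp (u (Real.log ‖w‖)) := fun w hw => by
    rw [hu, Real.exp_add, ← hlogh w hw, Real.exp_log (H.pos_herm w), hpow w hw]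
  have hstate : ∀ w : ℂ, w ≠ 0 → stateFn h (fun z => z ^ n) w = Real.exp (u (Real.log ‖w‖)) :=
    fun w hw => by rw [← hherm w hw, stateFn, norm_pow, ← pow_mul, mul_comm n]
  have hG1 : ∀ t, HasDerivAt (fun t => Real.exp (u t) - 1)
      (Real.exp (u t) * (deriv f t + 2 * n)) t := fun t => (hu1 t).exp.sub_const 1
  have hG2 : ∀ t, HasDerivAt (fun t => Real.exp (u t) * (deriv f t + 2 * n))
      (Real.exp (u t) * (deriv f t + 2 * n) * (deriv f t + 2 * n) +
        Real.exp (u t) * deriv (deriv f) t) t := fun t =>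
    (hu1 t).exp.mul ((hf2 t).add_const _)
  -- the two equations along the positive ray
  have key : ∀ t, deriv (deriv f) t =
      (Real.exp (u t) - 1) * (ρ (Real.exp t : ℂ) * Real.exp t ^ 2) ∧
      deriv (deriv k) t + 1 / n * (Real.exp (u t) * (deriv f t + 2 * n) * (deriv f t + 2 * n) +
        Real.exp (u t) * deriv (deriv f) t) - 1 / n * deriv (deriv f) t = 0 := by
    intro t
    have hz : (Real.exp t : ℂ) ≠ 0 := by exact_mod_cast (Real.exp_pos t).ne'
    have hlt : Real.log ‖(Real.exp t : ℂ)‖ = t := by rw [norm_ofReal_exp, Real.log_exp]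
    obtain ⟨e1, e2⟩ := H.eb (Real.exp t : ℂ)
    have L1 := laplacian_of_log hz hlogh hf1 (hf2 _)
    have L2 := laplacian_of_log hz hlogρ hk1 (hk2 _)
    have L3 := laplacian_of_log (F := fun w => stateFn h (fun z => z ^ n) w - 1) hz
      (fun w hw => by rw [hstate w hw]) hG1 (hG2 _)
    rw [curv, L1, hstate _ hz] at e1
    rw [scal, lapl, L2, L3, hstate _ hz] at e2
    rw [hlt, norm_ofReal_exp] at e1 e2
    have hρt := (H.pos_metric (Real.exp t : ℂ)).ne'
    have het := (Real.exp_pos t).ne'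
    have e3 : coupling n = 1 / n / 2 := by rw [← two_mul_coupling]; ring
    rw [e3] at e2
    set r := ρ (Real.exp t : ℂ) with hr
    have e1' : deriv (deriv f) t = (Real.exp (u t) - 1) * (r * Real.exp t ^ 2) := by
      field_simp at e1
      linarith
    refine ⟨e1', ?_⟩
    have e4 : deriv (deriv k) t + 1 / n * (Real.exp (u t) * (deriv f t + 2 * n) *
        (deriv f t + 2 * n) + Real.exp (u t) * deriv (deriv f) t) -
        1 / n * ((Real.exp (u t) - 1) * (r * Real.exp t ^ 2)) = 0 := by
      field_simp at e2 ⊢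
      linarith
    rw [← e1'] at e4
    exact e4
  -- the combination of logarithms that is constant
  set D : ℝ → ℝ := fun t => k t + 1 / n * (Real.exp (u t) - 1) - 1 / n * f t with hD
  set D' : ℝ → ℝ := fun t => deriv k t + 1 / n * (Real.exp (u t) * (deriv f t + 2 * n)) -
    1 / n * deriv f t with hD'
  have hD1 : ∀ t, HasDerivAt D (D' t) t := fun t =>
    ((hk1 t).add ((hG1 t).const_mul (1 / n : ℝ))).sub ((hf1 t).const_mul (1 / n : ℝ))
  have hD2 : ∀ t, HasDerivAt D' 0 t := fun t =>
    (((hk2 t).add ((hG2 t).const_mul (1 / n : ℝ))).sub ((hf2 t).const_mul (1 / n : ℝ))).congr_deriv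
      (key t).2
  have hub : Tendsto u atBot atBot :=
    (tendsto_logRay H.smooth_herm H.pos_herm).add_atBot
      (Tendsto.const_mul_atBot (by positivity) tendsto_id)
  have hub' : Tendsto (deriv u) atBot (𝓝 (2 * n)) := by
    rw [hu']
    simpa using (tendsto_deriv_logRay H.smooth_herm H.pos_herm).add_const (2 * n : ℝ)
  -- The two equations make D affine in t; regularity at the origin kills its slope.
  have hD'0 : Tendsto D' atBot (𝓝 0) := by
    have h1 := tendsto_deriv_logRay H.smooth_metric H.pos_metric
    have h2 := tendsto_deriv_logRay H.smooth_herm H.pos_herm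
    have h3 := (Real.tendsto_exp_atBot.comp hub).mul (h2.add_const (2 * n : ℝ))
    have h4 := (h1.add (h3.const_mul (1 / n : ℝ))).sub (h2.const_mul (1 / n : ℝ))
    rw [show (0 : ℝ) = 0 + 1 / n * (0 * (0 + 2 * n)) - 1 / n * 0 by ring]
    exact h4
  have hDc : ∀ t, D' t = 0 := fun t => by
    have h1 : ∀ s, D' s = D' t := fun s => is_const_of_deriv_eq_zero
      (fun t => (hD2 t).differentiableAt) (fun t => (hD2 t).deriv) s t
    have h2 : Tendsto (fun _ : ℝ => D' t) atBot (𝓝 0) := hD'0.congr h1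
    exact tendsto_nhds_unique tendsto_const_nhds h2
  have hDc' : ∀ t, D t = D 0 := fun t => is_const_of_deriv_eq_zero
    (fun t => (hD1 t).differentiableAt) (fun t => by rw [(hD1 t).deriv, hDc]) t 0
  -- The constancy of D, exponentiated. The summand 1/n undoes the -1 in the term (e^u - 1)/n of D.
  have hR : ∀ t, ρ (Real.exp t : ℂ) * Real.exp t ^ 2 = Real.exp (D 0 + 1 / n) * pot (1 / n) (u t) := by
    intro t
    have e1 : ρ (Real.exp t : ℂ) = Real.exp (k t) := by
      rw [hk, logRay, Real.exp_log (H.pos_metric _)]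
    rw [e1, ← Real.exp_nat_mul, ← Real.exp_add, pot, ← Real.exp_add, ← hDc' t]
    congr 1
    simp only [hD, hu]
    field_simp
    push_cast
    ring
  refine ⟨Real.exp (D 0 + 1 / n), u, Real.exp_pos _,
    ⟨fun t => (hu1 t).differentiableAt, fun t => ?_⟩, hub', fun z hz => ⟨?_, hherm z hz⟩⟩
  · rw [hu']
    refine ((hf2 t).add_const _).congr_deriv ?_
    rw [(key t).1, hR, force]
    ring
  · rw [← hR, ← eq_of_isRotInvariant hρ hz, Real.exp_log (norm_pos_iff.2 hz)]

/-- A rotationally invariant Einstein-Bogomol'nyi metric on the plane that is asymptotic to the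
cylinder comes from the limit profile. -/
theorem exists_limitProfile_of_isEBPlane (hn : 1 ≤ n) {ρ h : ℂ → ℝ}
    (H : IsEBPlane (coupling n) n ρ h) (hρ : IsRotInvariant ρ) (hh : IsRotInvariant h)
    (has : AsymptoticToCylinder (2 * n) ρ) :
    ∃ u, LimitProfile n u ∧ ρ = planeMetric n (1 / lamB n 0) u ∧ h = planeHerm n u := by
  have hn0 : (0 : ℝ) < n := by exact_mod_cast hn
  obtain ⟨m, u, hm, hu, hbot, hg⟩ := exists_solves_of_isEBPlane hn H hρ hh
  have hub := tendsto_atBot_of_tendsto_deriv hu.1 (by positivity) hbot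
  have hen := hu.energy_of_tendsto hn hub hbot
  have hR : Tendsto (fun t => m * pot (1 / n) (u t)) atTop (𝓝 (2 * n)) := by
    obtain ⟨κ, hκ, hb⟩ := has
    obtain ⟨C, hC⟩ := hb 0
    have h1 : Tendsto (fun t => C * Real.exp (-(κ * t))) atTop (𝓝 0) := by
      have := (Real.tendsto_exp_neg_atTop_nhds_zero.comp
        (Tendsto.const_mul_atTop hκ tendsto_id)).const_mul C
      simpa using this
    rw [tendsto_iff_norm_sub_tendsto_zero]
    refine squeeze_zero' (Eventually.of_forall fun _ => norm_nonneg _) ?_ h1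
    filter_upwards [eventually_ge_atTop 0] with t ht
    have h2 := hC t (by simpa using ht)
    rw [norm_iteratedFDeriv_zero] at h2
    have h3 := (hg (Complex.exp t) (Complex.exp_ne_zero t)).1
    rw [cyl, h3, Complex.norm_exp, Real.log_exp] at h2
    simpa using h2
  -- Convergence of the conformal factor to 2n exhausts the energy (2n)², so the slope must tend to
  -- 0.
  have hsq : Tendsto (fun t => deriv u t ^ 2) atTop (𝓝 0) := by
    have h1 := (hR.const_mul (2 * n : ℝ)).const_sub ((2 * n : ℝ) ^ 2)
    rw [show (2 * n : ℝ) ^ 2 - 2 * n * (2 * n) = 0 by ring] at h1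
    refine h1.congr fun t => ?_
    rw [← hen t]
    ring
  have htop : Tendsto (deriv u) atTop (𝓝 0) := by
    rw [tendsto_zero_iff_abs_tendsto_zero]
    have := (Real.continuous_sqrt.tendsto _).comp hsq
    rw [Real.sqrt_zero] at this
    exact this.congr fun t => Real.sqrt_sq_eq_abs _
  obtain ⟨hmeq, hlim⟩ := limitProfile_of_tendsto hn hm hu hbot htop
  subst hmeq
  obtain ⟨e1, e2⟩ := hlim.eq_plane (lam := lamB n 0) rfl H.smooth_metric.continuous
    H.smooth_herm.continuous (givenBy_iff.2 hg)
  exact ⟨u, hlim, e1, e2⟩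

/-- Each limit profile rises from -∞ to 0, so v takes the value u 0 somewhere. After a translation
the two agree at one point, which is enough for uniqueness. -/
theorem LimitProfile.exists_eq_comp_add {v : ℝ → ℝ} (hu : LimitProfile n u) (hv : LimitProfile n v) :
    ∃ s, v = fun t => u (t + s) := by
  obtain ⟨r, hr⟩ : ∃ r, v r = u 0 := by
    obtain ⟨r₁, h1⟩ := (hv.tendsto_atBot.eventually (eventually_le_atBot (u 0))).exists
    obtain ⟨r₂, h2⟩ := (hv.tendsto_zero.eventually (lt_mem_nhds (hu.neg 0))).exists
    obtain ⟨r, -, hr⟩ := isPreconnected_univ.intermediate_value (mem_univ r₁) (mem_univ r₂)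
      hv.solves.1.continuous.continuousOn ⟨h1, h2.le⟩
    exact ⟨r, hr⟩
  refine ⟨-r, hv.unique (hu.comp_add_const (-r)) (t := r) ?_⟩
  rw [hr, add_neg_cancel]

theorem LimitProfile.exists_dilation (hu : LimitProfile n u) {ρ h : ℂ → ℝ}
    (H : IsEBPlane (coupling n) n ρ h) (hρ : IsRotInvariant ρ) (hh : IsRotInvariant h)
    (has : AsymptoticToCylinder (2 * n) ρ) :
    ∃ r : ℝ, 0 < r ∧ ∀ w : ℂ, ρ w = r ^ 2 * planeMetric n (1 / lamB n 0) u (r * w) ∧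
      h w = r ^ (2 * n) * planeHerm n u (r * w) := by
  obtain ⟨v, hv, rfl, rfl⟩ := exists_limitProfile_of_isEBPlane hu.one_le H hρ hh has
  obtain ⟨s, rfl⟩ := hu.exists_eq_comp_add hv
  exact ⟨Real.exp s, Real.exp_pos s, hu.plane_comp_add s⟩

end

section

variable {n : ℕ} {m b lam : ℝ} {u : ℝ → ℝ}

theorem higgs_eq (n : ℕ) (i : Fin 2) : higgs n i = fun z => z ^ n := by
  funext z
  fin_cases i <;> simp [higgs, homog]

/-! ### Yang's solutions -/

/-- Evenness of u is invariance under z ↦ 1/z, so the same radial function gives the metric in both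
charts. -/
theorem planeMetric_inv (hn : 1 ≤ n) (hu : ∀ t, u (-t) = u t) {w : ℂ} (hw : w ≠ 0) :
    planeMetric n m u w * ‖w‖ ^ 4 = planeMetric n m u w⁻¹ := by
  have e1 := planeMetric_mul (m := m) (u := u) hn (inv_ne_zero hw)
  have hw0 : ‖w‖ ≠ 0 := norm_ne_zero_iff.2 hw
  rw [norm_inv, Real.log_inv, hu, ← planeMetric_mul hn hw] at e1
  rw [eq_comm]
  field_simp at e1 ⊢
  linarith

theorem planeHerm_inv (hu : ∀ t, u (-t) = u t) {w : ℂ} (hw : w ≠ 0) :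
    planeHerm n u w * ‖w‖ ^ (2 * (2 * n)) = planeHerm n u w⁻¹ := by
  have e1 := planeHerm_mul (n := n) (u := u) (inv_ne_zero hw)
  have hw0 : ‖w‖ ^ (2 * n) ≠ 0 := pow_ne_zero _ (norm_ne_zero_iff.2 hw)
  rw [norm_inv, Real.log_inv, hu, ← planeHerm_mul (n := n) hw, inv_pow] at e1
  rw [mul_inv_eq_iff_eq_mul₀ hw0] at e1
  rw [e1, two_mul (2 * n), pow_add]
  ring

theorem solves_of_solvesODE (h : SolvesODE (coupling n) lam u) : Solves (1 / n) (1 / lam) u := by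
  rw [← two_mul_coupling]
  exact solvesODE_iff.1 h

theorem Profile.solvesODE (h : Profile n (1 / lam) u) : SolvesODE (coupling n) lam u := by
  rw [solvesODE_iff, two_mul_coupling]
  exact h.solves

theorem YangProfile.even (h : YangProfile n b m u) (t : ℝ) : u (-t) = u t :=
  h.solves.even h.one_le h.init_deriv t

/-- The Kähler metric on the projective line determined by Yang's profile. -/
noncomputable def YangProfile.kahler (h : YangProfile n b m u) : KahlerP1 where
  ρ _ := planeMetric n m u
  smooth _ := h.contDiff_planeMetric
  pos _ _ := h.factor_pos _
  compat _ hw := planeMetric_inv h.one_le h.even hw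

/-- The Hermitian metric on `O(2n)` determined by Yang's profile. -/
noncomputable def YangProfile.hermitian (h : YangProfile n b m u) : HermitianP1 (2 * n) where
  h _ := planeHerm n u
  smooth _ := h.contDiff_planeHerm
  pos _ _ := weight_pos _ _ _
  compat _ hw := planeHerm_inv h.even hw

theorem YangProfile.isYang (hlam : 0 < lam) (h : YangProfile n b (1 / lam) u) :
    IsYang n b lam u h.kahler h.hermitian where
  lam_pos := hlam
  ode := h.solvesODE
  init := h.init
  init_deriv := h.init_deriv
  at_top := h.at_top
  at_bot := h.at_bot
  given := givenBy_plane h.one_le lam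

variable {g : KahlerP1} {k : HermitianP1 (2 * n)}

theorem IsYang.yangProfile (H : IsYang n b lam u g k) (hn : 1 ≤ n) (hb : 0 < b) :
    YangProfile n b (1 / lam) u :=
  (yangProfile_iff hn hb).2 ⟨one_div_pos.2 H.lam_pos, solves_of_solvesODE H.ode, H.init,
    H.init_deriv, H.at_top, H.at_bot⟩

theorem IsYang.lam_eq (H : IsYang n b lam u g k) (hn : 1 ≤ n) (hb : 0 < b) : lam = lamB n b := by
  have := (H.yangProfile hn hb).eq
  rwa [one_div, one_div, inv_inj] at this

theorem IsYang.eq_plane (H : IsYang n b lam u g k) (hn : 1 ≤ n) (hb : 0 < b) (i : Fin 2) :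
    g.ρ i = planeMetric n (1 / lam) u ∧ k.h i = planeHerm n u := by
  have hu := H.yangProfile hn hb
  obtain ⟨e1, e2⟩ := hu.eq_plane rfl (g.smooth 0).continuous (k.smooth 0).continuous H.given
  fin_cases i
  · exact ⟨e1, e2⟩
  · refine ⟨eq_of_eq_on_compl_zero (g.smooth 1).continuous hu.contDiff_planeMetric.continuous
      fun w hw => ?_, eq_of_eq_on_compl_zero (k.smooth 1).continuous
      hu.contDiff_planeHerm.continuous fun w hw => ?_⟩
    · have h1 := g.compat w hw
      rw [e1, ← planeMetric_inv hn hu.even hw] at h1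
      exact mul_right_cancel₀ (pow_ne_zero _ (norm_ne_zero_iff.2 hw)) h1
    · have h1 := k.compat w hw
      rw [e2, ← planeHerm_inv hu.even hw] at h1
      exact mul_right_cancel₀ (pow_ne_zero _ (norm_ne_zero_iff.2 hw)) h1

theorem IsYang.isEBP1 (H : IsYang n b lam u g k) (hn : 1 ≤ n) (hb : 0 < b) :
    IsEBP1 (coupling n) n g k := fun i => by
  rw [higgs_eq, (H.eq_plane hn hb i).1, (H.eq_plane hn hb i).2]
  exact (H.yangProfile hn hb).solvesEB

theorem kahlerP1_ext {g g' : KahlerP1} (h : g.ρ = g'.ρ) : g = g' := by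
  cases g
  cases g'
  cases h
  rfl

theorem hermitianP1_ext {d : ℕ} {g g' : HermitianP1 d} (h : g.h = g'.h) : g = g' := by
  cases g
  cases g'
  cases h
  rfl

theorem existsUnique_isYang (hn : 1 ≤ n) (hb : 0 < b) :
    ∃! y : ℝ × (ℝ → ℝ) × KahlerP1 × HermitianP1 (2 * n),
      IsYang n b y.1 y.2.1 y.2.2.1 y.2.2.2 := by
  obtain ⟨u, hu⟩ := exists_yangProfile hn hb
  refine ⟨(lamB n b, u, hu.kahler, hu.hermitian), hu.isYang (lamB_pos hn b), ?_⟩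
  rintro ⟨lam, v, g, k⟩ H
  replace H : IsYang n b lam v g k := H
  obtain rfl := H.lam_eq hn hb
  have hv := H.yangProfile hn hb
  obtain rfl : u = v := hu.solves.unique (one_div_pos_of_one_le hn) hv.solves 0
    (hu.init.trans hv.init.symm) (hu.init_deriv.trans hv.init_deriv.symm)
  have e1 : g = hu.kahler := kahlerP1_ext (funext fun i => (H.eq_plane hn hb i).1)
  have e2 : k = hu.hermitian := hermitianP1_ext (funext fun i => (H.eq_plane hn hb i).2)
  rw [e1, e2]

/-! ### The limit problem -/

variable {c : ℝ} {ρ h : ℂ → ℝ}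

theorem IsLinet.eq_plane (H : IsLinet n c lam u ρ h) (hn : 1 ≤ n) :
    lam = lamB n 0 ∧ LimitProfile n u ∧ ρ = planeMetric n (1 / lamB n 0) u ∧
      h = planeHerm n u := by
  obtain ⟨e, hu⟩ := limitProfile_of_tendsto hn (one_div_pos.2 H.lam_pos)
    (solves_of_solvesODE H.ode) H.at_bot H.at_top
  rw [one_div, one_div, inv_inj] at e
  subst e
  exact ⟨rfl, hu, hu.eq_plane rfl H.cont_metric H.cont_herm H.given⟩

theorem LimitProfile.isLinet (hu : LimitProfile n u) (h0 : u 0 = -c) :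
    IsLinet n c (lamB n 0) u (planeMetric n (1 / lamB n 0) u) (planeHerm n u) where
  lam_pos := lamB_pos hu.one_le 0
  ode := hu.solvesODE
  init := h0
  at_bot := hu.at_bot
  at_top := hu.deriv_tendsto_zero
  cont_metric := hu.contDiff_planeMetric.continuous
  cont_herm := hu.contDiff_planeHerm.continuous
  given := givenBy_plane hu.one_le _

theorem existsUnique_isLinet (hn : 1 ≤ n) (hc : 0 < c) :
    ∃! y : ℝ × (ℝ → ℝ) × (ℂ → ℝ) × (ℂ → ℝ), IsLinet n c y.1 y.2.1 y.2.2.1 y.2.2.2 := by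
  obtain ⟨u, hu, h0⟩ := exists_limitProfile hn hc
  refine ⟨(lamB n 0, u, planeMetric n (1 / lamB n 0) u, planeHerm n u), hu.isLinet h0, ?_⟩
  rintro ⟨lam, v, ρ, h⟩ H
  replace H : IsLinet n c lam v ρ h := H
  obtain ⟨rfl, hv, rfl, rfl⟩ := H.eq_plane hn
  obtain rfl := hu.unique hv (t := 0) (h0.trans H.init.symm)
  rfl

theorem IsLinet.properties (H : IsLinet n c lam u ρ h) (hn : 1 ≤ n) :
    lam = lamB n 0 ∧
      IsEBPlane (coupling n) n ρ h ∧ IsRotInvariant ρ ∧ IsRotInvariant h ∧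
      IsCompleteMetric ρ ∧
      (∀ t : ℝ, 0 ≤ t →
        c * Real.exp (-(2 * n * √(coupling n) * t)) ≤ -u t ∧
        -u t ≤ c * Real.exp (-(2 * n * √(coupling n) *
          Real.exp (-coupling n * (Real.exp (-c) - (1 - c)) - c / 2) * t))) ∧
      (∀ l : ℕ, ∃ C : ℝ, ∀ ζ : ℂ, 0 ≤ ζ.re →
        ‖iteratedFDeriv ℝ l (fun ξ => cyl ρ ξ - 2 * n) ζ‖ ≤ C * u ζ.re ^ 2) ∧
      (∀ l : ℕ, ∃ C : ℝ, ∀ ζ : ℂ, 0 ≤ ζ.re →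
        ‖iteratedFDeriv ℝ l (cyl (curv h)) ζ‖ ≤ C * |u ζ.re|) ∧
      AsymptoticToCylinder (2 * n) ρ ∧ ExpDecay (cyl (curv h)) ∧
      Integrable (curv h) volume ∧ 1 / (2 * Real.pi) * ∫ z, curv h z = n ∧
      (∀ ρ' h' : ℂ → ℝ, IsEBPlane (coupling n) n ρ' h' →
        IsRotInvariant ρ' → IsRotInvariant h' → IsCompleteMetric ρ' →
        AsymptoticToCylinder (2 * n) ρ' →
        ∃ m : ℝ, 0 < m ∧ ∀ w : ℂ, ρ' w = m ^ 2 * ρ (m * w) ∧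
          h' w = m ^ (2 * n) * h (m * w)) := by
  obtain ⟨rfl, hu, rfl, rfl⟩ := H.eq_plane hn
  obtain ⟨h1, h2⟩ := hu.integral_curv hu.deriv_tendsto_zero
  exact ⟨rfl, hu.isEBPlane, isRotInvariant_planeMetric, isRotInvariant_planeHerm,
    hu.isCompleteMetric, fun t ht => ⟨hu.lower_bound H.init ht, hu.upper_bound H.init ht⟩,
    hu.metric_bound, hu.curv_bound, hu.asymptoticToCylinder, hu.expDecay_curv, h1, h2,
    fun _ _ hEB hρ hh _ has => hu.exists_dilation hEB hρ hh has⟩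

/-! ### The flat cylinder -/

theorem cyl_cylMetric (n : ℕ) (ζ : ℂ) : cyl (cylMetric n) ζ = 2 * n := by
  have := norm_ne_zero_iff.2 (Complex.exp_ne_zero ζ)
  rw [cyl, cylMetric]
  field_simp

theorem scal_cylMetric (hn : 1 ≤ n) {w : ℂ} (hw : w ≠ 0) : scal (cylMetric n) w = 0 := by
  have hn0 : (2 * n : ℝ) ≠ 0 := by positivity
  have := laplacian_of_log (F := fun w => Real.log (cylMetric n w))
    (f := fun t => Real.log (2 * n) - 2 * t) (f₁ := fun _ => -2) (f₂ := 0) hw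
    (fun z hz => by
      rw [cylMetric, Real.log_div hn0 (pow_ne_zero _ (norm_ne_zero_iff.2 hz)), Real.log_pow]
      norm_num)
    (fun t => by simpa using ((hasDerivAt_id t).const_mul 2).const_sub (Real.log (2 * n)))
    (hasDerivAt_const _ _)
  rw [scal, this]
  simp

theorem curv_cylHerm {w : ℂ} (hw : w ≠ 0) : curv (cylHerm n) w = 0 := by
  have := laplacian_of_log (F := fun w => Real.log (cylHerm n w))
    (f := fun t => -(2 * n * t)) (f₁ := fun _ => -(2 * n)) (f₂ := 0) hw
    (fun z hz => by
      rw [cylHerm, one_div, Real.log_inv, Real.log_pow]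
      push_cast
      ring)
    (fun t => ((hasDerivAt_id t).const_mul (2 * n : ℝ)).neg.congr_deriv (by simp))
    (hasDerivAt_const _ _)
  rw [curv, this]
  simp

end

/-! ### The limit based on the equator -/

theorem smoothConv_const {E : Type} [NormedAddCommGroup E] [NormedSpace ℝ E] (Ω : Set ℂ)
    (f : ℂ → E) : SmoothConv Ω (fun _ => f) f := fun _ _ _ _ _ hv =>
  Eventually.of_forall fun _ _ _ => refl_mem_uniformity hv

theorem solves_zero (a m : ℝ) : Solves a m 0 := by
  refine ⟨differentiable_const 0, fun t => ?_⟩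
  have : deriv (0 : ℝ → ℝ) = fun _ => 0 := funext fun t => deriv_const t 0
  rw [this]
  simpa [force] using hasDerivAt_const t (0 : ℝ)

section

variable {n : ℕ}

theorem tendsto_one_div_lamB (n : ℕ) :
    Tendsto (fun b => 1 / lamB n b) (𝓝[>] 0) (𝓝 (1 / lamB n 0)) := by
  simp only [one_div_lamB]
  have : Continuous fun b => 2 * n / pot (1 / n) (-b) :=
    continuous_const.div ((contDiff_pot (1 / n) (k := 0)).continuous.comp continuous_neg)
      fun b => (pot_pos _ _).ne'
  exact (this.tendsto 0).mono_left nhdsWithin_le_nhds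

theorem one_div_lamB_mul_pot_zero (n : ℕ) : 1 / lamB n 0 * pot (1 / n) 0 = 2 * n := by
  rw [one_div_lamB, neg_zero, div_mul_cancel₀ _ (pot_pos _ _).ne']

section Equator

variable {u : ℝ → ℝ → ℝ} (hu : ∀ b, 0 < b → YangProfile n b (1 / lamB n b) (u b))
include hu

/-- The equilibrium is placed at the index b = 0, so that the family and its limit form a single
family over b ≥ 0. The equilibrium is not a `Profile`; only the algebra in t = log |z| is available,
which is enough away from the zeros. -/
theorem solves_update (b : ℝ) (hb : b ∈ Ici (0 : ℝ)) :
    Solves (1 / n) (1 / lamB n b) (Function.update u 0 0 b) := by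
  rcases eq_or_ne b 0 with rfl | h
  · rw [Function.update_self]
    exact solves_zero _ _
  · rw [Function.update_of_ne h]
    exact (hu b (lt_of_le_of_ne hb h.symm)).solves

theorem contConv_equator (hn : 1 ≤ n) :
    ∀ f ∈ cylAlg n (fun b => 1 / lamB n b) (Function.update u 0 0),
      ContConv (𝓝[>] 0) univ f (f 0) := by
  refine contConv_cylAlg (profileConv_of_init hn (I := Ici 0)
    (mem_of_superset self_mem_nhdsWithin Ioi_subset_Ici_self) (mem_Ici.2 le_rfl)
    (solves_update hu) (tendsto_one_div_lamB n) ?_ ?_)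
  · have h : Tendsto (fun b : ℝ => -b) (𝓝[>] 0) (𝓝 0) := by
      have := (continuous_neg.tendsto (0 : ℝ)).mono_left (nhdsWithin_le_nhds (s := Ioi 0))
      rwa [neg_zero] at this
    rw [Function.update_self]
    refine h.congr' ?_
    filter_upwards [self_mem_nhdsWithin] with b hb
    rw [Function.update_of_ne (ne_of_gt hb), (hu b hb).init]
  · have h0 : deriv (0 : ℝ → ℝ) 0 = 0 := deriv_const 0 0
    rw [Function.update_self, h0]
    refine tendsto_const_nhds.congr' ?_
    filter_upwards [self_mem_nhdsWithin] with b hb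
    rw [Function.update_of_ne (ne_of_gt hb), (hu b hb).init_deriv]

theorem smoothConv_equator (hn : 1 ≤ n) {f : ℝ → ℝ → ℝ}
    (hf : f ∈ cylAlg n (fun b => 1 / lamB n b) (Function.update u 0 0)) {L : ℂ → ℝ}
    (hL : ContDiffOn ℝ ∞ L {0}ᶜ) {F : ℝ → ℂ → ℝ} {F₀ : ℂ → ℝ}
    (hF : ∀ b, 0 < b → ∀ z : ℂ, z ≠ 0 → F b z = f b (Real.log ‖z‖) * L z)
    (hF₀ : ∀ z : ℂ, z ≠ 0 → F₀ z = f 0 (Real.log ‖z‖) * L z) : SmoothConv {0}ᶜ F F₀ :=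
  (diffAlg_cylAlg (solves_update hu)).smoothConv isOpen_compl_singleton (mapsTo_univ _ _)
    (fun _ hz => ((contDiffAt_norm ℝ hz).log (norm_ne_zero_iff.2 hz)).contDiffWithinAt)
    (mem_of_superset self_mem_nhdsWithin Ioi_subset_Ici_self) (mem_Ici.2 le_rfl)
    (contConv_equator hu hn) hL hf
    (fun b hb hb0 z hz => hF b (lt_of_le_of_ne hb hb0.symm) z hz) (fun z hz => hF₀ z hz)

end Equator

theorem metric_mem_cylAlg {ι : Type*} {M : ι → ℝ} {U : ι → ℝ → ℝ} :
    (fun i t => M i * pot (1 / n) (U i t)) ∈ cylAlg n M U :=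
  mul_mem param_mem_cylAlg pot_mem_cylAlg

theorem exp_mem_cylAlg {ι : Type*} {M : ι → ℝ} {U : ι → ℝ → ℝ} :
    (fun i t => Real.exp (U i t)) ∈ cylAlg n M U := by
  have := add_mem (exp_sub_one_mem_cylAlg (n := n) (M := M) (U := U)) (one_mem _)
  convert this using 1
  funext i t
  simp

theorem contDiffOn_one_div_norm_pow (k : ℕ) :
    ContDiffOn ℝ ∞ (fun z : ℂ => 1 / ‖z‖ ^ k) {0}ᶜ := fun _ hz =>
  (contDiffAt_const.div ((contDiffAt_norm ℝ hz).pow k)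
    (pow_ne_zero _ (norm_ne_zero_iff.2 hz))).contDiffWithinAt

section Family

variable {lam : ℝ → ℝ} {u : ℝ → ℝ → ℝ} {g : ℝ → KahlerP1} {h : ℝ → HermitianP1 (2 * n)}
  (H : ∀ b, 0 < b → IsYang n b (lam b) (u b) (g b) (h b))
include H

theorem yangProfile_family (hn : 1 ≤ n) (b : ℝ) (hb : 0 < b) :
    YangProfile n b (1 / lamB n b) (u b) := by
  rw [← (H b hb).lam_eq hn hb]
  exact (H b hb).yangProfile hn hb

theorem eq_plane_family (hn : 1 ≤ n) (b : ℝ) (hb : 0 < b) (i : Fin 2) :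
    (g b).ρ i = planeMetric n (1 / lamB n b) (u b) ∧ (h b).h i = planeHerm n (u b) := by
  rw [← (H b hb).lam_eq hn hb]
  exact (H b hb).eq_plane hn hb i

/-- The limit of Yang's solutions based at a point of the equator. -/
theorem pointedConv_equator (hn : 1 ≤ n) {p : ℂ} (hp : ‖p‖ = 1) :
    PointedConv (fun b => (g b).ρ 0) (fun b => (h b).h 0) (fun _ => higgs n 0) (fun _ => p)
      {0}ᶜ (cylMetric n) (cylHerm n) (fun w => w ^ n) p (fun _ w => w) (fun _ _ => 1) where
  isOpen := isOpen_compl_singleton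
  base_mem := norm_ne_zero_iff.1 (by rw [hp]; exact one_ne_zero)
  holo := Eventually.of_forall fun _ => differentiableOn_id
  inj := Eventually.of_forall fun _ => injOn_id _
  base := Eventually.of_forall fun _ => rfl
  lift_holo := Eventually.of_forall fun _ => differentiableOn_const 1
  lift_ne := Eventually.of_forall fun _ _ _ => one_ne_zero
  metric := by
    refine smoothConv_equator (yangProfile_family H hn) hn metric_mem_cylAlg
      (contDiffOn_one_div_norm_pow 2) (fun b hb z hz => ?_) (fun z _ => ?_)
    · have hz0 : ‖z‖ ^ 2 ≠ 0 := pow_ne_zero _ (norm_ne_zero_iff.2 hz)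
      rw [(eq_plane_family H hn b hb 0).1, Function.update_of_ne hb.ne', ← planeMetric_mul hn hz]
      simp [hz0]
    · rw [Function.update_self, Pi.zero_apply, one_div_lamB_mul_pot_zero, cylMetric]
      ring
  herm := by
    refine smoothConv_equator (yangProfile_family H hn) hn exp_mem_cylAlg
      (contDiffOn_one_div_norm_pow (2 * n)) (fun b hb z hz => ?_) (fun z _ => ?_)
    · have hz0 : ‖z‖ ^ (2 * n) ≠ 0 := pow_ne_zero _ (norm_ne_zero_iff.2 hz)
      rw [(eq_plane_family H hn b hb 0).2, Function.update_of_ne hb.ne',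
        ← planeHerm_mul (n := n) hz, norm_one]
      field_simp
    · rw [Function.update_self, Pi.zero_apply, Real.exp_zero, cylHerm, one_mul]
  section_conv := by
    simp only [higgs_eq, div_one]
    exact smoothConv_const _ _

theorem smoothConv_stateFn (hn : 1 ≤ n) :
    SmoothConv {0}ᶜ (fun b => stateFn ((h b).h 0) (higgs n 0)) (fun _ => 1) := by
  refine smoothConv_equator (yangProfile_family H hn) hn exp_mem_cylAlg (L := fun _ => 1)
    contDiffOn_const (fun b hb z hz => ?_) (fun z _ => ?_)
  · rw [(eq_plane_family H hn b hb 0).2, Function.update_of_ne hb.ne',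
      ← planeHerm_mul (n := n) hz, stateFn, higgs_eq, norm_pow, ← pow_mul, mul_comm n, mul_one]
  · rw [Function.update_self, Pi.zero_apply, Real.exp_zero, one_mul]

end Family

/-! ### The diameter -/

/-- From |u'| < 2n follows u ≥ -b - 2n|t|, which the exponent 1/n turns into the factor e^{-2|t|};
moreover m `pot` (-b) = 2n ≥ 1. The bound is uniform in b and is used in the caps, where convergence
on compact sets of t gives nothing. -/
theorem YangProfile.le_metric {b m : ℝ} {u : ℝ → ℝ} (h : YangProfile n b m u) (t : ℝ) :
    Real.exp (-(2 * |t|)) ≤ m * pot (1 / n) (u t) := by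
  have hn := h.n_pos
  have h1 : |u t - u 0| ≤ 2 * n * |t| := by
    have := convex_univ.norm_image_sub_le_of_norm_deriv_le (f := u) (C := 2 * n)
      (fun x _ => h.solves.1 x) (fun x _ => (h.abs_deriv_lt x).le) (mem_univ 0) (mem_univ t)
    simpa using this
  rw [h.init] at h1
  have h2 := Real.exp_le_exp.2 (h.le t)
  have h3 : (1 : ℝ) ≤ 2 * n := by
    have : (1 : ℝ) ≤ n := by exact_mod_cast h.one_le
    linarith
  have h4 : pot (1 / n) (-b) * Real.exp (-(2 * |t|)) ≤ pot (1 / n) (u t) := by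
    rw [pot, pot, ← Real.exp_add, Real.exp_le_exp]
    have h5 : -b - Real.exp (-b) - 2 * n * |t| ≤ u t - Real.exp (u t) := by
      linarith [(abs_le.1 h1).1]
    calc 1 / n * (-b - Real.exp (-b)) + -(2 * |t|)
        = 1 / n * (-b - Real.exp (-b) - 2 * n * |t|) := by field_simp; ring
      _ ≤ _ := by gcongr
  rw [h.eq, one_div_lamB, div_mul_eq_mul_div, le_div_iff₀ (pot_pos _ _), mul_comm]
  calc pot (1 / n) (-b) * Real.exp (-(2 * |t|)) ≤ pot (1 / n) (u t) := h4
    _ ≤ 2 * n * pot (1 / n) (u t) := le_mul_of_one_le_left (pot_pos _ _).le h3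

/-- In the caps the gradient of the gauge is compared with `le_metric`, on the cylinder with the
hypothesis ρ |z|² ≥ 1. The factor 2 is slack. -/
theorem YangProfile.norm_fderiv_gaugeChart_le {b m K : ℝ} {u : ℝ → ℝ} (h : YangProfile n b m u)
    (hK : 1 < K) (hR : ∀ t ∈ Icc (-Real.log K) (Real.log K), 1 ≤ m * pot (1 / n) (u t)) (z : ℂ) :
    ‖fderiv ℝ (gaugeChart K) z‖ ≤ 2 * √(planeMetric n m u z) := by
  rcases eq_or_ne z 0 with rfl | hz
  · rw [norm_fderiv_gaugeChart hK]
    simp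
  have hz0 := norm_pos_iff.2 hz
  have hK0 : 0 < K := by linarith
  have hρ := planeMetric_mul (m := m) (u := u) h.one_le hz
  obtain ⟨g1, g2, g3⟩ := EinsteinBogomolnyi.norm_fderiv_gaugeChart_le hK z
  have hle := h.le_metric (Real.log ‖z‖)
  rw [← hρ] at hle
  have key : ∀ a : ℝ, a ^ 2 * ‖z‖ ^ 2 ≤ planeMetric n m u z * ‖z‖ ^ 2 →
      a ≤ 2 * √(planeMetric n m u z) := fun a ha => by
    have h1 := Real.le_sqrt_of_sq_le (le_of_mul_le_mul_right ha (by positivity))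
    linarith [Real.sqrt_nonneg (planeMetric n m u z)]
  have hexp : Real.exp (2 * Real.log ‖z‖) = ‖z‖ ^ 2 := by
    rw [mul_comm, Real.exp_mul, Real.exp_log hz0]
    norm_num
  rcases le_or_gt ‖z‖ (1 / K) with h1 | h1
  · refine (g1 h1).trans (key 1 ?_)
    have h2 : Real.log ‖z‖ ≤ 0 := Real.log_nonpos hz0.le
      (h1.trans ((div_le_one hK0).2 hK.le))
    rw [abs_of_nonpos h2, mul_neg, neg_neg, hexp] at hle
    linarith
  rcases le_or_gt K ‖z‖ with h2 | h2
  · refine (g3 h2).trans (key _ ?_)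
    have h3 : 0 ≤ Real.log ‖z‖ := Real.log_nonneg (hK.le.trans h2)
    rw [abs_of_nonneg h3, Real.exp_neg, hexp] at hle
    refine le_trans (le_of_eq ?_) hle
    field_simp
  · refine (g2 hz).trans (key _ ?_)
    rw [hρ, div_pow, one_pow, one_div, inv_mul_cancel₀ (by positivity)]
    refine hR _ ⟨?_, Real.log_le_log hz0 h2.le⟩
    rw [← Real.log_inv, ← one_div]
    exact Real.log_le_log (by positivity) h1.le

theorem tendsto_diamP1 (hn : 1 ≤ n) {lam : ℝ → ℝ} {u : ℝ → ℝ → ℝ} {g : ℝ → KahlerP1}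
    {h : ℝ → HermitianP1 (2 * n)} (H : ∀ b, 0 < b → IsYang n b (lam b) (u b) (g b) (h b)) :
    Tendsto (fun b => diamP1 (g b)) (𝓝[>] 0) (𝓝 ⊤) := by
  rw [ENNReal.tendsto_nhds_top_iff_nnreal]
  intro x
  -- Chosen so that the lower bound log K / 2 for the diameter is x + 1.
  set K := Real.exp (2 * (x + 1)) with hKdef
  have hK : 1 < K := Real.one_lt_exp_iff.2 (by positivity)
  have hn1 : (1 : ℝ) ≤ n := by exact_mod_cast hn
  have hu := yangProfile_family H hn
  have h0 : ContinuousOn (fun t => 1 / lamB n 0 * pot (1 / n) (Function.update u 0 0 0 t)) univ := by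
    simp only [Function.update_self, Pi.zero_apply]
    exact continuousOn_const
  have hc := (contConv_equator hu hn _ metric_mem_cylAlg).tendstoUniformlyOn h0
    (isCompact_Icc (a := -Real.log K) (b := Real.log K)) (subset_univ _)
  -- On |t| ≤ log K the conformal factor is eventually within 1 of 2n, hence at least 2n - 1 ≥ 1.
  filter_upwards [Metric.tendstoUniformlyOn_iff.1 hc 1 one_pos, self_mem_nhdsWithin] with b hb hb0
  have hR : ∀ t ∈ Icc (-Real.log K) (Real.log K), 1 ≤ 1 / lamB n b * pot (1 / n) (u b t) := by
    intro t ht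
    have h1 := hb t ht
    rw [Function.update_self, Pi.zero_apply, one_div_lamB_mul_pot_zero,
      Function.update_of_ne (ne_of_gt hb0), Real.dist_eq] at h1
    linarith [(abs_lt.1 h1).2]
  refine lt_of_lt_of_le ?_ (log_le_diamP1 hK fun i z => ?_)
  · rw [hKdef, Real.log_exp, mul_div_cancel_left₀ _ two_ne_zero, ENNReal.lt_ofReal_iff_toReal_lt
      ENNReal.coe_ne_top]
    simp
  · rw [(eq_plane_family H hn b hb0 i).1]
    exact (hu b hb0).norm_fderiv_gaugeChart_le hK hR z

/-! ### The limit at a zero -/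

namespace YangProfile

variable {b m c : ℝ} {u : ℝ → ℝ} (h : YangProfile n b m u)
include h

theorem deriv_pos {t : ℝ} (ht : t < 0) : 0 < deriv u t := h.init_deriv ▸ h.strictAnti ht

theorem existsUnique_eq (hbc : b < c) : ∃! t : ℝ, t < 0 ∧ u t = -c := by
  have hmono : StrictMonoOn u (Iic 0) := strictMonoOn_of_deriv_pos (convex_Iic 0)
    h.solves.1.continuous.continuousOn fun t ht => h.deriv_pos (by simpa using ht)
  obtain ⟨s, hs, hs0⟩ := ((h.tendsto_atBot.eventually (eventually_le_atBot (-c))).and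
    (eventually_le_atBot 0)).exists
  obtain ⟨t, ht, htc⟩ := intermediate_value_Icc hs0 h.solves.1.continuous.continuousOn
    ⟨hs, by rw [h.init]; linarith⟩
  have hlt : t < 0 := lt_of_le_of_ne ht.2 fun h0 => by
    rw [h0, h.init] at htc
    linarith
  exact ⟨t, ⟨hlt, htc⟩, fun r hr => hmono.injOn hr.1.le hlt.le (hr.2.trans htc.symm)⟩

/-- Before its maximum the profile is increasing, so its slope is a continuous function of m and of
the height alone. -/
theorem deriv_eq_sqrt {t : ℝ} (ht : t < 0) :
    deriv u t = √((2 * n) ^ 2 - 2 * n * (m * pot (1 / n) (u t))) := by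
  rw [← Real.sqrt_sq (h.deriv_pos ht).le]
  congr 1
  linarith [h.energy t]

end YangProfile

theorem LimitProfile.deriv_eq_sqrt {u : ℝ → ℝ} (h : LimitProfile n u) (t : ℝ) :
    deriv u t = √((2 * n) ^ 2 - 2 * n * (1 / lamB n 0 * pot (1 / n) (u t))) := by
  rw [← Real.sqrt_sq (h.deriv_pos t).le]
  congr 1
  linarith [h.energy t]

section Zero

variable {c : ℝ} {u : ℝ → ℝ → ℝ} {T : ℝ → ℝ} {u₀ : ℝ → ℝ}
  (hc : 0 < c) (hu : ∀ b, 0 < b → YangProfile n b (1 / lamB n b) (u b))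
  (hT : ∀ b ∈ Ioo 0 c, T b < 0 ∧ u b (T b) = -c) (hu₀ : LimitProfile n u₀) (h0 : u₀ 0 = -c)

/-- Yang's profiles, translated by `T b`, and the profile `u₀` at `b = 0`. -/
noncomputable def shifted (u : ℝ → ℝ → ℝ) (T : ℝ → ℝ) (u₀ : ℝ → ℝ) : ℝ → ℝ → ℝ :=
  Function.update (fun b t => u b (t + T b)) 0 u₀

include hu hu₀ in
theorem profile_shifted (b : ℝ) (hb : b ∈ Ico 0 c) :
    Profile n (1 / lamB n b) (shifted u T u₀ b) := by
  rcases eq_or_ne b 0 with rfl | h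
  · rw [shifted, Function.update_self]
    exact hu₀.toProfile
  · rw [shifted, Function.update_of_ne h]
    exact (hu b (lt_of_le_of_ne hb.1 h.symm)).toProfile.comp_add_const (T b)

-- At time 0 all shifted profiles have height -c, and their slopes there depend only on m and c and
-- converge with m. Nothing needs to be known about the size of T b.
include hc hu hT hu₀ h0 in
theorem profileConv_shifted :
    ProfileConv n (𝓝[>] 0) (fun b => 1 / lamB n b) (shifted u T u₀) (1 / lamB n 0)
      (shifted u T u₀ 0) := by
  have hmem : Ioo 0 c ∈ 𝓝[>] (0 : ℝ) := Ioo_mem_nhdsGT hc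
  refine profileConv_of_init hu₀.one_le (I := Ico 0 c) (mem_of_superset hmem Ioo_subset_Ico_self)
    (left_mem_Ico.2 hc) (fun b hb => (profile_shifted hu hu₀ b hb).solves)
    (tendsto_one_div_lamB n) ?_ ?_
  · refine tendsto_const_nhds.congr' ?_
    filter_upwards [hmem] with b hb
    rw [shifted, Function.update_self, Function.update_of_ne (ne_of_gt hb.1), zero_add,
      (hT b hb).2, h0]
  · have h1 : Tendsto (fun b => √((2 * n) ^ 2 - 2 * n * (1 / lamB n b * pot (1 / n) (-c))))
        (𝓝[>] 0) (𝓝 (√((2 * n) ^ 2 - 2 * n * (1 / lamB n 0 * pot (1 / n) (-c))))) :=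
      (((((tendsto_one_div_lamB n).mul_const _).const_mul _).const_sub _)).sqrt
    have e : deriv (shifted u T u₀ 0) 0 =
        √((2 * n) ^ 2 - 2 * n * (1 / lamB n 0 * pot (1 / n) (-c))) := by
      rw [shifted, Function.update_self, hu₀.deriv_eq_sqrt, h0]
    rw [e]
    refine h1.congr' ?_
    filter_upwards [hmem] with b hb
    rw [shifted, Function.update_of_ne (ne_of_gt hb.1), deriv_comp_add_const, zero_add,
      (hu b hb.1).deriv_eq_sqrt (hT b hb).1, (hT b hb).2]

include hc hu hT hu₀ h0 in
theorem smoothConv_shifted {f : ℝ → ℝ → ℝ}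
    (hf : f ∈ planeAlg n (fun b => 1 / lamB n b) (shifted u T u₀)) {F : ℝ → ℂ → ℝ} {F₀ : ℂ → ℝ}
    (hF : ∀ b ∈ Ioo 0 c, ∀ z, F b z = f b (‖z‖ ^ 2)) (hF₀ : ∀ z, F₀ z = f 0 (‖z‖ ^ 2)) :
    SmoothConv univ F F₀ := by
  have hmem : Ico 0 c ∈ 𝓝[>] (0 : ℝ) := mem_of_superset (Ioo_mem_nhdsGT hc) Ioo_subset_Ico_self
  refine (diffAlg_planeAlg (profile_shifted hu hu₀)).smoothConv isOpen_univ (mapsTo_norm_sq univ)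
    (contDiffOn_norm_sq univ) hmem (left_mem_Ico.2 hc)
    (contConv_planeAlg hmem (left_mem_Ico.2 hc) (profile_shifted hu hu₀)
      (profileConv_shifted hc hu hT hu₀ h0)) (L := fun _ => (1 : ℝ)) contDiffOn_const hf
    (fun b hb hb0 z _ => ?_) (fun z _ => ?_)
  · rw [hF b ⟨lt_of_le_of_ne hb.1 hb0.symm, hb.2⟩ z, smul_eq_mul, mul_one]
  · rw [hF₀ z, smul_eq_mul, mul_one]

end Zero

/-- The limit of Yang's solutions based at a zero of the Higgs field. -/
theorem pointedConv_zero (hn : 1 ≤ n) {lam : ℝ → ℝ} {u : ℝ → ℝ → ℝ} {g : ℝ → KahlerP1}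
    {h : ℝ → HermitianP1 (2 * n)} (H : ∀ b, 0 < b → IsYang n b (lam b) (u b) (g b) (h b))
    {c : ℝ} (hc : 0 < c) {T : ℝ → ℝ} (hT : ∀ b ∈ Ioo 0 c, T b < 0 ∧ u b (T b) = -c)
    {u₀ : ℝ → ℝ} (hu₀ : LimitProfile n u₀) (h0 : u₀ 0 = -c) (i : Fin 2) :
    PointedConv (fun b => (g b).ρ i) (fun b => (h b).h i) (fun _ => higgs n i) (fun _ => 0)
      univ (planeMetric n (1 / lamB n 0) u₀) (planeHerm n u₀) (fun w => w ^ n) 0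
      (fun b w => (Real.exp (T b) : ℂ) * w) (fun b _ => (Real.exp (T b) : ℂ) ^ n) := by
  have hu := yangProfile_family H hn
  have he : ∀ b, (Real.exp (T b) : ℂ) ≠ 0 := fun b => by
    exact_mod_cast (Real.exp_pos (T b)).ne'
  refine ⟨isOpen_univ, mem_univ _, Eventually.of_forall fun b => ?_,
    Eventually.of_forall fun b => (mul_right_injective₀ (he b)).injOn,
    Eventually.of_forall fun b => mul_zero _,
    Eventually.of_forall fun b => differentiableOn_const _,
    Eventually.of_forall fun b _ _ => pow_ne_zero _ (he b), ?_, ?_, ?_⟩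
  · exact (differentiable_id.const_mul _).differentiableOn
  · refine smoothConv_shifted hc hu hT hu₀ h0 factor_mem_planeAlg (fun b hb z => ?_) fun z => ?_
    · have hd : deriv (fun w => (Real.exp (T b) : ℂ) * w) z = (Real.exp (T b) : ℂ) := by
        simp
      rw [(eq_plane_family H hn b hb.1 i).1, hd, norm_ofReal_exp, mul_comm, shifted,
        Function.update_of_ne (ne_of_gt hb.1)]
      exact ((hu b hb.1).plane_comp_add (T b) z).1.symm
    · rw [shifted, Function.update_self]
      rfl
  · refine smoothConv_shifted hc hu hT hu₀ h0 weight_mem_planeAlg (fun b hb z => ?_) fun z => ?_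
    · rw [(eq_plane_family H hn b hb.1 i).2, norm_pow, norm_ofReal_exp, ← pow_mul, mul_comm n,
        mul_comm, shifted, Function.update_of_ne (ne_of_gt hb.1)]
      exact ((hu b hb.1).plane_comp_add (T b) z).2.symm
    · rw [shifted, Function.update_self]
      rfl
  · have e : (fun (b : ℝ) (w : ℂ) => higgs n i ((Real.exp (T b) : ℂ) * w) /
        (Real.exp (T b) : ℂ) ^ n) = fun _ w => w ^ n := by
      funext b w
      simp only [higgs_eq]
      rw [mul_pow, mul_div_cancel_left₀ _ (pow_ne_zero _ (he b))]
    rw [e]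
    exact smoothConv_const _ _

end

end EinsteinBogomolnyi

/-! ### The main theorem -/

theorem mainTheorem7 (n : ℕ) (hn : 1 ≤ n) :
    -- Yang's solutions: existence, uniqueness, value of the parameter, Einstein-Bogomol'nyi
    (∀ b : ℝ, 0 < b →
      (∃! y : ℝ × (ℝ → ℝ) × KahlerP1 × HermitianP1 (2 * n),
        IsYang n b y.1 y.2.1 y.2.2.1 y.2.2.2) ∧
      ∀ lam u g h, IsYang n b lam u g h → lam = lamB n b ∧ IsEBP1 (coupling n) n g h) ∧
    -- the limit problem: existence and uniqueness for each initial value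
    (∀ c : ℝ, 0 < c →
      ∃! y : ℝ × (ℝ → ℝ) × (ℂ → ℝ) × (ℂ → ℝ), IsLinet n c y.1 y.2.1 y.2.2.1 y.2.2.2) ∧
    -- properties of the solution of the limit problem
    (∀ (c lam : ℝ) (u : ℝ → ℝ) (ρ h : ℂ → ℝ), 0 < c → IsLinet n c lam u ρ h →
      lam = lamB n 0 ∧
      IsEBPlane (coupling n) n ρ h ∧ IsRotInvariant ρ ∧ IsRotInvariant h ∧
      IsCompleteMetric ρ ∧
      -- exponential rates
      (∀ t : ℝ, 0 ≤ t →
        c * Real.exp (-(2 * n * √(coupling n) * t)) ≤ -u t ∧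
        -u t ≤ c * Real.exp (-(2 * n * √(coupling n) *
          Real.exp (-coupling n * (Real.exp (-c) - (1 - c)) - c / 2) * t))) ∧
      (∀ l : ℕ, ∃ C : ℝ, ∀ ζ : ℂ, 0 ≤ ζ.re →
        ‖iteratedFDeriv ℝ l (fun ξ => cyl ρ ξ - 2 * n) ζ‖ ≤ C * u ζ.re ^ 2) ∧
      (∀ l : ℕ, ∃ C : ℝ, ∀ ζ : ℂ, 0 ≤ ζ.re →
        ‖iteratedFDeriv ℝ l (cyl (curv h)) ζ‖ ≤ C * |u ζ.re|) ∧
      AsymptoticToCylinder (2 * n) ρ ∧ ExpDecay (cyl (curv h)) ∧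
      -- total string number `n`
      Integrable (curv h) volume ∧ 1 / (2 * Real.pi) * ∫ z, curv h z = n ∧
      -- uniqueness up to dilation
      (∀ ρ' h' : ℂ → ℝ, IsEBPlane (coupling n) n ρ' h' →
        IsRotInvariant ρ' → IsRotInvariant h' → IsCompleteMetric ρ' →
        AsymptoticToCylinder (2 * n) ρ' →
        ∃ m : ℝ, 0 < m ∧ ∀ w : ℂ, ρ' w = m ^ 2 * ρ (m * w) ∧ h' w = m ^ (2 * n) * h (m * w))) ∧
    -- the cylinder and its Hermitian metric are flat
    (∀ ζ : ℂ, cyl (cylMetric n) ζ = 2 * n) ∧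
    (∀ w : ℂ, w ≠ 0 → scal (cylMetric n) w = 0 ∧ curv (cylHerm n) w = 0) ∧
    -- behaviour of Yang's solutions as `b → 0+`
    (∀ (lam : ℝ → ℝ) (u : ℝ → ℝ → ℝ) (g : ℝ → KahlerP1) (h : ℝ → HermitianP1 (2 * n)),
      (∀ b, 0 < b → IsYang n b (lam b) (u b) (g b) (h b)) →
      -- the diameter tends to infinity
      Tendsto (fun b => diamP1 (g b)) (𝓝[>] 0) (𝓝 ⊤) ∧
      -- limit based at a point of the equator
      (∀ p : ℂ, ‖p‖ = 1 →
        PointedConv (fun b => (g b).ρ 0) (fun b => (h b).h 0) (fun _ => higgs n 0) (fun _ => p)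
          {0}ᶜ (cylMetric n) (cylHerm n) (fun w => w ^ n) p (fun _ w => w) (fun _ _ => 1) ∧
        SmoothConv {0}ᶜ (fun b => stateFn ((h b).h 0) (higgs n 0)) (fun _ => 1)) ∧
      -- limit based at either of the two zeros of the Higgs field
      (∀ c : ℝ, 0 < c →
        (∀ b ∈ Ioo 0 c, ∃! t : ℝ, t < 0 ∧ u b t = -c) ∧
        ∀ T : ℝ → ℝ, (∀ b ∈ Ioo 0 c, T b < 0 ∧ u b (T b) = -c) →
        ∀ (lam₀ : ℝ) (u₀ : ℝ → ℝ) (ρ₀ h₀ : ℂ → ℝ), IsLinet n c lam₀ u₀ ρ₀ h₀ →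
        ∀ i : Fin 2,
          PointedConv (fun b => (g b).ρ i) (fun b => (h b).h i) (fun _ => higgs n i) (fun _ => 0)
            univ ρ₀ h₀ (fun w => w ^ n) 0
            (fun b w => (Real.exp (T b) : ℂ) * w) (fun b _ => (Real.exp (T b) : ℂ) ^ n))) :=
  ⟨fun _ hb => ⟨existsUnique_isYang hn hb, fun _ _ _ _ H => ⟨H.lam_eq hn hb, H.isEBP1 hn hb⟩⟩,
    fun _ hc => existsUnique_isLinet hn hc, fun _ _ _ _ _ _ H => H.properties hn,
    cyl_cylMetric n, fun _ hw => ⟨scal_cylMetric hn hw, curv_cylHerm hw⟩, fun _ _ _ _ H =>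
    ⟨tendsto_diamP1 hn H, fun _ hp => ⟨pointedConv_equator H hn hp, smoothConv_stateFn H hn⟩,
      fun _ hc => ⟨fun b hb => (yangProfile_family H hn b hb.1).existsUnique_eq hb.2,
        fun _ hT _ _ _ _ H₀ i => by
          obtain ⟨-, hu₀, rfl, rfl⟩ := H₀.eq_plane hn
          exact pointedConv_zero hn H hc hT hu₀ H₀.init i⟩⟩⟩
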